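/- Let $(\mathbb S,\mathcal S)$ be a measurable space, $\Psi:\mathbb R\times\mathbb S\to\mathbb R$ measurable, and let $\{X_t:t\in\mathbb Z\}$ be a strictly stationary process such that $(X_t)_{t\ge 0}$ has the law of a chain given by $X_t=\Psi(X_{t-1},\varepsilon_t)$, $t\ge1$, where $\varepsilon_1,\varepsilon_2,\dots$ are i.i.d. random elements of $\mathbb S$, independent of the initial value $X_0$. Assume: (a) There are $0<\alpha<\infty$ and $0\le p\le 1$ with $\lim_{x\to\infty}\Pr(|X_0|>xy)/\Pr(|X_0|>x)=y^{-\alpha}$ for all $y>0$ and $\lim_{x\to\infty}\Pr(X_0>x)/\Pr(|X_0|>x)=p$. Put $p(+1)=p$, $p(-1)=1-p$. (b) There is a measurable $\mathbb V\subset\mathbb S$ with $\Pr(\varepsilon_1\in\mathbb V)=1$ such that for every $\sigma\in\{-1,1\}$ with $p(\sigma)>0$ and every $v\in\mathbb V$ the limit $\phi(v,\sigma)=\lim_{x\to\sigma\infty}x^{-1}\Psi(x,v)$ exists in $\mathbb R$. Moreover, if $\Pr[\phi(\varepsilon_1,\sigma)=0]>0$ for some $\sigma$ with $p(\sigma)>0$,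 then there is a measurable $\mathbb W\subset\mathbb V$ with $\Pr(\varepsilon_1\in\mathbb W)=1$ such that for all $v\in\mathbb W$, $\sup_{|y|\le x}|\Psi(y,v)|=O(x)$ as $x\to\infty$. Let $\mu$ be the law of $(M_0,M_1)$, where $M_1=M_0\,\phi(\varepsilon_1,\operatorname{sign}M_0)$, $\Pr(M_0=\sigma)=p(\sigma)$ for $\sigma\in\{-1,1\}$, and $M_0$ is independent of $\varepsilon_1$. Definitions. Write $(x)_+=\max(x,0)$. Let $\mathcal M_{p,\alpha}$ be the set of laws of random pairs $(I,M)$ in $\{-1,1\}\times\mathbb R$ with $\Pr(I=1)=p=1-\Pr(I=-1)$ and $\mathrm E[(\sigma M)_+^\alpha]\le\Pr(I=\sigma)$ for $\sigma\in\{-1,1\}$. Two laws $\mathcal L(I,M)$ and $\mathcal L(I^*,M^*)$ in $\mathcal M_{p,\alpha}$ are adjoint if $\mathrm E[(xI)_+^\alpha\wedge(yM)_+^\alpha]=\mathrm E[(xM^*)_+^\alpha\wedge(yI^*)_+^\alpha]$ for all $x,y\in\mathbb R$. For $\kappa=\mathcal L(I,M)\in\mathcal M_{p,\alpha}$ let $T_\kappa(x)=\mathcal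 L(xM/I\mid I=\operatorname{sign}x)$ if $x\ne0$, and $T_\kappa(0)=\delta_0$. A process $\{M_t:t\in\mathbb Z\}$ is a back-and-forth tail chain $\mathrm{BFTC}(\alpha,\mu)$ with $\mu\in\mathcal M_{p,\alpha}$ if $\mathcal L(M_0,M_1)=\mu$, if $\mu^*=\mathcal L(M_0,M_{-1})$ lies in $\mathcal M_{p,\alpha}$ and is adjoint to $\mu$, and if for every integer $t\ge1$, almost surely, the conditional law of $M_t$ given $(M_j)_{j<t}$ is $T_\mu(M_{t-1})$ and the conditional law of $M_{-t}$ given $(M_j)_{j>-t}$ is $T_{\mu^*}(M_{-t+1})$. Then there exist a random variable $Y$ and a process $\{M_t:t\in\mathbb Z\}$ on a common probability space such that (i) $Y$ is independent of $\{M_t:t\in\mathbb Z\}$; (ii) $\Pr(Y>y)=y^{-\alpha}$ for $y\ge1$; (iii) $\{M_t\}$ is a $\mathrm{BFTC}(\alpha,\mu)$ (in particular $\mu\in\mathcal M_{p,\alpha}$). For every such $Y$ and $\{M_t\}$ and all integers $s,t\ge0$, as $x\to\infty$, $$\mathcal L\Bigl(\frac{|X_0|}{x},\frac{X_{-s}}{|X_0|},\dots,\frac{X_t}{|X_0|}\Bigm||X_0|>x\Bigr)\rightsquigarrow\mathcal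 L(Y,M_{-s},\dots,M_t),$$ where $\rightsquigarrow$ denotes weak convergence of probability measures. -/

import Mathlib

open MeasureTheory ProbabilityTheory Filter Topology

noncomputable section

namespace TailChain

/-- The weights `p(+1) = p` and `p(-1) = 1 - p`. -/
def signWeight (p σ : ℝ) : ℝ := if σ = 1 then p else 1 - p

/-- `Z` is regularly varying with index `α` and tail balance `p`. -/
structure RegVarTails {Ω : Type*} [MeasurableSpace Ω] (P : Measure Ω) (Z : Ω → ℝ)
    (α p : ℝ) : Prop where
  index_pos : 0 < α
  nonneg : 0 ≤ p
  le_one : p ≤ 1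
  tendsto_ratio : ∀ y : ℝ, 0 < y →
    Tendsto (fun x : ℝ => P.real {ω | x * y < |Z ω|} / P.real {ω | x < |Z ω|})
      atTop (𝓝 (y ^ (-α)))
  tendsto_balance :
    Tendsto (fun x : ℝ => P.real {ω | x < Z ω} / P.real {ω | x < |Z ω|}) atTop (𝓝 p)

/-- The condition on `Ψ (x, ·)` for large `|x|`, where `ν` is the law of the innovations and
`φ v σ` is the limit of `Ψ x v / x` as `x → σ ∞`. Only those `σ ∈ {-1, 1}` with `p(σ) > 0`
matter. The supremum of `|Ψ y v|` over `|y| ≤ x` is `O(x)` as `x → ∞` iff for some `C` and all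
large `x`, each `|Ψ y v|` with `|y| ≤ x` is at most `C x`. -/
def LinearAtInfinity {S : Type*} [MeasurableSpace S] (Ψ : ℝ → S → ℝ) (ν : Measure S)
    (p : ℝ) (φ : S → ℝ → ℝ) : Prop :=
  ∃ V : Set S, MeasurableSet V ∧ ν V = 1 ∧
    (∀ σ ∈ ({-1, 1} : Set ℝ), 0 < signWeight p σ → ∀ v ∈ V,
      Tendsto (fun x : ℝ => (σ * x)⁻¹ * Ψ (σ * x) v) atTop (𝓝 (φ v σ))) ∧
    ((∃ σ ∈ ({-1, 1} : Set ℝ), 0 < signWeight p σ ∧ 0 < ν {v | φ v σ = 0}) →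
      ∃ W : Set S, W ⊆ V ∧ MeasurableSet W ∧ ν W = 1 ∧
        ∀ v ∈ W, ∃ C : ℝ, ∀ᶠ x : ℝ in atTop, ∀ y : ℝ, |y| ≤ x → |Ψ y v| ≤ C * x)

/-- The one-sided chain `Z (n + 1) = Ψ (Z n) (ε n)`, `n = 0, 1, 2, …`, where `ε n` plays the role
of the `(n + 1)`-st innovation: the innovations are i.i.d. and independent of `Z 0`. -/
structure IsRecursiveChain {S Ω : Type*} [MeasurableSpace S] [MeasurableSpace Ω]
    (Ψ : ℝ → S → ℝ) (P : Measure Ω) (Z : ℕ → Ω → ℝ) (ε : ℕ → Ω → S) : Prop where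
  measurable_map : Measurable (Function.uncurry Ψ)
  measurable_init : Measurable (Z 0)
  measurable_innov : ∀ n, Measurable (ε n)
  indep_innov : iIndepFun ε P
  ident_innov : ∀ n, P.map (ε n) = P.map (ε 0)
  indep_init : IndepFun (Z 0) (fun ω (n : ℕ) => ε n ω) P
  recursion : ∀ n ω, Z (n + 1) ω = Ψ (Z n ω) (ε n ω)

/-- `X`, indexed by all integers, is strictly stationary. -/
structure IsStationary {Ω : Type*} [MeasurableSpace Ω] (P : Measure Ω) (X : ℤ → Ω → ℝ) :
    Prop where
  measurable : ∀ t, Measurable (X t)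
  shift : ∀ h : ℤ, P.map (fun ω (t : ℤ) => X (t + h) ω) = P.map (fun ω (t : ℤ) => X t ω)

/-- The set `M_{p,α}` of laws of pairs `(I, M)` with `I ∈ {-1, 1}`. -/
structure MemClass (p α : ℝ) (μ : Measure (ℝ × ℝ)) : Prop where
  isProb : IsProbabilityMeasure μ
  sign_pos : μ {z | z.1 = 1} = ENNReal.ofReal p
  sign_neg : μ {z | z.1 = -1} = ENNReal.ofReal (1 - p)
  moment : ∀ σ ∈ ({-1, 1} : Set ℝ),
    ∫⁻ z, ENNReal.ofReal ((max (σ * z.2) 0) ^ α) ∂μ ≤ μ {z | z.1 = σ}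

/-- Two laws `μ = L(I, M)` and `μ' = L(I', M')` in `M_{p,α}` are adjoint:
`E[(x I)₊^α ∧ (y M)₊^α] = E[(x M')₊^α ∧ (y I')₊^α]` for all real `x, y`. -/
structure IsAdjoint (p α : ℝ) (μ μ' : Measure (ℝ × ℝ)) : Prop where
  mem_left : MemClass p α μ
  mem_right : MemClass p α μ'
  identity : ∀ x y : ℝ,
    ∫ z, min ((max (x * z.1) 0) ^ α) ((max (y * z.2) 0) ^ α) ∂μ =
      ∫ z, min ((max (x * z.2) 0) ^ α) ((max (y * z.1) 0) ^ α) ∂μ'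

/-- For `μ = L(I, M)`: the law `L(x M / I | I = sign x)` if `x ≠ 0`, and `δ_0` if `x = 0`. -/
def transition (μ : Measure (ℝ × ℝ)) (x : ℝ) : Measure ℝ :=
  if x = 0 then Measure.dirac 0
  else (μ[|{z : ℝ × ℝ | z.1 = Real.sign x}]).map (fun z => x * z.2 / z.1)

/-- `(M_t)`, `t ∈ ℤ`, is a back-and-forth tail chain with index `α` and forward transition law
`μ` in `M_{p,α}`. -/
structure IsBFTC {Ω : Type*} [MeasurableSpace Ω] (p α : ℝ) (μ : Measure (ℝ × ℝ))
    (P : Measure Ω) (M : ℤ → Ω → ℝ) : Prop where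
  measurable : ∀ t, Measurable (M t)
  law_forward : P.map (fun ω => (M 0 ω, M 1 ω)) = μ
  law_backward : IsAdjoint p α μ (P.map (fun ω => (M 0 ω, M (-1) ω)))
  forward : ∀ t : ℤ, 1 ≤ t → ∀ B : Set ℝ, MeasurableSet B →
    P⟦M t ⁻¹' B | ⨆ j : Set.Iio t, MeasurableSpace.comap (M j) inferInstance⟧
      =ᵐ[P] fun ω => (transition μ (M (t - 1) ω)).real B
  backward : ∀ t : ℤ, 1 ≤ t → ∀ B : Set ℝ, MeasurableSet B →
    P⟦M (-t) ⁻¹' B | ⨆ j : Set.Ioi (-t), MeasurableSpace.comap (M j) inferInstance⟧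
      =ᵐ[P] fun ω =>
        (transition (P.map (fun ω => (M 0 ω, M (-1) ω))) (M (-t + 1) ω)).real B

/-- The law of `(M_0, M_1)` with `M_1 = M_0 φ(ε, sign M_0)`, where `M_0` and `ε` are independent,
`ε` has law `ν`, and `M_0` takes the values `1` and `-1` with probabilities `p` and `1 - p`. -/
def forwardLaw {S : Type*} [MeasurableSpace S] (p : ℝ) (ν : Measure S) (φ : S → ℝ → ℝ) :
    Measure (ℝ × ℝ) :=
  ((ENNReal.ofReal p • Measure.dirac (1 : ℝ) +
      ENNReal.ofReal (1 - p) • Measure.dirac (-1 : ℝ)).prod ν).map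
    (fun z => (z.1, z.1 * φ z.2 (Real.sign z.1)))

/-- `(Y, (M_t))` is as in the limit: `Y` is Pareto(`α`), independent of `(M_t)`, which is a
back-and-forth tail chain with forward transition law `μ`. -/
structure IsTailLimit {Ω : Type*} [MeasurableSpace Ω] (p α : ℝ) (μ : Measure (ℝ × ℝ))
    (P : Measure Ω) (Y : Ω → ℝ) (M : ℤ → Ω → ℝ) : Prop where
  measurable : Measurable Y
  indep : IndepFun Y (fun ω (t : ℤ) => M t ω) P
  pareto : ∀ y : ℝ, 1 ≤ y → P {ω | y < Y ω} = ENNReal.ofReal (y ^ (-α))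
  bftc : IsBFTC p α μ P M

/-- The law of `(|X_0| / x, X_{-s} / |X_0|, …, X_t / |X_0|)` given `|X_0| > x`. -/
def conditionalLaw {Ω : Type*} [MeasurableSpace Ω] (P : Measure Ω) (X : ℤ → Ω → ℝ)
    (s t : ℕ) (x : ℝ) : FiniteMeasure (ℝ × (Fin (s + t + 1) → ℝ)) :=
  ⟨(P[|{ω | x < |X 0 ω|}]).map
    (fun ω => (|X 0 ω| / x, fun i => X ((i : ℤ) - s) ω / |X 0 ω|)), inferInstance⟩

/-- The law of `(Y, M_{-s}, …, M_t)`. -/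
def jointLaw {Ω : Type*} [MeasurableSpace Ω] (P : Measure Ω) [IsFiniteMeasure P]
    (Y : Ω → ℝ) (M : ℤ → Ω → ℝ) (s t : ℕ) : FiniteMeasure (ℝ × (Fin (s + t + 1) → ℝ)) :=
  ⟨P.map (fun ω => (Y ω, fun i => M ((i : ℤ) - s) ω)), inferInstance⟩

end TailChain

end

noncomputable section

namespace TailChain

/-! Regular variation says that the law of `X 0 / x`, divided by the probability that `|X 0| > x`,
converges vaguely away from `0` to the homogeneous measure `signTail p α`. At large values the
recursion acts like multiplication by a random factor that depends only on the sign of the current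
value. The scaled forward path therefore converges vaguely to the multiplicative chain `path`,
started from `signTail p α` and driven by i.i.d. pairs of multipliers. `tendsto_recPath` gives this
for frozen noise and `tendsto_integral_path` integrates over the noise. If a multiplier vanishes,
the next value is of smaller order than `x`, and the linear growth assumption keeps the later ones
so. Signs of weight zero, where nothing is assumed, are avoided thanks to stationarity: passing to
the limit in the equality of the tails of `σ X 1` and `σ X 0` bounds the moments of the multipliers
(`memClass_stepLaw`), which forbids steps into such signs and puts `μ` in the class.

For the past, the adjoint is built explicitly (`adjointLaw`): reweight by `|M| ^ α`, invert the
ratio, and put the missing mass on the value zero. Together with the homogeneity of `signTail`, this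
choice reverses one step in time on pairs of nonzero values (`lintegral_step_reverse`). Hence
`tailProcess`, driven forward by `μ` and backward by the adjoint, is invariant under shifts when
tested on functions that vanish if either end of the shifted stretch is zero
(`lintegral_tailProcess_shiftBy`). Stationarity of `X` matches this invariance: a functional of the
times from `-k` on that vanishes when the value at `0` or at `-k` is small can be viewed from time
`-k`, where it only involves a forward path, and its limit can be moved back
(`tendsto_integral_tailProcess_shift`).

What remains are past values that are small compared with `X 0`. Negative coordinates are
thresholded at level `δ` and admitted one at a time; each difference vanishes when the newly
admitted value is small, so the shift argument covers it (`tendsto_integral_smooth`). The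
thresholding error vanishes with `δ` (`abs_integral_polar_sub_smooth_le`).

Restricting `tailProcess` to `|m 0| > 1` and dividing by the modulus at time `0` yields a Pareto
radius independent of a back-and-forth tail chain (`map_canonLaw_mul`, `isTailLimit_canon`). The
adjoint is unique (`IsAdjoint.unique`), so the finite-dimensional laws of the chain are determined
one coordinate at a time (`IsBFTC.map_window_eq`), and every admissible pair has the law found in
this model. -/

/-- The measure with density `α y ^ (-α - 1)` on the positive half-line. -/
def tailMeasure (α : ℝ) : Measure ℝ :=
  (volume.restrict (Set.Ioi 0)).withDensity (fun y => ENNReal.ofReal (α * y ^ (-α - 1)))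

instance (α : ℝ) : SFinite (tailMeasure α) := by
  unfold tailMeasure; infer_instance

/-- The law of a random sign with probability `p` of being positive. -/
def signMeasure (p : ℝ) : Measure ℝ :=
  ENNReal.ofReal p • Measure.dirac (1 : ℝ) + ENNReal.ofReal (1 - p) • Measure.dirac (-1 : ℝ)

instance (p : ℝ) : IsFiniteMeasure (signMeasure p) := by
  have (c x : ℝ) : IsFiniteMeasure (ENNReal.ofReal c • Measure.dirac x) :=
    Measure.smul_finite _ ENNReal.ofReal_ne_top
  unfold signMeasure; infer_instance

/-- The two-sided tail measure with weights `p` and `1 - p`. -/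
def signTail (p α : ℝ) : Measure ℝ :=
  ((tailMeasure α).prod (signMeasure p)).map (fun z => z.1 * z.2)

instance (p α : ℝ) : SFinite (signTail p α) := by
  unfold signTail; infer_instance

/-- The multiplier selected by the sign of `x`. -/
def select (a : ℝ × ℝ) (x : ℝ) : ℝ := if 0 < x then a.1 else if x < 0 then a.2 else 0

/-- One step of the multiplicative chain driven by the pair of multipliers `a`. -/
def step (x : ℝ) (a : ℝ × ℝ) : ℝ := x * select a x

/-- The path of the multiplicative chain started at `x`. -/
def path (x : ℝ) (a : ℕ → ℝ × ℝ) : ℕ → ℝ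
  | 0 => x
  | n + 1 => step (path x a n) (a n)

/-- The sequence without its first entry. -/
def tail {E : Type*} (a : ℕ → E) (n : ℕ) : E := a (n + 1)

/-- A two-sided sequence made of a path from `y` and a reversed path from `x`. -/
def chain (x y : ℝ) (b a : ℕ → ℝ × ℝ) : ℤ → ℝ
  | Int.ofNat n => path y a n
  | Int.negSucc n => path x b n

/-- The two-sided sequence with value `y` at time `0`, driven by `a` forward and `b` backward. -/
def biChain (y : ℝ) (b a : ℕ → ℝ × ℝ) : ℤ → ℝ := chain (step y (b 0)) y (tail b) a

/-- The left shift on two-sided sequences. -/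
def shift (m : ℤ → ℝ) (k : ℤ) : ℝ := m (k + 1)

/-- The law of `(I, M)` with `M = step I a`, for independent `I` and `a ∼ κ`. -/
def stepLaw (p : ℝ) (κ : Measure (ℝ × ℝ)) : Measure (ℝ × ℝ) :=
  ((signMeasure p).prod κ).map (fun z => (z.1, step z.1 z.2))

/-! ### Signs and homogeneous tail measures -/

lemma signWeight_one (p : ℝ) : signWeight p 1 = p := by simp [signWeight]

lemma signWeight_neg_one (p : ℝ) : signWeight p (-1) = 1 - p := by
  norm_num [signWeight]

lemma signWeight_nonneg {p : ℝ} (h0 : 0 ≤ p) (h1 : p ≤ 1) (σ : ℝ) : 0 ≤ signWeight p σ := by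
  unfold signWeight; split_ifs <;> linarith

lemma signMeasure_eq (p : ℝ) : signMeasure p =
    ENNReal.ofReal (signWeight p 1) • Measure.dirac (1 : ℝ) +
      ENNReal.ofReal (signWeight p (-1)) • Measure.dirac (-1 : ℝ) := by
  rw [signWeight_one, signWeight_neg_one]; rfl

lemma isProbabilityMeasure_signMeasure {p : ℝ} (h0 : 0 ≤ p) (h1 : p ≤ 1) :
    IsProbabilityMeasure (signMeasure p) := by
  constructor
  simp only [signMeasure, Measure.add_apply, Measure.smul_apply, measure_univ, smul_eq_mul, mul_one]
  rw [← ENNReal.ofReal_add h0 (by linarith)]; simp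

lemma lintegral_signMeasure (p : ℝ) (f : ℝ → ENNReal) :
    ∫⁻ i, f i ∂(signMeasure p) =
      ENNReal.ofReal (signWeight p 1) * f 1 + ENNReal.ofReal (signWeight p (-1)) * f (-1) := by
  rw [signMeasure_eq, lintegral_add_measure]
  simp

/-- An atom of weight zero is invisible to almost-everywhere statements. This is why hypotheses on
`φ` restricted to signs of positive weight suffice throughout. -/
lemma ae_signMeasure {p : ℝ} {q : ℝ → Prop} :
    (∀ᵐ i ∂(signMeasure p), q i) ↔ ∀ σ ∈ ({-1, 1} : Set ℝ), 0 < signWeight p σ → q σ := by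
  have key (c : ℝ) (x : ℝ) :
      (∀ᵐ i ∂(ENNReal.ofReal c • Measure.dirac x), q i) ↔ (0 < c → q x) := by
    by_cases hc : 0 < c
    · have : ENNReal.ofReal c ≠ 0 := by simpa using hc
      rw [Measure.ae_ennreal_smul_measure_eq this, ae_dirac_eq]
      simp [hc]
    · have : ENNReal.ofReal c = 0 := by simpa using hc
      simp [this, hc]
  rw [signMeasure_eq, ae_add_measure_iff, key, key]
  simp only [Set.mem_insert_iff, Set.mem_singleton_iff, forall_eq_or_imp, forall_eq]
  tauto

lemma lintegral_tailMeasure {α : ℝ} {f : ℝ → ENNReal} (hf : Measurable f) :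
    ∫⁻ y, f y ∂(tailMeasure α) =
      ∫⁻ y in Set.Ioi 0, ENNReal.ofReal (α * y ^ (-α - 1)) * f y := by
  rw [tailMeasure, lintegral_withDensity_eq_lintegral_mul _ (by fun_prop) hf]
  rfl

lemma tailMeasure_Ioi {α y : ℝ} (hα : 0 < α) (hy : 0 < y) :
    tailMeasure α (Set.Ioi y) = ENNReal.ofReal (y ^ (-α)) := by
  rw [tailMeasure, withDensity_apply _ measurableSet_Ioi,
    Measure.restrict_restrict measurableSet_Ioi,
    Set.inter_eq_left.2 (Set.Ioi_subset_Ioi hy.le), ← ofReal_integral_eq_lintegral_ofReal]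
  · rw [integral_const_mul, integral_Ioi_rpow_of_lt (by linarith) hy]
    congr 1
    have : -α - 1 + 1 = -α := by ring
    rw [this]; field_simp
  · exact (integrableOn_Ioi_rpow_of_lt (by linarith) hy).const_mul _
  · refine (ae_restrict_iff' measurableSet_Ioi).2 (.of_forall fun u hu => ?_)
    have : 0 < u := hy.trans hu
    positivity

lemma tailMeasure_Iic (α : ℝ) : tailMeasure α (Set.Iic 0) = 0 := by
  rw [tailMeasure, withDensity_apply _ measurableSet_Iic,
    Measure.restrict_restrict measurableSet_Iic,
    Set.Iic_inter_Ioi, Set.Ioc_self, Measure.restrict_empty, lintegral_zero_measure]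

lemma ae_tailMeasure_pos (α : ℝ) : ∀ᵐ y ∂(tailMeasure α), 0 < y := by
  have := tailMeasure_Iic α
  rw [ae_iff]
  simpa only [not_lt] using! this

/-- The tail measure is homogeneous of order `-α`. -/
lemma lintegral_tailMeasure_mul {α c : ℝ} (hα : 0 < α) (hc : 0 < c) {f : ℝ → ENNReal}
    (hf : Measurable f) :
    ∫⁻ y, f (c * y) ∂(tailMeasure α) = ENNReal.ofReal (c ^ α) * ∫⁻ y, f y ∂(tailMeasure α) := by
  have hm : Measurable fun y : ℝ => (Set.Ioi (0 : ℝ)).indicator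
      (fun y => ENNReal.ofReal (α * y ^ (-α - 1)) * f y) y :=
    Measurable.indicator (by fun_prop) measurableSet_Ioi
  rw [lintegral_tailMeasure hf, lintegral_tailMeasure (by fun_prop),
    ← lintegral_indicator measurableSet_Ioi, ← lintegral_indicator measurableSet_Ioi]
  conv_rhs => rw [← Real.smul_map_volume_mul_left hc.ne', lintegral_smul_measure,
    lintegral_map hm (by fun_prop)]
  rw [abs_of_pos hc, smul_eq_mul, ← mul_assoc, ← ENNReal.ofReal_mul (by positivity),
    ← lintegral_const_mul _ (by fun_prop)]
  refine lintegral_congr fun y => ?_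
  by_cases hy : 0 < y
  · have hcy : 0 < c * y := by positivity
    rw [Set.indicator_of_mem (by exact hy), Set.indicator_of_mem (by exact hcy), ← mul_assoc,
      ← ENNReal.ofReal_mul (by positivity)]
    congr 2
    rw [Real.mul_rpow hc.le hy.le, Real.rpow_sub hc, Real.rpow_neg hc.le]
    field_simp
    rw [Real.rpow_one]
  · have hcy : ¬ 0 < c * y := fun h => hy (pos_of_mul_pos_right h hc.le)
    rw [Set.indicator_of_notMem (by exact hy), Set.indicator_of_notMem (by exact hcy), mul_zero]

lemma lintegral_signTail {p α : ℝ} {f : ℝ → ENNReal} (hf : Measurable f) :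
    ∫⁻ y, f y ∂(signTail p α) = ∫⁻ u, ∫⁻ i, f (u * i) ∂(signMeasure p) ∂(tailMeasure α) := by
  rw [signTail, lintegral_map hf (by fun_prop), lintegral_prod _ (by fun_prop)]

lemma signTail_zero (p α : ℝ) : ∀ᵐ y ∂(signTail p α), y ≠ 0 := by
  rw [ae_iff]
  have h : MeasurableSet {y : ℝ | ¬ y ≠ 0} := by simp
  rw [← lintegral_indicator_one h, lintegral_signTail (measurable_one.indicator h)]
  refine (lintegral_congr_ae ?_).trans lintegral_zero
  filter_upwards [ae_tailMeasure_pos α] with u hu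
  rw [lintegral_signMeasure]
  simp [hu.ne']

/-! ### Steps, paths and two-sided chains -/

@[fun_prop]
lemma measurable_step : Measurable (fun z : ℝ × (ℝ × ℝ) => step z.1 z.2) := by
  unfold step select
  refine measurable_fst.mul (Measurable.ite (measurableSet_lt measurable_const measurable_fst)
    (by fun_prop) (Measurable.ite (measurableSet_lt measurable_fst measurable_const)
    (by fun_prop) (by fun_prop)))

@[fun_prop]
lemma Measurable.step_comp {β : Type*} [MeasurableSpace β] {f : β → ℝ} {g : β → ℝ × ℝ}
    (hf : Measurable f) (hg : Measurable g) : Measurable (fun x => step (f x) (g x)) :=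
  measurable_step.comp (hf.prodMk hg)

lemma step_zero (a : ℝ × ℝ) : step 0 a = 0 := by simp [step]

lemma step_mul {c : ℝ} (hc : 0 < c) (x : ℝ) (a : ℝ × ℝ) : step (c * x) a = c * step x a := by
  have h1 : 0 < c * x ↔ 0 < x := by simp [hc]
  have h2 : c * x < 0 ↔ x < 0 := by simp [mul_neg_iff, hc, hc.not_gt]
  simp only [step, select, h1, h2, mul_assoc]

/-- The definition adds the last multiplier; shifting time requires peeling off the first one. -/
lemma path_succ' (x : ℝ) (a : ℕ → ℝ × ℝ) (n : ℕ) :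
    path x a (n + 1) = path (step x (a 0)) (tail a) n := by
  induction n with
  | zero => rfl
  | succ n ih => rw [path, ih]; rfl

lemma path_mul {c : ℝ} (hc : 0 < c) (x : ℝ) (a : ℕ → ℝ × ℝ) (n : ℕ) :
    path (c * x) a n = c * path x a n := by
  induction n with
  | zero => rfl
  | succ n ih => rw [path, ih, step_mul hc]; rfl

lemma path_eq_zero {x : ℝ} {a : ℕ → ℝ × ℝ} {n k : ℕ} (h : path x a n = 0) :
    path x a (n + k) = 0 := by
  induction k with
  | zero => exact h
  | succ k ih => rw [← add_assoc, path, ih, step_zero]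

lemma measurable_path (n : ℕ) :
    Measurable (fun z : ℝ × (ℕ → ℝ × ℝ) => path z.1 z.2 n) := by
  induction n with
  | zero => exact measurable_fst
  | succ n ih => simp only [path]; fun_prop

@[fun_prop]
lemma Measurable.path_comp {β : Type*} [MeasurableSpace β] {f : β → ℝ} {g : β → ℕ → ℝ × ℝ}
    (hf : Measurable f) (hg : Measurable g) (n : ℕ) : Measurable (fun x => path (f x) (g x) n) :=
  (measurable_path n).comp (hf.prodMk hg)

@[fun_prop]
lemma measurable_tail {E : Type*} [MeasurableSpace E] :
    Measurable (tail : (ℕ → E) → ℕ → E) :=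
  measurable_pi_lambda _ fun n => measurable_pi_apply (n + 1)

@[fun_prop]
lemma measurable_shift : Measurable shift :=
  measurable_pi_lambda _ fun n => measurable_pi_apply (n + 1)

@[fun_prop]
lemma Measurable.chain_comp {β : Type*} [MeasurableSpace β] {f f' : β → ℝ}
    {g g' : β → ℕ → ℝ × ℝ} (hf : Measurable f) (hf' : Measurable f') (hg : Measurable g)
    (hg' : Measurable g') : Measurable (fun x => chain (f x) (f' x) (g x) (g' x)) := by
  refine measurable_pi_lambda _ fun n => ?_
  cases n with
  | ofNat n => simp only [chain]; fun_prop
  | negSucc n => simp only [chain]; fun_prop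

@[fun_prop]
lemma Measurable.biChain_comp {β : Type*} [MeasurableSpace β] {f : β → ℝ}
    {g g' : β → ℕ → ℝ × ℝ} (hf : Measurable f) (hg : Measurable g)
    (hg' : Measurable g') : Measurable (fun x => biChain (f x) (g x) (g' x)) := by
  unfold biChain; fun_prop

lemma biChain_natCast (y : ℝ) (b a : ℕ → ℝ × ℝ) (n : ℕ) : biChain y b a n = path y a n := rfl

/-- The definition isolates the first backward step because `Int.negSucc n` is `-(n + 1)`. In this
form past and future play symmetric roles. -/
lemma biChain_neg_natCast (y : ℝ) (b a : ℕ → ℝ × ℝ) (n : ℕ) :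
    biChain y b a (-n) = path y b n := by
  cases n with
  | zero => rfl
  | succ n => rw [path_succ', show (-((n + 1 : ℕ) : ℤ)) = Int.negSucc n from rfl]; rfl

lemma biChain_mul {c : ℝ} (hc : 0 < c) (y : ℝ) (b a : ℕ → ℝ × ℝ) (k : ℤ) :
    biChain (c * y) b a k = c * biChain y b a k := by
  cases k with
  | ofNat n => exact path_mul hc y a n
  | negSucc n =>
    simp only [biChain, chain]
    rw [step_mul hc, path_mul hc]

/-- The first forward multiplier moves into the value at the new origin, and `y` becomes the value
at time `-1`, still driven backward by all of `b`. A chain and its shift thus differ only in how the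
two values at times `-1` and `0` are generated. -/
lemma shift_biChain (y : ℝ) (b a : ℕ → ℝ × ℝ) :
    shift (biChain y b a) = chain y (step y (a 0)) b (tail a) := by
  ext k
  rcases k with n | n
  · exact path_succ' y a n
  · cases n with
    | zero => rfl
    | succ n => exact (path_succ' y b n).symm

/-! ### Splitting i.i.d. sequences and the law of one step -/

/-- The first entry and the rest of an i.i.d. sequence are independent. -/
lemma map_head_tail {E : Type*} [MeasurableSpace E] (κ : Measure E) [IsProbabilityMeasure κ] :
    (Measure.infinitePi fun _ : ℕ => κ).map (fun a => (a 0, tail a)) =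
      κ.prod (Measure.infinitePi fun _ : ℕ => κ) := by
  set Γ := Measure.infinitePi fun _ : ℕ => κ with hΓ
  have hind : iIndepFun (fun n (a : ℕ → E) => a n) Γ :=
    iIndepFun_infinitePi (X := fun _ x => x) (fun _ => measurable_id)
  have h0 : Γ.map (fun a => a 0) = κ := Measure.infinitePi_map_eval _ 0
  have ht : Γ.map tail = Γ :=
    Measure.map_infinitePi_infinitePi_of_inj (P := fun _ : ℕ => κ) (add_left_injective 1)
  have hI : IndepFun (fun a : ℕ → E => a 0) tail Γ := by
    have := indep_iSup_of_disjoint (m := fun n : ℕ => MeasurableSpace.comap (fun a : ℕ → E => a n)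
      inferInstance) (fun n => (measurable_pi_apply n).comap_le) hind
      (S := {0}) (T := {0}ᶜ) disjoint_compl_right
    refine (IndepFun_iff_Indep _ _ _).2
      (indep_of_indep_of_le_left (indep_of_indep_of_le_right this ?_) ?_)
    · rw [MeasurableSpace.pi, MeasurableSpace.comap_iSup]
      refine iSup_le fun n => ?_
      rw [MeasurableSpace.comap_comp]
      exact le_iSup₂_of_le (f := fun n (_ : n ∈ ({0}ᶜ : Set ℕ)) =>
        MeasurableSpace.comap (fun a : ℕ → E => a n) inferInstance) (n + 1) (by simp) le_rfl
    · simp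
  rw [(indepFun_iff_map_prod_eq_prod_map_map (measurable_pi_apply 0).aemeasurable
    measurable_tail.aemeasurable).1 hI, h0, ht]

lemma lintegral_infinitePi_head_tail {E : Type*} [MeasurableSpace E] (κ : Measure E)
    [IsProbabilityMeasure κ] {f : E → (ℕ → E) → ENNReal} (hf : Measurable (Function.uncurry f)) :
    ∫⁻ a, f (a 0) (tail a) ∂(Measure.infinitePi fun _ : ℕ => κ) =
      ∫⁻ x, ∫⁻ a, f x a ∂(Measure.infinitePi fun _ : ℕ => κ) ∂κ := by
  have := lintegral_prod (μ := κ) (ν := Measure.infinitePi fun _ : ℕ => κ) _ hf.aemeasurable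
  rw [← map_head_tail, lintegral_map hf (by fun_prop)] at this
  exact this

lemma lintegral_stepLaw {p : ℝ} {κ : Measure (ℝ × ℝ)} [SFinite κ] {f : ℝ × ℝ → ENNReal}
    (hf : Measurable f) :
    ∫⁻ z, f z ∂(stepLaw p κ) =
      ENNReal.ofReal (signWeight p 1) * ∫⁻ a, f (1, step 1 a) ∂κ +
        ENNReal.ofReal (signWeight p (-1)) * ∫⁻ a, f (-1, step (-1) a) ∂κ := by
  rw [stepLaw, lintegral_map hf (by fun_prop), lintegral_prod _ (by fun_prop),
    lintegral_signMeasure]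

lemma isProbabilityMeasure_stepLaw {p : ℝ} (h0 : 0 ≤ p) (h1 : p ≤ 1) (κ : Measure (ℝ × ℝ))
    [IsProbabilityMeasure κ] : IsProbabilityMeasure (stepLaw p κ) := by
  have := isProbabilityMeasure_signMeasure h0 h1
  exact Measure.isProbabilityMeasure_map (by fun_prop)

/-! ### The class of transition laws and the construction of the adjoint -/

lemma measurableSet_fst_eq (σ : ℝ) : MeasurableSet {z : ℝ × ℝ | z.1 = σ} :=
  measurable_fst (measurableSet_singleton σ)

lemma MemClass.sign {p α : ℝ} {μ : Measure (ℝ × ℝ)} (h : MemClass p α μ) :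
    ∀ σ ∈ ({-1, 1} : Set ℝ), μ {z | z.1 = σ} = ENNReal.ofReal (signWeight p σ) := by
  rintro σ (rfl | rfl)
  · rw [h.sign_neg, signWeight_neg_one]
  · rw [h.sign_pos, signWeight_one]

/-- Splitting an integral according to the sign in the first coordinate. -/
lemma MemClass.lintegral_eq {p α : ℝ} (h0 : 0 ≤ p) (h1 : p ≤ 1) {μ : Measure (ℝ × ℝ)}
    (h : MemClass p α μ) (f : ℝ × ℝ → ENNReal) :
    ∫⁻ z, f z ∂μ = ∫⁻ z in {z | z.1 = 1}, f z ∂μ + ∫⁻ z in {z | z.1 = -1}, f z ∂μ := by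
  have := h.isProb
  have hd : Disjoint {z : ℝ × ℝ | z.1 = 1} {z | z.1 = -1} := by
    rw [Set.disjoint_left]; intro z (hz : z.1 = 1) (hz' : z.1 = -1); linarith
  have hu : μ (({z | z.1 = 1} ∪ {z | z.1 = -1})ᶜ) = 0 := by
    have : μ ({z | z.1 = 1} ∪ {z | z.1 = -1}) = 1 := by
      rw [measure_union hd (measurableSet_fst_eq _), h.sign_pos, h.sign_neg,
        ← ENNReal.ofReal_add h0 (by linarith)]
      simp
    exact (prob_compl_eq_zero_iff ((measurableSet_fst_eq _).union (measurableSet_fst_eq _))).2 this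
  rw [← lintegral_union (measurableSet_fst_eq _) hd,
    ← lintegral_add_compl f ((measurableSet_fst_eq 1).union (measurableSet_fst_eq (-1))),
    setLIntegral_measure_zero _ _ hu, add_zero]

lemma MemClass.ae_sign {p α : ℝ} (h0 : 0 ≤ p) (h1 : p ≤ 1) {μ : Measure (ℝ × ℝ)}
    (h : MemClass p α μ) : ∀ᵐ z ∂μ, z.1 = 1 ∨ z.1 = -1 := by
  have := h.isProb
  have hm : MeasurableSet {z : ℝ × ℝ | z.1 = 1 ∨ z.1 = -1}ᶜ :=
    ((measurableSet_fst_eq 1).union (measurableSet_fst_eq (-1))).compl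
  rw [ae_iff]
  change μ ({z : ℝ × ℝ | z.1 = 1 ∨ z.1 = -1}ᶜ) = 0
  rw [← lintegral_indicator_one hm, h.lintegral_eq h0 h1,
    setLIntegral_eq_zero (measurableSet_fst_eq _), setLIntegral_eq_zero (measurableSet_fst_eq _),
    add_zero]
  · intro z (hz : z.1 = -1); simp [hz]
  · intro z (hz : z.1 = 1); simp [hz]

/-- The moment `E[(σ M)₊ ^ α]`. -/
def signMoment (α σ : ℝ) (μ : Measure (ℝ × ℝ)) : ENNReal :=
  ∫⁻ z, ENNReal.ofReal ((max (σ * z.2) 0) ^ α) ∂μ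

/-- The adjoint of the law `μ`. -/
def adjointLaw (p α : ℝ) (μ : Measure (ℝ × ℝ)) : Measure (ℝ × ℝ) :=
  (μ.withDensity (fun z => ENNReal.ofReal (|z.2| ^ α))).map (fun z => (Real.sign z.2, z.1 / |z.2|))
    + ((ENNReal.ofReal (signWeight p 1) - signMoment α 1 μ) • Measure.dirac ((1 : ℝ), (0 : ℝ))
    + (ENNReal.ofReal (signWeight p (-1)) - signMoment α (-1) μ) •
      Measure.dirac ((-1 : ℝ), (0 : ℝ)))

@[fun_prop]
lemma measurable_sign : Measurable Real.sign := by
  unfold Real.sign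
  exact Measurable.ite measurableSet_Iio measurable_const
    (Measurable.ite measurableSet_Ioi measurable_const measurable_const)

lemma lintegral_adjointLaw {p α : ℝ} {μ : Measure (ℝ × ℝ)} {f : ℝ × ℝ → ENNReal}
    (hf : Measurable f) :
    ∫⁻ z, f z ∂(adjointLaw p α μ) =
      ∫⁻ z, ENNReal.ofReal (|z.2| ^ α) * f (Real.sign z.2, z.1 / |z.2|) ∂μ +
      ((ENNReal.ofReal (signWeight p 1) - signMoment α 1 μ) * f (1, 0) +
      (ENNReal.ofReal (signWeight p (-1)) - signMoment α (-1) μ) * f (-1, 0)) := by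
  have hm : Measurable (fun z : ℝ × ℝ => (Real.sign z.2, z.1 / |z.2|)) := by fun_prop
  rw [adjointLaw, lintegral_add_measure, lintegral_add_measure, lintegral_smul_measure,
    lintegral_smul_measure, lintegral_dirac, lintegral_dirac, lintegral_map hf hm]
  congr 1
  exact lintegral_withDensity_eq_lintegral_mul μ (by fun_prop) (hf.comp hm)

lemma abs_rpow_mul_indicator_sign {α σ : ℝ} (hα : 0 < α) (hσ : σ ∈ ({-1, 1} : Set ℝ)) (u : ℝ) :
    ENNReal.ofReal (|u| ^ α) * (if Real.sign u = σ then 1 else 0) =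
      ENNReal.ofReal ((max (σ * u) 0) ^ α) := by
  have h0 : (0 : ℝ) ^ α = 0 := Real.zero_rpow hα.ne'
  rcases lt_trichotomy u 0 with hu | rfl | hu
  · rw [Real.sign_of_neg hu, abs_of_neg hu]
    rcases hσ with rfl | rfl
    · simp [hu.le]
    · norm_num [hu.le, h0]
  · simp [h0]
  · rw [Real.sign_of_pos hu, abs_of_pos hu]
    rcases hσ with rfl | rfl
    · norm_num [hu.le, h0]
    · simp [hu.le]

lemma max_mul_rpow {α c : ℝ} (hc : 0 < c) (t : ℝ) :
    c ^ α * (max t 0) ^ α = (max (c * t) 0) ^ α := by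
  rw [← Real.mul_rpow hc.le (le_max_right _ _), mul_max_of_nonneg _ _ hc.le, mul_zero]

/-- The reweighted part gives the sign `σ` the mass `signMoment α σ μ`, and the atom at `(σ, 0)`
tops it up to the weight of `σ`. The moment bound holds because the density cancels the denominator:
`|M| ^ α (σ I / |M|)₊ ^ α` is the indicator of `I = σ`, except where `M = 0` and it is lost. -/
lemma memClass_adjointLaw {p α : ℝ} (hα : 0 < α) (h0 : 0 ≤ p) (h1 : p ≤ 1)
    {μ : Measure (ℝ × ℝ)} (h : MemClass p α μ) : MemClass p α (adjointLaw p α μ) := by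
  have := h.isProb
  -- This keeps the truncated subtraction in the atoms of `adjointLaw` from losing mass.
  have hmom : ∀ σ ∈ ({-1, 1} : Set ℝ), signMoment α σ μ ≤ ENNReal.ofReal (signWeight p σ) := by
    intro σ hσ; rw [← h.sign σ hσ]; exact h.moment σ hσ
  have hsign : ∀ σ ∈ ({-1, 1} : Set ℝ),
      adjointLaw p α μ {z | z.1 = σ} = ENNReal.ofReal (signWeight p σ) := by
    intro σ hσ
    rw [← lintegral_indicator_one (measurableSet_fst_eq σ),
      lintegral_adjointLaw (measurable_one.indicator (measurableSet_fst_eq σ))]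
    have : ∫⁻ z, ENNReal.ofReal (|z.2| ^ α) * ({z : ℝ × ℝ | z.1 = σ}.indicator 1
        (Real.sign z.2, z.1 / |z.2|)) ∂μ = signMoment α σ μ := by
      refine lintegral_congr fun z => ?_
      rw [← abs_rpow_mul_indicator_sign hα hσ]
      simp [Set.indicator_apply]
    rw [this]
    rcases hσ with rfl | rfl
    · norm_num [Set.indicator_apply]
      exact add_tsub_cancel_of_le (hmom (-1) (by simp))
    · norm_num [Set.indicator_apply]
      exact add_tsub_cancel_of_le (hmom 1 (by simp))
  refine ⟨⟨?_⟩, ?_, ?_, ?_⟩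
  · rw [← lintegral_one, lintegral_adjointLaw measurable_const]
    simp only [mul_one]
    have : ∫⁻ z, ENNReal.ofReal (|z.2| ^ α) ∂μ = signMoment α 1 μ + signMoment α (-1) μ := by
      rw [signMoment, signMoment, ← lintegral_add_left (by fun_prop)]
      refine lintegral_congr fun z => ?_
      rw [← abs_rpow_mul_indicator_sign hα (by simp), ← abs_rpow_mul_indicator_sign hα (by simp),
        ← mul_add]
      rcases lt_trichotomy z.2 0 with hu | hu | hu
      · norm_num [Real.sign_of_neg hu]
      · simp [hu, Real.zero_rpow hα.ne']
      · norm_num [Real.sign_of_pos hu]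
    rw [this, add_add_add_comm, add_tsub_cancel_of_le (hmom 1 (by simp)),
      add_tsub_cancel_of_le (hmom (-1) (by simp)), signWeight_one, signWeight_neg_one,
      ← ENNReal.ofReal_add h0 (by linarith)]
    simp
  · rw [hsign 1 (by simp), signWeight_one]
  · rw [hsign (-1) (by simp), signWeight_neg_one]
  · intro σ hσ
    rw [hsign σ hσ, ← h.sign σ hσ, lintegral_adjointLaw (by fun_prop)]
    simp only [mul_zero, max_self, Real.zero_rpow hα.ne', ENNReal.ofReal_zero, add_zero]
    rw [← lintegral_indicator_one (measurableSet_fst_eq σ)]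
    refine lintegral_mono_ae ?_
    filter_upwards [h.ae_sign h0 h1] with z hz
    by_cases hz2 : z.2 = 0
    · simp [hz2, Real.zero_rpow hα.ne']
    have hp : 0 < |z.2| := abs_pos.2 hz2
    rw [← ENNReal.ofReal_mul (by positivity), max_mul_rpow hp,
      show |z.2| * (σ * (z.1 / |z.2|)) = σ * z.1 by field_simp]
    rcases hσ with rfl | rfl <;> rcases hz with hz | hz <;>
      norm_num [hz, Set.indicator_apply, Real.zero_rpow hα.ne']

/-- The density `|M| ^ α` multiplies both arguments of the minimum and clears the denominators,
turning `(I / |M|, sign M)` back into `(I, M)`. The atoms contribute nothing, since one argument of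
the minimum is zero there. -/
lemma isAdjoint_adjointLaw {p α : ℝ} (hα : 0 < α) (h0 : 0 ≤ p) (h1 : p ≤ 1)
    {μ : Measure (ℝ × ℝ)} (h : MemClass p α μ) : IsAdjoint p α μ (adjointLaw p α μ) := by
  have z0 : (0 : ℝ) ^ α = 0 := Real.zero_rpow hα.ne'
  refine ⟨h, memClass_adjointLaw hα h0 h1 h, fun x y => ?_⟩
  have nn (u v : ℝ) : 0 ≤ min ((max u 0) ^ α) ((max v 0) ^ α) := by positivity
  rw [integral_eq_lintegral_of_nonneg_ae (.of_forall fun z => nn _ _)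
      (Measurable.aestronglyMeasurable (by fun_prop)),
    integral_eq_lintegral_of_nonneg_ae (.of_forall fun z => nn _ _)
      (Measurable.aestronglyMeasurable (by fun_prop)), lintegral_adjointLaw (by fun_prop)]
  congr 1
  have e (v : ℝ) : min (0 : ℝ) ((max v 0) ^ α) = 0 := min_eq_left (by positivity)
  simp only [mul_zero, max_self, z0, e, ENNReal.ofReal_zero, add_zero]
  refine lintegral_congr fun z => ?_
  by_cases hz2 : z.2 = 0
  · simp only [hz2, mul_zero, max_self, z0, abs_zero, ENNReal.ofReal_zero, zero_mul]
    rw [min_eq_right (by positivity), ENNReal.ofReal_zero]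
  have hp : 0 < |z.2| := abs_pos.2 hz2
  rw [← ENNReal.ofReal_mul (by positivity), mul_min_of_nonneg _ _ (by positivity), max_mul_rpow hp,
    max_mul_rpow hp, show |z.2| * (x * (z.1 / |z.2|)) = x * z.1 by field_simp,
    show |z.2| * (y * Real.sign z.2) = y * (Real.sign z.2 * |z.2|) by ring]
  congr 5
  rcases lt_or_gt_of_ne hz2 with hu | hu
  · simp [Real.sign_of_neg hu, abs_of_neg hu]
  · simp [Real.sign_of_pos hu, abs_of_pos hu]

/-! ### Realizing a transition law by pairs of multipliers -/

/-- The law of the multiplier `M / I` given `I = σ`. -/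
def multiplierLaw (p : ℝ) (μ : Measure (ℝ × ℝ)) (σ : ℝ) : Measure ℝ :=
  if 0 < signWeight p σ then (μ[|{z : ℝ × ℝ | z.1 = σ}]).map (fun z => z.2 / z.1)
  else Measure.dirac 0

/-- A law of pairs of multipliers that realizes `μ` through `stepLaw`. -/
def multiplierPair (p : ℝ) (μ : Measure (ℝ × ℝ)) : Measure (ℝ × ℝ) :=
  (multiplierLaw p μ 1).prod (multiplierLaw p μ (-1))

lemma MemClass.isProbabilityMeasure_multiplierLaw {p α : ℝ} {μ : Measure (ℝ × ℝ)}
    (h : MemClass p α μ) {σ : ℝ} (hσ : σ ∈ ({-1, 1} : Set ℝ)) :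
    IsProbabilityMeasure (multiplierLaw p μ σ) := by
  have := h.isProb
  unfold multiplierLaw
  split_ifs with hw
  · have : μ {z | z.1 = σ} ≠ 0 := by rw [h.sign σ hσ]; simpa using hw
    have := cond_isProbabilityMeasure this
    exact Measure.isProbabilityMeasure_map (by fun_prop)
  · infer_instance

lemma MemClass.isProbabilityMeasure_multiplierPair {p α : ℝ} {μ : Measure (ℝ × ℝ)}
    (h : MemClass p α μ) : IsProbabilityMeasure (multiplierPair p μ) := by
  have := h.isProbabilityMeasure_multiplierLaw (σ := 1) (by simp)
  have := h.isProbabilityMeasure_multiplierLaw (σ := -1) (by simp)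
  unfold multiplierPair; infer_instance

lemma MemClass.lintegral_multiplierLaw {p α : ℝ} {μ : Measure (ℝ × ℝ)}
    (h : MemClass p α μ) {σ : ℝ} (hσ : σ ∈ ({-1, 1} : Set ℝ)) {f : ℝ × ℝ → ENNReal}
    (hf : Measurable f) :
    ENNReal.ofReal (signWeight p σ) * ∫⁻ t, f (σ, σ * t) ∂(multiplierLaw p μ σ) =
      ∫⁻ z in {z | z.1 = σ}, f z ∂μ := by
  have := h.isProb
  have hs := h.sign σ hσ
  have hσ0 : σ ≠ 0 := by rcases hσ with rfl | rfl <;> norm_num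
  by_cases hw : 0 < signWeight p σ
  · have hw' : ENNReal.ofReal (signWeight p σ) ≠ 0 := by simpa using hw
    rw [multiplierLaw, if_pos hw, lintegral_map (by fun_prop) (by fun_prop),
      ProbabilityTheory.cond, lintegral_smul_measure, smul_eq_mul, ← mul_assoc, hs,
      ENNReal.mul_inv_cancel hw' ENNReal.ofReal_ne_top, one_mul]
    refine setLIntegral_congr_fun (measurableSet_fst_eq σ) fun z (hz : z.1 = σ) => ?_
    have : (σ, σ * (z.2 / z.1)) = z := by
      ext
      · exact hz.symm
      · simp only [hz]; field_simp
    simp only [this]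
  · have hw' : ENNReal.ofReal (signWeight p σ) = 0 := by simpa using hw
    rw [setLIntegral_measure_zero _ _ (hs.trans hw'), hw', zero_mul]

lemma step_one (a : ℝ × ℝ) : step 1 a = a.1 := by simp [step, select]

lemma step_neg_one (a : ℝ × ℝ) : step (-1) a = -a.2 := by norm_num [step, select]

/-- Only one coordinate of the pair is used at each step, so the coupling of the two is immaterial;
the product is a convenient choice. -/
lemma MemClass.stepLaw_multiplierPair {p α : ℝ} (h0 : 0 ≤ p) (h1 : p ≤ 1)
    {μ : Measure (ℝ × ℝ)} (h : MemClass p α μ) : stepLaw p (multiplierPair p μ) = μ := by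
  have i1 := h.isProbabilityMeasure_multiplierLaw (σ := 1) (by simp)
  have i2 := h.isProbabilityMeasure_multiplierLaw (σ := -1) (by simp)
  have := h.isProbabilityMeasure_multiplierPair
  refine Measure.ext_of_lintegral _ fun f hf => ?_
  rw [lintegral_stepLaw hf, h.lintegral_eq h0 h1, ← h.lintegral_multiplierLaw (by simp) hf,
    ← h.lintegral_multiplierLaw (by simp) hf, multiplierPair]
  simp only [step_one, step_neg_one]
  rw [lintegral_prod _ (by fun_prop), lintegral_prod_symm _ (by fun_prop)]
  simp

lemma stepLaw_fst_eq_inter {p : ℝ} {κ : Measure (ℝ × ℝ)} [SFinite κ] {σ : ℝ}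
    (hσ : σ ∈ ({-1, 1} : Set ℝ)) {B : Set (ℝ × ℝ)} (hB : MeasurableSet B) :
    stepLaw p κ ({z | z.1 = σ} ∩ B) =
      ENNReal.ofReal (signWeight p σ) * κ {a | (σ, step σ a) ∈ B} := by
  have hm := (measurableSet_fst_eq σ).inter hB
  have hm' : MeasurableSet {a | (σ, step σ a) ∈ B} := by
    have : Measurable (fun a => (σ, step σ a)) := by fun_prop
    exact this hB
  rw [← lintegral_indicator_one hm, lintegral_stepLaw (measurable_one.indicator hm),
    ← lintegral_indicator_one hm']
  have e (a : ℝ × ℝ) : ({z : ℝ × ℝ | z.1 = σ} ∩ B).indicator (1 : ℝ × ℝ → ENNReal) (σ, step σ a) =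
      {a | (σ, step σ a) ∈ B}.indicator 1 a := by
    by_cases h : (σ, step σ a) ∈ B
    · rw [Set.indicator_of_mem (by exact ⟨rfl, h⟩), Set.indicator_of_mem (by exact h)]; rfl
    · rw [Set.indicator_of_notMem (fun hh => h hh.2), Set.indicator_of_notMem (by exact h)]
  have e' (τ : ℝ) (hτ : τ ≠ σ) (a : ℝ × ℝ) :
      ({z : ℝ × ℝ | z.1 = σ} ∩ B).indicator (1 : ℝ × ℝ → ENNReal) (τ, step τ a) = 0 := by
    exact Set.indicator_of_notMem (fun hh => hτ hh.1) _
  rcases hσ with rfl | rfl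
  · simp only [e, e' 1 (by norm_num), lintegral_zero, mul_zero, zero_add]
  · simp only [e, e' (-1) (by norm_num), lintegral_zero, mul_zero, add_zero]

lemma stepLaw_fst_eq {p : ℝ} {κ : Measure (ℝ × ℝ)} [IsProbabilityMeasure κ] {σ : ℝ}
    (hσ : σ ∈ ({-1, 1} : Set ℝ)) :
    stepLaw p κ {z | z.1 = σ} = ENNReal.ofReal (signWeight p σ) := by
  have := stepLaw_fst_eq_inter (p := p) (κ := κ) hσ MeasurableSet.univ
  simpa using this

/-- The transition law of `stepLaw p κ` is a step driven by `κ`. -/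
lemma transition_stepLaw {p : ℝ} {κ : Measure (ℝ × ℝ)} [IsProbabilityMeasure κ] {x : ℝ}
    (hx : x = 0 ∨ 0 < signWeight p (Real.sign x)) :
    transition (stepLaw p κ) x = κ.map (step x) := by
  have hms : Measurable (step x) := by fun_prop
  by_cases hx0 : x = 0
  · subst hx0
    rw [transition, if_pos rfl]
    have : step 0 = fun _ => 0 := funext step_zero
    rw [this, Measure.map_const, measure_univ, one_smul]
  -- Positive weight is essential: conditioning on a null event would give the zero measure instead
  -- of a transition law.
  have hw := hx.resolve_left hx0
  have hw' : ENNReal.ofReal (signWeight p (Real.sign x)) ≠ 0 := by simpa using hw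
  have hσ : Real.sign x ∈ ({-1, 1} : Set ℝ) := by
    rcases lt_or_gt_of_ne hx0 with h | h
    · simp [Real.sign_of_neg h]
    · simp [Real.sign_of_pos h]
  have hm : Measurable (fun z : ℝ × ℝ => x * z.2 / z.1) := by fun_prop
  rw [transition, if_neg hx0]
  ext B hB
  rw [Measure.map_apply hm hB, cond_apply (measurableSet_fst_eq _), stepLaw_fst_eq hσ,
    stepLaw_fst_eq_inter hσ (hm hB), ← mul_assoc, ENNReal.inv_mul_cancel hw' ENNReal.ofReal_ne_top,
    one_mul, Measure.map_apply hms hB]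
  congr 1
  ext a
  have : x * step (Real.sign x) a / Real.sign x = step x a := by
    rcases lt_or_gt_of_ne hx0 with h | h
    · rw [Real.sign_of_neg h, step_neg_one, step, select, if_neg h.not_gt, if_pos h]; ring
    · rw [Real.sign_of_pos h, step_one, step, select, if_pos h]; ring
  simp [this]

/-! ### Measures determined by rays, and uniqueness of the adjoint -/

/-- Finite measures that agree on the rays `(r, ∞)`, `r > 0`, agree on `(0, ∞)`. -/
lemma measure_eq_of_subset_Ioi {m m' : Measure ℝ} [IsFiniteMeasure m] [IsFiniteMeasure m']
    (h : ∀ r : ℝ, 0 < r → m (Set.Ioi r) = m' (Set.Ioi r)) {B : Set ℝ} (hB : MeasurableSet B)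
    (hB0 : B ⊆ Set.Ioi 0) : m B = m' B := by
  have h0 : m (Set.Ioi 0) = m' (Set.Ioi 0) := by
    have hU : Set.Ioi (0 : ℝ) = ⋃ n : ℕ, Set.Ioi (1 / ((n : ℝ) + 1)) := by
      ext x
      simp only [Set.mem_Ioi, Set.mem_iUnion]
      exact ⟨fun hx => exists_nat_one_div_lt hx, fun ⟨n, hn⟩ => lt_trans (by positivity) hn⟩
    have hmono : Monotone fun n : ℕ => Set.Ioi (1 / ((n : ℝ) + 1)) := fun i j hij =>
      Set.Ioi_subset_Ioi (one_div_le_one_div_of_le (by positivity) (by exact_mod_cast by omega))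
    rw [hU, hmono.measure_iUnion, hmono.measure_iUnion]
    exact iSup_congr fun n => h _ (by positivity)
  have key : m.restrict (Set.Ioi 0) = m'.restrict (Set.Ioi 0) := by
    refine ext_of_generate_finite _ (BorelSpace.measurable_eq.trans (borel_eq_generateFrom_Ioi ℝ))
      isPiSystem_Ioi ?_ (by simpa using h0)
    rintro _ ⟨a, rfl⟩
    rw [Measure.restrict_apply measurableSet_Ioi, Measure.restrict_apply measurableSet_Ioi,
      Set.Ioi_inter_Ioi]
    rcases (le_max_right a 0).lt_or_eq with h' | h'
    · exact h _ h'
    · rw [show a ⊔ 0 = 0 from h'.symm, h0]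
  have := congrArg (fun ν => ν B) key
  simpa only [Measure.restrict_apply hB, Set.inter_eq_left.2 hB0] using this

/-- Finite measures of the same mass that agree on the rays `(r, ∞)` and `(-∞, -r)`, `r > 0`,
are equal. -/
lemma measure_eq_of_rays {m m' : Measure ℝ} [IsFiniteMeasure m] [IsFiniteMeasure m']
    (hu : m Set.univ = m' Set.univ) (h : ∀ r : ℝ, 0 < r → m (Set.Ioi r) = m' (Set.Ioi r))
    (h' : ∀ r : ℝ, 0 < r → m (Set.Iio (-r)) = m' (Set.Iio (-r))) : m = m' := by
  refine ext_of_generate_finite _ (BorelSpace.measurable_eq.trans (borel_eq_generateFrom_Ioi ℝ))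
    isPiSystem_Ioi ?_ hu
  rintro _ ⟨a, rfl⟩
  by_cases ha : 0 ≤ a
  · exact measure_eq_of_subset_Ioi h measurableSet_Ioi (Set.Ioi_subset_Ioi ha)
  · have e (ν : Measure ℝ) (B : Set ℝ) (hB : MeasurableSet B) :
        (ν.map (fun x => -x)) B = ν ((fun x => -x) ⁻¹' B) :=
      Measure.map_apply measurable_neg hB
    have : m (Set.Iic a) = m' (Set.Iic a) := by
      have := measure_eq_of_subset_Ioi (m := m.map (fun x => -x)) (m' := m'.map (fun x => -x))
        (B := Set.Ici (-a)) (fun r hr => by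
          rw [e _ _ measurableSet_Ioi, e _ _ measurableSet_Ioi]
          simpa using h' r hr) measurableSet_Ici (fun x (hx : -a ≤ x) => by
          rw [Set.mem_Ioi]; linarith [not_le.1 ha])
      rw [e _ _ measurableSet_Ici, e _ _ measurableSet_Ici] at this
      simpa using this
    rw [← Set.compl_Iic, measure_compl measurableSet_Iic (measure_ne_top _ _),
      measure_compl measurableSet_Iic (measure_ne_top _ _), hu, this]

/-- The tail of a variable is recovered from its truncated means. -/
lemma tendsto_truncated_integral {β : Type*} [MeasurableSpace β] (μ : Measure β)
    [IsFiniteMeasure μ] {W : β → ℝ} (hW : Measurable W) (c : ℝ) :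
    Tendsto (fun n : ℕ => ∫ z, (n : ℝ) * (min (W z) (c + 1 / n) - min (W z) c) ∂μ) atTop
      (𝓝 (μ.real {z | c < W z})) := by
  have hs : MeasurableSet {z | c < W z} := measurableSet_lt measurable_const hW
  rw [← integral_indicator_one hs]
  -- The integrand is the slope of the truncation over `[c, c + 1/n]`. It lies between `0` and `1`
  -- and converges pointwise to the indicator, so no integrability of `W` is needed.
  refine tendsto_integral_of_dominated_convergence (fun _ => 1) ?_ (integrable_const _) ?_ ?_
  · intro n; exact Measurable.aestronglyMeasurable (by fun_prop)
  · intro n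
    refine .of_forall fun z => ?_
    rcases Nat.eq_zero_or_pos n with rfl | hn
    · simp
    have hn' : (0 : ℝ) < n := by exact_mod_cast hn
    have hd : (0 : ℝ) < 1 / n := by positivity
    have h1 : min (W z) (c + 1 / n) ≤ min (W z) c + 1 / n := by
      rcases le_total (W z) c with h | h
      · rw [min_eq_left h]; linarith [min_le_left (W z) (c + 1 / n)]
      · rw [min_eq_right h]; exact min_le_right _ _
    have h2 : min (W z) c ≤ min (W z) (c + 1 / n) := min_le_min_left _ (by linarith)
    rw [Real.norm_eq_abs, abs_of_nonneg (mul_nonneg hn'.le (by linarith))]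
    calc (n : ℝ) * (min (W z) (c + 1 / n) - min (W z) c) ≤ n * (1 / n) := by gcongr; linarith
      _ = 1 := by field_simp
  · refine .of_forall fun z => ?_
    by_cases hz : c < W z
    · rw [Set.indicator_of_mem (by exact hz)]
      refine tendsto_const_nhds.congr' ?_
      have := (tendsto_one_div_atTop_nhds_zero_nat (𝕜 := ℝ)).eventually_lt_const (sub_pos.2 hz)
      filter_upwards [this, eventually_gt_atTop 0] with n hn hn0
      have hn' : (0 : ℝ) < n := by exact_mod_cast hn0
      rw [min_eq_right (by linarith), min_eq_right hz.le]
      simp only [Pi.one_apply]; field_simp; ring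
    · rw [Set.indicator_of_notMem (by exact hz)]
      refine tendsto_const_nhds.congr' ?_
      filter_upwards [eventually_gt_atTop 0] with n hn0
      have hn' : (0 : ℝ) < n := by exact_mod_cast hn0
      have : (0 : ℝ) < 1 / n := by positivity
      rw [min_eq_left (by linarith [not_lt.1 hz]), min_eq_left (not_lt.1 hz)]; ring

/-- The adjoint of a law is unique. -/
lemma IsAdjoint.unique {p α : ℝ} (hα : 0 < α) (h0 : 0 ≤ p) (h1 : p ≤ 1)
    {μ μ₁ μ₂ : Measure (ℝ × ℝ)} (ha : IsAdjoint p α μ μ₁) (hb : IsAdjoint p α μ μ₂) :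
    μ₁ = μ₂ := by
  have i1 := ha.mem_right.isProb
  have i2 := hb.mem_right.isProb
  have z0 : (0 : ℝ) ^ α = 0 := Real.zero_rpow hα.ne'
  have hσ' : ∀ σ ∈ ({-1, 1} : Set ℝ), σ * σ = 1 := by rintro σ (rfl | rfl) <;> norm_num
  -- truncated means on `{z.1 = σ}`
  have trunc (σ : ℝ) (hσ : σ ∈ ({-1, 1} : Set ℝ)) (s c : ℝ) (hc : 0 < c)
      (ν : Measure (ℝ × ℝ)) (hν : MemClass p α ν) :
      ∫ z in {z | z.1 = σ}, min ((max (s * z.2) 0) ^ α) c ∂ν =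
        c * ∫ z, min ((max ((c ^ (-(1 / α)) * s) * z.2) 0) ^ α) ((max (σ * z.1) 0) ^ α) ∂ν := by
    rw [← integral_indicator (measurableSet_fst_eq σ), ← integral_const_mul]
    refine integral_congr_ae ?_
    filter_upwards [hν.ae_sign h0 h1] with z hz
    have hw : 0 < c ^ (-(1 / α)) := by positivity
    -- Rescaling the argument by `c ^ (-(1 / α))` turns truncation at `1` into truncation at `c`,
    -- which brings the mean into the form of the adjoint identity.
    have hcw : c * (c ^ (-(1 / α))) ^ α = 1 := by
      rw [← Real.rpow_mul hc.le, show -(1 / α) * α = -1 by field_simp, Real.rpow_neg_one,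
        mul_inv_cancel₀ hc.ne']
    by_cases hzσ : z.1 = σ
    · rw [Set.indicator_of_mem (by exact hzσ), hzσ, hσ' σ hσ, max_eq_left zero_le_one,
        Real.one_rpow, mul_assoc, ← max_mul_rpow hw, mul_min_of_nonneg _ _ hc.le, ← mul_assoc, hcw,
        one_mul, mul_one]
    · rw [Set.indicator_of_notMem (by exact hzσ)]
      have : σ * z.1 = -1 := by
        rcases hσ with rfl | rfl <;> rcases hz with hz | hz <;> simp_all
      rw [this, max_eq_right (show (-1 : ℝ) ≤ 0 by norm_num), z0, min_eq_right (by positivity),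
        mul_zero]
  -- The identity fixes every truncated mean of an adjoint through `μ` alone, and difference
  -- quotients in the truncation level recover the tails.
  have ray (σ : ℝ) (hσ : σ ∈ ({-1, 1} : Set ℝ)) (s r : ℝ) (hr : 0 < r) :
      (μ₁.restrict {z | z.1 = σ}) {z | r < s * z.2} =
        (μ₂.restrict {z | z.1 = σ}) {z | r < s * z.2} := by
    have hset : {z : ℝ × ℝ | r < s * z.2} = {z | r ^ α < (max (s * z.2) 0) ^ α} := by
      ext z
      change r < s * z.2 ↔ r ^ α < (max (s * z.2) 0) ^ α
      rw [Real.rpow_lt_rpow_iff hr.le (le_max_right _ _) hα, lt_max_iff]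
      simp [hr.le]
    rw [← measureReal_eq_measureReal_iff, hset]
    have hm : Measurable fun z : ℝ × ℝ => (max (s * z.2) 0) ^ α := by fun_prop
    refine tendsto_nhds_unique (tendsto_truncated_integral _ hm _)
      ((tendsto_truncated_integral _ hm _).congr' ?_)
    filter_upwards [eventually_gt_atTop 0] with n hn0
    have hn' : (0 : ℝ) < n := by exact_mod_cast hn0
    have hint (ν : Measure (ℝ × ℝ)) [IsProbabilityMeasure ν] (c : ℝ) (hc : 0 ≤ c) :
        Integrable (fun z : ℝ × ℝ => min ((max (s * z.2) 0) ^ α) c)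
          (ν.restrict {z | z.1 = σ}) := by
      refine Integrable.of_bound (C := c) (Measurable.aestronglyMeasurable (by fun_prop))
        (.of_forall fun z => ?_)
      rw [Real.norm_eq_abs, abs_of_nonneg (by positivity)]
      exact min_le_right _ _
    have hc : 0 < r ^ α := by positivity
    have hc' : 0 < r ^ α + 1 / n := by positivity
    rw [integral_const_mul, integral_const_mul,
      integral_sub (hint _ _ hc'.le) (hint _ _ hc.le),
      integral_sub (hint _ _ hc'.le) (hint _ _ hc.le),
      trunc σ hσ s _ hc' _ ha.mem_right, trunc σ hσ s _ hc _ ha.mem_right,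
      trunc σ hσ s _ hc' _ hb.mem_right, trunc σ hσ s _ hc _ hb.mem_right,
      ← ha.identity, ← hb.identity, ← ha.identity, ← hb.identity]
  have slice (σ : ℝ) (hσ : σ ∈ ({-1, 1} : Set ℝ)) :
      (μ₁.restrict {z | z.1 = σ}).map Prod.snd = (μ₂.restrict {z | z.1 = σ}).map Prod.snd := by
    refine measure_eq_of_rays ?_ (fun r hr => ?_) (fun r hr => ?_)
    · rw [Measure.map_apply measurable_snd .univ, Measure.map_apply measurable_snd .univ]
      simp [ha.mem_right.sign σ hσ, hb.mem_right.sign σ hσ]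
    · rw [Measure.map_apply measurable_snd measurableSet_Ioi,
        Measure.map_apply measurable_snd measurableSet_Ioi]
      have := ray σ hσ 1 r hr
      simp only [one_mul] at this
      exact this
    · rw [Measure.map_apply measurable_snd measurableSet_Iio,
        Measure.map_apply measurable_snd measurableSet_Iio]
      have := ray σ hσ (-1) r hr
      have e : {z : ℝ × ℝ | r < -1 * z.2} = Prod.snd ⁻¹' Set.Iio (-r) := by
        ext z
        change r < -1 * z.2 ↔ z.2 < -r
        constructor <;> intro h <;> linarith
      rwa [e] at this
  refine Measure.ext_of_lintegral _ fun f hf => ?_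
  have e (ν : Measure (ℝ × ℝ)) (σ : ℝ) :
      ∫⁻ z in {z | z.1 = σ}, f z ∂ν =
        ∫⁻ t, f (σ, t) ∂((ν.restrict {z | z.1 = σ}).map Prod.snd) := by
    rw [lintegral_map (by fun_prop) measurable_snd]
    refine setLIntegral_congr_fun (measurableSet_fst_eq σ) fun z (hz : z.1 = σ) => ?_
    simp only [← hz]
  rw [ha.mem_right.lintegral_eq h0 h1, hb.mem_right.lintegral_eq h0 h1, e, e, e, e,
    slice 1 (by simp), slice (-1) (by simp)]

/-! ### Pareto law and measurability of transitions -/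

/-- The Pareto law. -/
def pareto (α : ℝ) : Measure ℝ := (tailMeasure α).restrict (Set.Ioi 1)

lemma isProbabilityMeasure_pareto {α : ℝ} (hα : 0 < α) : IsProbabilityMeasure (pareto α) :=
  ⟨by rw [pareto, Measure.restrict_apply_univ, tailMeasure_Ioi hα one_pos]; simp⟩

lemma pareto_Ioi {α y : ℝ} (hα : 0 < α) (hy : 1 ≤ y) :
    pareto α (Set.Ioi y) = ENNReal.ofReal (y ^ (-α)) := by
  rw [pareto, Measure.restrict_apply measurableSet_Ioi, Set.Ioi_inter_Ioi, sup_eq_left.2 hy,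
    tailMeasure_Ioi hα (by linarith)]

lemma eq_pareto {α : ℝ} (hα : 0 < α) {m : Measure ℝ} [IsProbabilityMeasure m]
    (h : ∀ y : ℝ, 1 ≤ y → m (Set.Ioi y) = ENNReal.ofReal (y ^ (-α))) : m = pareto α := by
  have := isProbabilityMeasure_pareto hα
  have aux (ν : Measure ℝ) [IsProbabilityMeasure ν]
      (hν : ∀ y : ℝ, 1 ≤ y → ν (Set.Ioi y) = ENNReal.ofReal (y ^ (-α))) (a : ℝ) (ha : a ≤ 1) :
      ν (Set.Ioi a) = 1 := by
    refine le_antisymm prob_le_one ?_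
    have := hν 1 le_rfl
    simp only [Real.one_rpow, ENNReal.ofReal_one] at this
    rw [← this]
    exact measure_mono (Set.Ioi_subset_Ioi ha)
  refine ext_of_generate_finite _ (BorelSpace.measurable_eq.trans (borel_eq_generateFrom_Ioi ℝ))
    isPiSystem_Ioi ?_ (by simp)
  rintro _ ⟨a, rfl⟩
  rcases le_total a 1 with ha | ha
  · rw [aux m h a ha, aux _ (fun y hy => pareto_Ioi hα hy) a ha]
  · rw [h a ha, pareto_Ioi hα ha]

lemma measurable_transition {μ : Measure (ℝ × ℝ)} [IsFiniteMeasure μ] {B : Set ℝ}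
    (hB : MeasurableSet B) : Measurable fun x => (transition μ x).real B := by
  have h (σ : ℝ) : Measurable fun x : ℝ => ((μ[|{z : ℝ × ℝ | z.1 = σ}]).map
      (fun z => x * z.2 / z.1)) B := by
    have hm : MeasurableSet {q : ℝ × (ℝ × ℝ) | q.1 * q.2.2 / q.2.1 ∈ B} := by
      have : Measurable fun q : ℝ × (ℝ × ℝ) => q.1 * q.2.2 / q.2.1 := by fun_prop
      exact this hB
    have e : (fun x : ℝ => ((μ[|{z : ℝ × ℝ | z.1 = σ}]).map (fun z => x * z.2 / z.1)) B) =
        fun x => (μ[|{z : ℝ × ℝ | z.1 = σ}]) (Prod.mk x ⁻¹' {q | q.1 * q.2.2 / q.2.1 ∈ B}) := by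
      ext x
      rw [Measure.map_apply (by fun_prop) hB]
      rfl
    rw [e]
    exact measurable_measure_prodMk_left hm
  have e : (fun x => (transition μ x).real B) = fun x => if x = 0 then
      (Measure.dirac (0 : ℝ) : Measure ℝ).real B else if 0 < x then
      (((μ[|{z : ℝ × ℝ | z.1 = 1}]).map (fun z => x * z.2 / z.1)) B).toReal else
      (((μ[|{z : ℝ × ℝ | z.1 = -1}]).map (fun z => x * z.2 / z.1)) B).toReal := by
    ext x
    unfold transition
    rcases lt_trichotomy x 0 with hx | hx | hx
    · rw [if_neg hx.ne, if_neg hx.ne, if_neg hx.not_gt, Real.sign_of_neg hx]; rfl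
    · rw [if_pos hx, if_pos hx]
    · rw [if_neg hx.ne', if_neg hx.ne', if_pos hx, Real.sign_of_pos hx]; rfl
  rw [e]
  exact Measurable.ite (measurableSet_singleton 0) measurable_const
    (Measurable.ite measurableSet_Ioi (h 1).ennreal_toReal (h (-1)).ennreal_toReal)

/-- The joint law of a variable and the past when the conditional law is a transition law. -/
lemma measureReal_inter_of_condExp {Ω : Type*} {𝒢 mΩ : MeasurableSpace Ω} {P : Measure Ω}
    [IsProbabilityMeasure P] {β : Type*} [MeasurableSpace β] {μ : Measure (ℝ × ℝ)}
    [IsFiniteMeasure μ] (h𝒢 : 𝒢 ≤ mΩ) {N : Ω → ℝ} (hN : Measurable N)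
    {V : Ω → β} (hV : Measurable[𝒢] V) {g : β → ℝ} (hg : Measurable g)
    {A : Set β} (hA : MeasurableSet A) {B : Set ℝ} (hB : MeasurableSet B)
    (h : P⟦N ⁻¹' B | 𝒢⟧ =ᵐ[P] fun ω => (transition μ (g (V ω))).real B) :
    P.real (V ⁻¹' A ∩ N ⁻¹' B) = ∫ v in A, (transition μ (g v)).real B ∂(P.map V) := by
  have hV' : Measurable V := hV.mono h𝒢 le_rfl
  rw [setIntegral_map (f := fun v => (transition μ (g v)).real B) hA
    ((measurable_transition hB).comp hg).aestronglyMeasurable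
    hV'.aemeasurable, ← setIntegral_congr_ae (f := P⟦N ⁻¹' B | 𝒢⟧) (hV' hA)
    (h.mono fun ω hω _ => hω), setIntegral_condExp h𝒢 _ (hV hA)]
  · rw [setIntegral_indicator (hN hB)]
    simp
  · exact (integrable_const _).indicator (hN hB)

/-! ### Uniqueness of the finite-dimensional laws -/

section Uniqueness

variable {Ω : Type*} {mΩ : MeasurableSpace Ω} {P : Measure Ω} [IsProbabilityMeasure P]

/-- Sequences agreeing with `m` on `J` and vanishing elsewhere. -/
def window (J : Finset ℤ) (m : ℤ → ℝ) (i : ℤ) : ℝ := if i ∈ J then m i else 0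

lemma measurable_window (J : Finset ℤ) : Measurable (window J) := by
  refine measurable_pi_lambda _ fun i => ?_
  unfold window
  split_ifs <;> fun_prop

lemma window_insert (J : Finset ℤ) (t : ℤ) (m : ℤ → ℝ) :
    window (insert t J) m = Function.update (window J m) t (m t) := by
  ext i
  by_cases h : i = t
  · subst h; simp [window]
  · simp [window, h]

/-- The joint law of a window and one further coordinate given by a transition law. -/
lemma measureReal_map_window_prod {μ : Measure (ℝ × ℝ)} [IsFiniteMeasure μ] {M : ℤ → Ω → ℝ}
    (hM : ∀ t, Measurable (M t)) {J : Finset ℤ} {I : Set ℤ} (hJ : ∀ j ∈ J, j ∈ I) {t r : ℤ}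
    (hr : r ∈ J) {A : Set (ℤ → ℝ)} (hA : MeasurableSet A) {B : Set ℝ} (hB : MeasurableSet B)
    (h : P⟦M t ⁻¹' B | ⨆ j : I, MeasurableSpace.comap (M j) inferInstance⟧
      =ᵐ[P] fun ω => (transition μ (M r ω)).real B) :
    (P.map (fun ω => (window J (fun i => M i ω), M t ω))).real (A ×ˢ B) =
      ∫ v in A, (transition μ (v r)).real B ∂(P.map (fun ω => window J fun i => M i ω)) := by
  have hV : Measurable[⨆ j : I, MeasurableSpace.comap (M j) inferInstance]
      (fun ω => window J fun i => M i ω) := by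
    refine @measurable_pi_lambda _ _ _ (_) _ _ fun i => ?_
    by_cases hi : i ∈ J
    · simp only [window, hi, if_true]
      refine Measurable.mono (comap_measurable (M i)) ?_ le_rfl
      exact le_iSup (fun j : I => MeasurableSpace.comap (M j) inferInstance) ⟨i, hJ i hi⟩
    · simp only [window, hi, if_false]
      exact measurable_const
  have h𝒢 : (⨆ j : I, MeasurableSpace.comap (M j) inferInstance) ≤ mΩ :=
    iSup_le fun j => (hM j).comap_le
  have hV' := hV.mono h𝒢 le_rfl
  rw [← measureReal_inter_of_condExp h𝒢 (hM t) hV (measurable_pi_apply r) hA hB,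
    map_measureReal_apply (hV'.prodMk (hM t)) (hA.prod hB)]
  · rfl
  · refine h.trans (.of_forall fun ω => ?_)
    simp [window, hr]

variable {Ω' : Type*} {mΩ' : MeasurableSpace Ω'} {P' : Measure Ω'} [IsProbabilityMeasure P']

/-- Window laws extend by one more coordinate whose conditional law is a transition law. -/
lemma map_window_insert {μ : Measure (ℝ × ℝ)} [IsFiniteMeasure μ] {M : ℤ → Ω → ℝ}
    (hM : ∀ t, Measurable (M t)) {M' : ℤ → Ω' → ℝ} (hM' : ∀ t, Measurable (M' t))
    {J : Finset ℤ} {I : Set ℤ} (hJ : ∀ j ∈ J, j ∈ I) {t r : ℤ} (hr : r ∈ J)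
    (h : ∀ B : Set ℝ, MeasurableSet B →
      P⟦M t ⁻¹' B | ⨆ j : I, MeasurableSpace.comap (M j) inferInstance⟧
      =ᵐ[P] fun ω => (transition μ (M r ω)).real B)
    (h' : ∀ B : Set ℝ, MeasurableSet B →
      P'⟦M' t ⁻¹' B | ⨆ j : I, MeasurableSpace.comap (M' j) inferInstance⟧
      =ᵐ[P'] fun ω => (transition μ (M' r ω)).real B)
    (heq : P.map (fun ω => window J fun i => M i ω) = P'.map (fun ω => window J fun i => M' i ω)) :
    P.map (fun ω => window (insert t J) fun i => M i ω) =
      P'.map (fun ω => window (insert t J) fun i => M' i ω) := by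
  have hW : Measurable fun ω => window J fun i => M i ω :=
    (measurable_window J).comp (measurable_pi_lambda _ hM)
  have hW' : Measurable fun ω => window J fun i => M' i ω :=
    (measurable_window J).comp (measurable_pi_lambda _ hM')
  have hprod : P.map (fun ω => (window J (fun i => M i ω), M t ω)) =
      P'.map (fun ω => (window J (fun i => M' i ω), M' t ω)) := by
    have := Measure.isProbabilityMeasure_map (μ := P) (hW.prodMk (hM t)).aemeasurable
    have := Measure.isProbabilityMeasure_map (μ := P') (hW'.prodMk (hM' t)).aemeasurable
    refine Measure.ext_prod fun {A B} hA hB => ?_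
    rw [← measureReal_eq_measureReal_iff, measureReal_map_window_prod hM hJ hr hA hB (h B hB),
      measureReal_map_window_prod hM' hJ hr hA hB (h' B hB), heq]
  have hupd : Measurable fun q : (ℤ → ℝ) × ℝ => Function.update q.1 t q.2 := by
    refine measurable_pi_lambda _ fun i => ?_
    by_cases hi : i = t
    · subst hi; simpa using measurable_snd
    · simp only [Function.update_of_ne hi]; fun_prop
  have := congrArg (Measure.map fun q : (ℤ → ℝ) × ℝ => Function.update q.1 t q.2) hprod
  rw [Measure.map_map hupd (hW.prodMk (hM t)), Measure.map_map hupd (hW'.prodMk (hM' t))] at this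
  simpa only [Function.comp_def, ← window_insert] using this

lemma Icc_insert_right (s t : ℕ) :
    (Finset.Icc (-s : ℤ) ((t + 1 : ℕ) : ℤ)) = insert ((t : ℤ) + 1) (Finset.Icc (-s : ℤ) t) := by
  ext i; simp only [Finset.mem_Icc, Finset.mem_insert]; omega

lemma Icc_insert_left (s t : ℕ) :
    (Finset.Icc (-((s + 1 : ℕ) : ℤ)) (t : ℤ)) =
      insert (-((s : ℤ) + 1)) (Finset.Icc (-s : ℤ) t) := by
  ext i; simp only [Finset.mem_Icc, Finset.mem_insert]; omega

/-- The finite-dimensional laws of a back-and-forth tail chain are unique. -/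
lemma IsBFTC.map_window_eq {p α : ℝ} (hα : 0 < α) (h0 : 0 ≤ p) (h1 : p ≤ 1)
    {μ : Measure (ℝ × ℝ)} {M : ℤ → Ω → ℝ} {M' : ℤ → Ω' → ℝ} (h : IsBFTC p α μ P M)
    (h' : IsBFTC p α μ P' M') (s t : ℕ) :
    P.map (fun ω => window (Finset.Icc (-s : ℤ) t) fun i => M i ω) =
      P'.map (fun ω => window (Finset.Icc (-s : ℤ) t) fun i => M' i ω) := by
  have := h.law_backward.mem_left.isProb
  have := h.law_backward.mem_right.isProb
  have hback := h.law_backward.unique hα h0 h1 h'.law_backward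
  -- Windows grow first to the right from time `0`, then to the left; each new coordinate sees only
  -- the window already treated through its neighbour.
  induction s with
  | zero =>
    induction t with
    | zero =>
      have e (m : ℤ → ℝ) : window (Finset.Icc (-(0 : ℕ) : ℤ) (0 : ℕ)) m =
          Function.update (fun _ => 0) 0 (m 0) := by
        rw [show Finset.Icc (-(0 : ℕ) : ℤ) (0 : ℕ) = insert 0 ∅ by rfl, window_insert]
        congr 1
      have hupd : Measurable fun x : ℝ × ℝ => Function.update (fun _ : ℤ => (0 : ℝ)) 0 x.1 := by
        refine measurable_pi_lambda _ fun i => ?_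
        by_cases hi : i = 0
        · subst hi; simpa using measurable_fst
        · simp [hi]
      simp only [e]
      -- The law of `M 0` alone is the first marginal of the common forward law.
      have := congrArg (Measure.map fun x : ℝ × ℝ =>
        Function.update (fun _ : ℤ => (0 : ℝ)) 0 x.1) (h.law_forward.trans h'.law_forward.symm)
      rwa [Measure.map_map hupd ((h.measurable 0).prodMk (h.measurable 1)),
        Measure.map_map hupd ((h'.measurable 0).prodMk (h'.measurable 1))] at this
    | succ t ih =>
      rw [Icc_insert_right]
      refine map_window_insert (μ := μ) h.measurable h'.measurable
        (I := Set.Iio ((t : ℤ) + 1)) (r := t)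
        (fun j hj => ?_) (by simp) (fun B hB => ?_) (fun B hB => ?_) ih
      · have := (Finset.mem_Icc.1 hj).2
        exact Set.mem_Iio.2 (by omega)
      · have := h.forward (t + 1) (by omega) B hB
        simpa using this
      · have := h'.forward (t + 1) (by omega) B hB
        simpa using this
  | succ s ih =>
    rw [Icc_insert_left]
    refine map_window_insert h.measurable h'.measurable (I := Set.Ioi (-((s : ℤ) + 1))) (r := -s)
      (μ := P.map (fun ω => (M 0 ω, M (-1) ω)))
      (fun j hj => ?_) (by simp) (fun B hB => ?_) (fun B hB => ?_) ih
    · have := (Finset.mem_Icc.1 hj).1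
      exact Set.mem_Ioi.2 (by omega)
    · have := h.backward (s + 1) (by omega) B hB
      rwa [show -((s : ℤ) + 1) + 1 = -s by ring] at this
    · have := h'.backward (s + 1) (by omega) B hB
      rw [show -((s : ℤ) + 1) + 1 = -s by ring] at this
      rwa [hback]

end Uniqueness

/-! ### Conditional laws under fresh independent multipliers -/

/-- The sequence `a` up to time `n`, continued by a constant. -/
def truncSeq (n : ℕ) (a : ℕ → ℝ × ℝ) (k : ℕ) : ℝ × ℝ := if k < n then a k else 0

@[fun_prop]
lemma measurable_truncSeq (n : ℕ) : Measurable (truncSeq n) := by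
  refine measurable_pi_lambda _ fun i => ?_
  unfold truncSeq
  split_ifs <;> fun_prop

lemma path_truncSeq (x : ℝ) (a : ℕ → ℝ × ℝ) {n k : ℕ} (h : k ≤ n) :
    path x (truncSeq n a) k = path x a k := by
  induction k with
  | zero => rfl
  | succ k ih => rw [path, path, ih (by omega), truncSeq, if_pos (by omega)]

/-- Entries from `n` on are replaced by a constant, so `truncSeq n` is measurable with respect to
the entries before `n`. -/
lemma indepFun_truncSeq (κ : Measure (ℝ × ℝ)) [IsProbabilityMeasure κ] (n : ℕ) :
    IndepFun (truncSeq n) (fun a => a n) (Measure.infinitePi fun _ : ℕ => κ) := by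
  have hind : iIndepFun (fun n (a : ℕ → ℝ × ℝ) => a n) (Measure.infinitePi fun _ : ℕ => κ) :=
    iIndepFun_infinitePi (X := fun _ x => x) (fun _ => measurable_id)
  have := indep_iSup_of_disjoint (m := fun n : ℕ => MeasurableSpace.comap
    (fun a : ℕ → ℝ × ℝ => a n) inferInstance) (fun n => (measurable_pi_apply n).comap_le) hind
    (S := Set.Iio n) (T := {n}) (by simp)
  refine (IndepFun_iff_Indep _ _ _).2
    (indep_of_indep_of_le_left (indep_of_indep_of_le_right this ?_) ?_)
  · simp
  · rw [MeasurableSpace.pi, MeasurableSpace.comap_iSup]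
    refine iSup_le fun k => ?_
    rw [MeasurableSpace.comap_comp]
    by_cases hk : k < n
    · have e : (fun b : ℕ → ℝ × ℝ => b k) ∘ truncSeq n = fun a => a k := by
        ext1 a; simp [truncSeq, hk]
      rw [e]
      exact le_iSup₂_of_le (f := fun n' (_ : n' ∈ Set.Iio n) =>
        MeasurableSpace.comap (fun a : ℕ → ℝ × ℝ => a n') inferInstance) k hk le_rfl
    · have e : (fun b : ℕ → ℝ × ℝ => b k) ∘ truncSeq n = fun a => 0 := by
        ext1 a; simp [truncSeq, hk]
      rw [e, MeasurableSpace.comap_const]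
      exact bot_le

/-- The current entry of an i.i.d. sequence is independent of the earlier ones, jointly with
anything that is independent of the sequence. -/
lemma indepFun_prodMk_truncSeq {Ω 𝒲 : Type*} [MeasurableSpace Ω] [MeasurableSpace 𝒲]
    {P : Measure Ω} {τ : Measure 𝒲} [IsProbabilityMeasure τ] {κ : Measure (ℝ × ℝ)}
    [IsProbabilityMeasure κ] {E : Ω → 𝒲} {A : Ω → ℕ → ℝ × ℝ} (hE : Measurable E)
    (hA : Measurable A)
    (h : P.map (fun ω => (E ω, A ω)) = τ.prod (Measure.infinitePi fun _ : ℕ => κ)) (n : ℕ) :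
    IndepFun (fun ω => (E ω, truncSeq n (A ω))) (fun ω => A ω n) P := by
  set Γ := Measure.infinitePi fun _ : ℕ => κ with hΓ
  have hEA : Measurable fun ω => (E ω, A ω) := hE.prodMk hA
  have hU : Measurable fun q : 𝒲 × (ℕ → ℝ × ℝ) => (q.1, truncSeq n q.2) := by fun_prop
  rw [indepFun_iff_measure_inter_preimage_eq_mul]
  intro s t hs ht
  have hsU := hU hs
  have htU : MeasurableSet {q : 𝒲 × (ℕ → ℝ × ℝ) | q.2 n ∈ t} := by
    have : Measurable fun q : 𝒲 × (ℕ → ℝ × ℝ) => q.2 n := by fun_prop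
    exact this ht
  have e1 := Measure.map_apply (μ := P) hEA (hsU.inter htU)
  have e2 := Measure.map_apply (μ := P) hEA hsU
  have e3 := Measure.map_apply (μ := P) hEA htU
  change _ = P ((fun ω => (E ω, truncSeq n (A ω))) ⁻¹' s ∩ (fun ω => A ω n) ⁻¹' t) at e1
  change _ = P ((fun ω => (E ω, truncSeq n (A ω))) ⁻¹' s) at e2
  change _ = P ((fun ω => A ω n) ⁻¹' t) at e3
  rw [← e1, ← e2, ← e3, h, Measure.prod_apply (hsU.inter htU), Measure.prod_apply hsU,
    Measure.prod_apply htU]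
  have hI := (indepFun_truncSeq κ n).measure_inter_preimage_eq_mul
  have m (w : 𝒲) : MeasurableSet {a | (w, a) ∈ s} := by
    have : Measurable fun a : ℕ → ℝ × ℝ => (w, a) := by fun_prop
    exact this hs
  have f1 (w : 𝒲) : Γ (Prod.mk w ⁻¹' ((fun q : 𝒲 × (ℕ → ℝ × ℝ) => (q.1, truncSeq n q.2)) ⁻¹' s ∩
      {q : 𝒲 × (ℕ → ℝ × ℝ) | q.2 n ∈ t})) =
      Γ (Prod.mk w ⁻¹' ((fun q : 𝒲 × (ℕ → ℝ × ℝ) => (q.1, truncSeq n q.2)) ⁻¹' s)) *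
        Γ ((fun a => a n) ⁻¹' t) := hI _ _ (m w) ht
  simp_rw [f1]
  rw [lintegral_mul_const _ (measurable_measure_prodMk_left hsU)]
  congr 1
  change _ = ∫⁻ _, Γ ((fun a => a n) ⁻¹' t) ∂τ
  simp

/-- The conditional law of a step driven by a fresh independent pair of multipliers. -/
lemma condExp_step {Ω : Type*} {𝒢 mΩ : MeasurableSpace Ω} {P : Measure Ω}
    [IsProbabilityMeasure P] {β : Type*} [mβ : MeasurableSpace β] {V : Ω → β} (hV : Measurable V)
    (h𝒢 : 𝒢 ≤ mβ.comap V) {g : β → ℝ} (hg : Measurable g)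
    (hgV : Measurable[𝒢] fun ω => g (V ω)) {U : Ω → ℝ × ℝ} (hU : Measurable U)
    (hUV : IndepFun V U P) {N : Ω → ℝ} (hN : ∀ ω, N ω = step (g (V ω)) (U ω)) {B : Set ℝ}
    (hB : MeasurableSet B) :
    P⟦N ⁻¹' B | 𝒢⟧ =ᵐ[P] fun ω => ((P.map U).map (step (g (V ω)))).real B := by
  have hle : 𝒢 ≤ mΩ := h𝒢.trans hV.comap_le
  have hprob := Measure.isProbabilityMeasure_map (μ := P) hU.aemeasurable
  have hNm : Measurable N := by
    rw [show N = fun ω => step (g (V ω)) (U ω) from funext hN]; fun_prop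
  have hS : MeasurableSet {q : β × (ℝ × ℝ) | step (g q.1) q.2 ∈ B} := by
    have : Measurable fun q : β × (ℝ × ℝ) => step (g q.1) q.2 := by fun_prop
    exact this hB
  have hS' : MeasurableSet {q : ℝ × (ℝ × ℝ) | step q.1 q.2 ∈ B} := measurable_step hB
  have hk : Measurable fun x => ((P.map U).map (step x)) B := by
    have e : (fun x => ((P.map U).map (step x)) B) =
        fun x => (P.map U) (Prod.mk x ⁻¹' {q | step q.1 q.2 ∈ B}) := by
      ext x
      rw [Measure.map_apply (by fun_prop) hB]
      rfl
    rw [e]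
    exact measurable_measure_prodMk_left hS'
  have hk' : ∀ x, ((P.map U).map (step x)) B ≤ 1 := fun x => by
    have : IsProbabilityMeasure ((P.map U).map (step x)) :=
      Measure.isProbabilityMeasure_map (by fun_prop)
    exact prob_le_one
  refine (ae_eq_condExp_of_forall_setIntegral_eq hle ((integrable_const (1 : ℝ)).indicator
    (hNm hB)) (fun s _ _ => ?_) (fun s hs _ => ?_) ?_).symm
  · refine Integrable.of_bound (C := 1) ((hk.comp (hg.comp hV)).ennreal_toReal.aestronglyMeasurable)
      (.of_forall fun ω => ?_)
    rw [Real.norm_eq_abs, abs_of_nonneg measureReal_nonneg]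
    exact ENNReal.toReal_le_of_le_ofReal zero_le_one (by simpa using hk' _)
  -- Events of `𝒢` are events of `V`, so the defining identity of conditional expectation becomes
  -- Fubini for the product law of `V` and `U`.
  · obtain ⟨A, hA, rfl⟩ := h𝒢 s hs
    rw [setIntegral_indicator (hNm hB)]
    have e := Measure.map_apply (μ := P) (hV.prodMk hU) ((measurable_fst hA).inter hS)
    have hlaw := (indepFun_iff_map_prod_eq_prod_map_map hV.aemeasurable hU.aemeasurable).1 hUV
    have hpre : (fun ω => (V ω, U ω)) ⁻¹' (Prod.fst ⁻¹' A ∩ {q | step (g q.1) q.2 ∈ B}) =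
        V ⁻¹' A ∩ N ⁻¹' B := by
      ext ω
      change (V ω ∈ A ∧ step (g (V ω)) (U ω) ∈ B) ↔ (V ω ∈ A ∧ N ω ∈ B)
      rw [hN]
    rw [hpre, hlaw, Measure.prod_apply ((measurable_fst hA).inter hS)] at e
    have e' : ∫⁻ v, (P.map U) (Prod.mk v ⁻¹' (Prod.fst ⁻¹' A ∩ {q | step (g q.1) q.2 ∈ B}))
        ∂(P.map V) = ∫⁻ ω in V ⁻¹' A, ((P.map U).map (step (g (V ω)))) B ∂P := by
      rw [lintegral_map (measurable_measure_prodMk_left ((measurable_fst hA).inter hS)) hV,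
        ← lintegral_indicator (hV hA)]
      refine lintegral_congr fun ω => ?_
      by_cases hω : V ω ∈ A
      · rw [Set.indicator_of_mem (by exact hω), Measure.map_apply (by fun_prop) hB]
        congr 1
        ext a
        change (V ω ∈ A ∧ step (g (V ω)) a ∈ B) ↔ step (g (V ω)) a ∈ B
        simp [hω]
      · rw [Set.indicator_of_notMem (by exact hω)]
        refine measure_mono_null (t := ∅) (fun a ha => hω ha.1) measure_empty
    rw [e'] at e
    simp only [integral_const, smul_eq_mul, mul_one, measureReal_restrict_apply_univ]
    rw [Measure.real, ← e]
    exact integral_toReal (f := fun ω => ((P.map U).map (step (g (V ω)))) B)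
      (hk.comp (hg.comp hV)).aemeasurable
      (.of_forall fun ω => (hk' _).trans_lt ENNReal.one_lt_top)
  · exact (hk.ennreal_toReal.comp hgV).aestronglyMeasurable

/-! ### Values with a sign of positive weight -/

/-- The value `x` is zero or has a sign of positive weight. -/
def Relevant (p x : ℝ) : Prop := x = 0 ∨ 0 < signWeight p (Real.sign x)

lemma relevant_mul {p c x : ℝ} (hc : 0 < c) : Relevant p (c * x) ↔ Relevant p x := by
  have : Real.sign (c * x) = Real.sign x := by
    rcases lt_trichotomy x 0 with h | h | h
    · rw [Real.sign_of_neg h, Real.sign_of_neg (mul_neg_of_pos_of_neg hc h)]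
    · simp [h]
    · rw [Real.sign_of_pos h, Real.sign_of_pos (mul_pos hc h)]
  rw [Relevant, Relevant, this, mul_eq_zero]
  simp [hc.ne']

lemma sign_mem {x : ℝ} (h : x ≠ 0) : Real.sign x ∈ ({-1, 1} : Set ℝ) := by
  rcases lt_or_gt_of_ne h with h | h
  · simp [Real.sign_of_neg h]
  · simp [Real.sign_of_pos h]

lemma abs_mul_sign (x : ℝ) : |x| * Real.sign x = x := by
  rcases lt_trichotomy x 0 with h | h | h
  · rw [Real.sign_of_neg h, abs_of_neg h]; ring
  · simp [h]
  · rw [Real.sign_of_pos h, abs_of_pos h]; ring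

lemma step_eq_abs_mul {x : ℝ} (hx : x ≠ 0) (a : ℝ × ℝ) : step x a = |x| * step (Real.sign x) a := by
  rw [← step_mul (abs_pos.2 hx), abs_mul_sign]

/-- A relevant value is carried to a relevant value by good multipliers. -/
lemma relevant_step {p x : ℝ} (hx : Relevant p x) {a : ℝ × ℝ}
    (ha : ∀ σ ∈ ({-1, 1} : Set ℝ), 0 < signWeight p σ → Relevant p (step σ a)) :
    Relevant p (step x a) := by
  by_cases h0 : x = 0
  · rw [h0, step_zero]; exact Or.inl rfl
  · rw [step_eq_abs_mul h0, relevant_mul (abs_pos.2 h0)]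
    exact ha _ (sign_mem h0) (hx.resolve_left h0)

lemma relevant_path {p x : ℝ} (hx : Relevant p x) {a : ℕ → ℝ × ℝ}
    (ha : ∀ n, ∀ σ ∈ ({-1, 1} : Set ℝ), 0 < signWeight p σ → Relevant p (step σ (a n))) (n : ℕ) :
    Relevant p (path x a n) := by
  induction n with
  | zero => exact hx
  | succ n ih => exact relevant_step ih (ha n)

lemma measurableSet_relevant (p : ℝ) : MeasurableSet {x : ℝ | Relevant p x} := by
  have : Measurable fun x : ℝ => signWeight p (Real.sign x) := by
    have : Measurable (signWeight p) :=
      Measurable.ite (measurableSet_singleton 1) measurable_const measurable_const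
    exact this.comp measurable_sign
  exact (measurableSet_singleton 0).union (measurableSet_lt measurable_const this)

/-- Under the moment condition, steps from relevant values stay relevant. -/
lemma ae_relevant_step {p α : ℝ}
    {κ : Measure (ℝ × ℝ)} [IsProbabilityMeasure κ] (h : MemClass p α (stepLaw p κ)) :
    ∀ᵐ a ∂κ, ∀ σ ∈ ({-1, 1} : Set ℝ), 0 < signWeight p σ → Relevant p (step σ a) := by
  -- For a sign of weight zero the moment bound reads `E[(τ M)₊ ^ α] ≤ 0`, so this sign is almost
  -- surely never entered.
  have key (τ : ℝ) (hτ : τ ∈ ({-1, 1} : Set ℝ)) (hw : ¬ 0 < signWeight p τ) :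
      ∀ᵐ z ∂(stepLaw p κ), τ * z.2 ≤ 0 := by
    have hm := h.moment τ hτ
    rw [h.sign τ hτ, ENNReal.ofReal_of_nonpos (not_lt.1 hw), nonpos_iff_eq_zero,
      lintegral_eq_zero_iff (by fun_prop)] at hm
    filter_upwards [hm] with z hz
    by_contra hc
    have hc' : 0 < τ * z.2 := not_le.1 hc
    have : 0 < (max (τ * z.2) 0) ^ α := Real.rpow_pos_of_pos (lt_max_of_lt_left hc') _
    simp only [Pi.zero_apply, ENNReal.ofReal_eq_zero] at hz
    linarith
  have hz : ∀ᵐ z ∂(stepLaw p κ), Relevant p z.2 := by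
    have e : ∀ τ ∈ ({-1, 1} : Set ℝ), ∀ᵐ z ∂(stepLaw p κ), ¬ 0 < signWeight p τ → τ * z.2 ≤ 0 := by
      intro τ hτ
      by_cases hw : 0 < signWeight p τ
      · exact .of_forall fun _ h => absurd hw h
      · exact (key τ hτ hw).mono fun _ h _ => h
    filter_upwards [e 1 (by simp), e (-1) (by simp)] with z hz hz'
    rcases lt_trichotomy z.2 0 with hs | hs | hs
    · right
      rw [Real.sign_of_neg hs]
      by_contra hc
      linarith [hz' hc]
    · exact Or.inl hs
    · right
      rw [Real.sign_of_pos hs]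
      by_contra hc
      linarith [hz hc]
  have hS : MeasurableSet {z : ℝ × ℝ | Relevant p z.2} := measurable_snd (measurableSet_relevant p)
  rw [stepLaw, ae_map_iff (by fun_prop) hS] at hz
  have := Measure.ae_ae_of_ae_prod hz
  rw [ae_signMeasure] at this
  rw [ae_ball_iff (Set.to_countable _)]
  intro σ hσ
  by_cases hw : 0 < signWeight p σ
  · exact (this σ hσ hw).mono fun a ha _ => ha
  · exact .of_forall fun a hw' => absurd hw' hw

lemma ae_infinitePi_eval {E : Type*} [MeasurableSpace E] {κ : Measure E} [IsProbabilityMeasure κ]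
    {q : E → Prop} (h : ∀ᵐ x ∂κ, q x) :
    ∀ᵐ a ∂(Measure.infinitePi fun _ : ℕ => κ), ∀ n, q (a n) :=
  ae_all_iff.2 fun n =>
    (measurePreserving_eval_infinitePi (fun _ : ℕ => κ) n).quasiMeasurePreserving.ae h

/-! ### The canonical model -/

/-- The law of `((Y, I), (b, a))` for the canonical model of the tail process. -/
def canonLaw (p α : ℝ) (κ' κ : Measure (ℝ × ℝ)) :
    Measure ((ℝ × ℝ) × ((ℕ → ℝ × ℝ) × (ℕ → ℝ × ℝ))) :=
  ((pareto α).prod (signMeasure p)).prod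
    ((Measure.infinitePi fun _ : ℕ => κ').prod (Measure.infinitePi fun _ : ℕ => κ))

/-- The tail chain of the canonical model. -/
def canonChain (t : ℤ) (ω : (ℝ × ℝ) × ((ℕ → ℝ × ℝ) × (ℕ → ℝ × ℝ))) : ℝ :=
  biChain ω.1.2 ω.2.1 ω.2.2 t

lemma measurable_canonChain (t : ℤ) : Measurable (canonChain t) := by
  have : Measurable fun ω : (ℝ × ℝ) × ((ℕ → ℝ × ℝ) × (ℕ → ℝ × ℝ)) =>
    biChain ω.1.2 ω.2.1 ω.2.2 := by fun_prop
  exact (measurable_pi_apply t).comp this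

section Canonical

variable {p α : ℝ} {κ' κ : Measure (ℝ × ℝ)} [IsProbabilityMeasure κ'] [IsProbabilityMeasure κ]

lemma isProbabilityMeasure_canonLaw (hα : 0 < α) (h0 : 0 ≤ p) (h1 : p ≤ 1) :
    IsProbabilityMeasure (canonLaw p α κ' κ) := by
  have := isProbabilityMeasure_signMeasure h0 h1
  have := isProbabilityMeasure_pareto hα
  unfold canonLaw; infer_instance

lemma canonLaw_map_forward :
    (canonLaw p α κ' κ).map (fun ω => ((ω.1, ω.2.1), ω.2.2)) =
      (((pareto α).prod (signMeasure p)).prod (Measure.infinitePi fun _ : ℕ => κ')).prod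
        (Measure.infinitePi fun _ : ℕ => κ) := by
  have : SFinite (pareto α) := by unfold pareto; infer_instance
  refine Measure.ext_of_lintegral _ fun f hf => ?_
  rw [lintegral_map hf (by fun_prop), canonLaw, lintegral_prod _ (by fun_prop),
    lintegral_prod _ hf.aemeasurable, lintegral_prod (μ := (pareto α).prod (signMeasure p)) _
      (Measurable.lintegral_prod_right' hf).aemeasurable]
  refine lintegral_congr fun w => ?_
  rw [lintegral_prod _ (by fun_prop)]

lemma canonLaw_map_backward :
    (canonLaw p α κ' κ).map (fun ω => ((ω.1, ω.2.2), ω.2.1)) =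
      (((pareto α).prod (signMeasure p)).prod (Measure.infinitePi fun _ : ℕ => κ)).prod
        (Measure.infinitePi fun _ : ℕ => κ') := by
  have : SFinite (pareto α) := by unfold pareto; infer_instance
  refine Measure.ext_of_lintegral _ fun f hf => ?_
  rw [lintegral_map hf (by fun_prop), canonLaw, lintegral_prod _ (by fun_prop),
    lintegral_prod _ hf.aemeasurable, lintegral_prod (μ := (pareto α).prod (signMeasure p)) _
      (Measurable.lintegral_prod_right' hf).aemeasurable]
  refine lintegral_congr fun w => ?_
  rw [lintegral_prod_symm _ (by fun_prop)]

/-- Stated for abstract driving sequences `A` and `B` so that the forward and the backward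
transition laws come from the same argument. -/
lemma map_sign_head {𝒲 : Type*} [MeasurableSpace 𝒲] {P : Measure ((ℝ × ℝ) × 𝒲)}
    (hα : 0 < α) {A B : 𝒲 → ℕ → ℝ × ℝ} (hA : Measurable A) (hB : Measurable B)
    (h : P.map (fun ω => ((ω.1, B ω.2), A ω.2)) =
      (((pareto α).prod (signMeasure p)).prod (Measure.infinitePi fun _ : ℕ => κ')).prod
        (Measure.infinitePi fun _ : ℕ => κ)) :
    P.map (fun ω => (ω.1.2, step ω.1.2 (A ω.2 0))) = stepLaw p κ := by
  have := isProbabilityMeasure_pareto hα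
  have hm : Measurable fun q : ((ℝ × ℝ) × (ℕ → ℝ × ℝ)) × (ℕ → ℝ × ℝ) =>
    (q.1.1.2, step q.1.1.2 (q.2 0)) := by fun_prop
  have e := congrArg (Measure.map fun q : ((ℝ × ℝ) × (ℕ → ℝ × ℝ)) × (ℕ → ℝ × ℝ) =>
    (q.1.1.2, step q.1.1.2 (q.2 0))) h
  rw [Measure.map_map hm (by fun_prop)] at e
  refine e.trans ?_
  have hev : (Measure.infinitePi fun _ : ℕ => κ).map (fun a => a 0) = κ :=
    Measure.infinitePi_map_eval _ 0
  refine Measure.ext_of_lintegral _ fun f hf => ?_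
  rw [lintegral_map hf hm, stepLaw, lintegral_map hf (by fun_prop), lintegral_prod _ (by fun_prop),
    lintegral_prod _ (by fun_prop)]
  have e2 (i : ℝ) : ∫⁻ a : ℕ → ℝ × ℝ, f (i, step i (a 0)) ∂(Measure.infinitePi fun _ : ℕ => κ) =
      ∫⁻ x, f (i, step i x) ∂κ := by
    conv_rhs => rw [← hev, lintegral_map (by fun_prop) (by fun_prop)]
  simp only [e2]
  have hF : Measurable fun i => ∫⁻ x, f (i, step i x) ∂κ :=
    Measurable.lintegral_prod_right' (f := fun q : ℝ × (ℝ × ℝ) => f (q.1, step q.1 q.2))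
      (by fun_prop)
  rw [lintegral_prod _ (by fun_prop)]
  simp only [lintegral_const, measure_univ, mul_one]
  rw [lintegral_prod _ (by fun_prop)]

/-- The step at time `n + 1` of a two-sided chain, in either direction of time, is a transition. -/
lemma condExp_canon {Ω : Type*} [mΩ : MeasurableSpace Ω] {P : Measure Ω} [IsProbabilityMeasure P]
    (hα : 0 < α) (h0 : 0 ≤ p) (h1 : p ≤ 1)
    (hmem : MemClass p α (stepLaw p κ)) {w : Ω → ℝ × ℝ} (hw : Measurable w)
    {A B : Ω → ℕ → ℝ × ℝ} (hA : Measurable A) (hB : Measurable B)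
    (h : P.map (fun ω => ((w ω, B ω), A ω)) =
      (((pareto α).prod (signMeasure p)).prod (Measure.infinitePi fun _ : ℕ => κ')).prod
        (Measure.infinitePi fun _ : ℕ => κ)) {M : ℤ → Ω → ℝ}
    {I : Set ℤ} {ι : ℤ → ℤ} (n : ℕ) (hI : ∀ j, j ∈ I → ι j ≤ n)
    (hM : ∀ j ω, M j ω = biChain (w ω).2 (B ω) (A ω) (ι j)) {s r : ℤ} (hs : ι s = n + 1)
    (hr : ι r = n) (hrI : r ∈ I) {C : Set ℝ} (hC : MeasurableSet C) :
    P⟦M s ⁻¹' C | ⨆ j : I, MeasurableSpace.comap (M j) inferInstance⟧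
      =ᵐ[P] fun ω => (transition (stepLaw p κ) (M r ω)).real C := by
  have := isProbabilityMeasure_signMeasure h0 h1
  have := isProbabilityMeasure_pareto hα
  have hE : Measurable fun ω => (w ω, B ω) := hw.prodMk hB
  have hV : Measurable fun ω => ((w ω, B ω), truncSeq n (A ω)) := by fun_prop
  have hMr (ω : Ω) : path (w ω).2 (truncSeq n (A ω)) n = M r ω := by
    rw [hM, hr, path_truncSeq _ _ le_rfl, biChain_natCast]
  have hU : Measurable fun ω => A ω n := by fun_prop
  have hlaw : P.map (fun ω => A ω n) = κ := by
    have e := congrArg (Measure.map Prod.snd) h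
    rw [Measure.map_map measurable_snd (by fun_prop), Measure.map_snd_prod, measure_univ,
      one_smul] at e
    change P.map A = _ at e
    have e' := congrArg (Measure.map fun a : ℕ → ℝ × ℝ => a n) e
    rw [Measure.map_map (by fun_prop) hA, Measure.infinitePi_map_eval] at e'
    exact e'
  -- The formula for `transition` as a step driven by `κ` is available only at relevant values, so
  -- the chain must almost surely stay among them.
  have hrel : ∀ᵐ ω ∂P, Relevant p (M r ω) := by
    have hgood := ae_infinitePi_eval (ae_relevant_step hmem)
    have e := congrArg (Measure.map fun q : ((ℝ × ℝ) × (ℕ → ℝ × ℝ)) × (ℕ → ℝ × ℝ) =>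
      q.2) h
    have qA : Measure.QuasiMeasurePreserving A P (Measure.infinitePi fun _ : ℕ => κ) := by
      refine ⟨hA, ?_⟩
      rw [Measure.map_map measurable_snd (by fun_prop), Measure.map_snd_prod, measure_univ,
        one_smul] at e
      change P.map A = _ at e
      rw [e]
    have qw : Measure.QuasiMeasurePreserving (fun ω => (w ω).2) P (signMeasure p) := by
      refine ⟨by fun_prop, ?_⟩
      have e := congrArg (Measure.map fun q : ((ℝ × ℝ) × (ℕ → ℝ × ℝ)) × (ℕ → ℝ × ℝ) =>
        q.1.1.2) h
      rw [Measure.map_map (by fun_prop) (by fun_prop),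
        show (fun q : ((ℝ × ℝ) × (ℕ → ℝ × ℝ)) × (ℕ → ℝ × ℝ) => q.1.1.2) =
          Prod.snd ∘ Prod.fst ∘ Prod.fst from rfl,
        ← Measure.map_map (g := Prod.snd) (f := Prod.fst ∘ Prod.fst) (by fun_prop) (by fun_prop),
        ← Measure.map_map (g := Prod.fst) (f := Prod.fst) (by fun_prop) (by fun_prop),
        Measure.map_fst_prod, measure_univ, one_smul, Measure.map_fst_prod, measure_univ, one_smul,
        Measure.map_snd_prod, measure_univ, one_smul] at e
      change P.map (fun ω => (w ω).2) = _ at e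
      rw [e]
    have hsgn : ∀ᵐ i ∂(signMeasure p), Relevant p i := by
      rw [ae_signMeasure]
      intro σ hσ hw
      right
      have : Real.sign σ = σ := by
        rcases hσ with rfl | rfl
        · rw [Real.sign_of_neg (by norm_num)]
        · rw [Real.sign_of_pos (by norm_num)]
      rwa [this]
    filter_upwards [qA.ae hgood, qw.ae hsgn] with ω h1 h2
    rw [hM, hr, biChain_natCast]
    exact relevant_path h2 h1 n
  have hle : (⨆ j : I, MeasurableSpace.comap (M j) inferInstance) ≤
      MeasurableSpace.comap (fun ω => ((w ω, B ω), truncSeq n (A ω))) inferInstance := by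
    refine iSup_le fun j => ?_
    have hG : Measurable fun v : ((ℝ × ℝ) × (ℕ → ℝ × ℝ)) × (ℕ → ℝ × ℝ) =>
        biChain v.1.1.2 v.1.2 v.2 (ι j) := by
      have : Measurable fun v : ((ℝ × ℝ) × (ℕ → ℝ × ℝ)) × (ℕ → ℝ × ℝ) =>
        biChain v.1.1.2 v.1.2 v.2 := by fun_prop
      exact (measurable_pi_apply (ι j)).comp this
    have e : M j = (fun v : ((ℝ × ℝ) × (ℕ → ℝ × ℝ)) × (ℕ → ℝ × ℝ) =>
        biChain v.1.1.2 v.1.2 v.2 (ι j)) ∘ fun ω => ((w ω, B ω), truncSeq n (A ω)) := by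
      ext ω
      simp only [Function.comp_apply]
      rw [hM]
      have hj := hI j j.2
      -- Times up to `n` use only the first `n` entries of `A`, and negative times use none. Hence
      -- `truncSeq n` retains all the information of the past.
      rcases hk : ι j with k | k
      · rw [hk] at hj
        exact (path_truncSeq _ _ (by simpa using hj)).symm
      · rfl
    rw [e, ← MeasurableSpace.comap_comp]
    exact MeasurableSpace.comap_mono hG.comap_le
  have hind := indepFun_prodMk_truncSeq hE hA h n
  have key := condExp_step hV hle (g := fun v => path v.1.1.2 v.2 n) (by fun_prop)
    (by
      simp only [hMr]
      exact Measurable.mono (comap_measurable (M r))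
        (le_iSup (fun j : I => MeasurableSpace.comap (M j) inferInstance) ⟨r, hrI⟩) le_rfl)
    hU hind (N := M s) (fun ω => by
      simp only [hMr]
      rw [hM, hs, hM, hr]
      rfl) hC
  refine key.trans ?_
  filter_upwards [hrel] with ω hω
  rw [transition_stepLaw hω, hlaw, hMr]

/-- The canonical model is a back-and-forth tail chain. -/
lemma isTailLimit_canon (hα : 0 < α) (h0 : 0 ≤ p) (h1 : p ≤ 1)
    (h : IsAdjoint p α (stepLaw p κ) (stepLaw p κ')) :
    IsTailLimit p α (stepLaw p κ) (canonLaw p α κ' κ) (fun ω => ω.1.1) canonChain := by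
  have := isProbabilityMeasure_canonLaw (κ := κ) (κ' := κ') hα h0 h1
  have := isProbabilityMeasure_signMeasure h0 h1
  have := isProbabilityMeasure_pareto hα
  have hlaw : (canonLaw p α κ' κ).map (fun ω => ω.1.1) = pareto α := by
    rw [canonLaw, show (fun ω : (ℝ × ℝ) × ((ℕ → ℝ × ℝ) × (ℕ → ℝ × ℝ)) => ω.1.1) =
      Prod.fst ∘ Prod.fst from rfl, ← Measure.map_map (by fun_prop) (by fun_prop),
      Measure.map_fst_prod, measure_univ, one_smul, Measure.map_fst_prod, measure_univ, one_smul]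
  have hb : (canonLaw p α κ' κ).map (fun ω => (canonChain 0 ω, canonChain (-1) ω)) =
      stepLaw p κ' :=
    map_sign_head (𝒲 := (ℕ → ℝ × ℝ) × (ℕ → ℝ × ℝ)) (A := Prod.fst) (B := Prod.snd)
      hα (by fun_prop) (by fun_prop)
      canonLaw_map_backward
  refine ⟨by fun_prop, ?_, fun y hy => ?_, ⟨measurable_canonChain, ?_, ?_, ?_, ?_⟩⟩
  · rw [indepFun_iff_measure_inter_preimage_eq_mul]
    intro s t hs ht
    have hG : Measurable fun ω : ℝ × ((ℕ → ℝ × ℝ) × (ℕ → ℝ × ℝ)) =>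
      biChain ω.1 ω.2.1 ω.2.2 := by fun_prop
    -- After reassociating, the radius is the first factor of a product and the chain is a function
    -- of the second, so independence is immediate.
    have e : canonLaw p α κ' κ = ((pareto α).prod ((signMeasure p).prod
        ((Measure.infinitePi fun _ : ℕ => κ').prod (Measure.infinitePi fun _ : ℕ => κ)))).map
        MeasurableEquiv.prodAssoc.symm := by
      rw [canonLaw, ← Measure.prodAssoc_prod (μ := pareto α) (ν := signMeasure p),
        MeasurableEquiv.map_symm_map]
    have hs' : MeasurableSet ((fun ω : (ℝ × ℝ) × ((ℕ → ℝ × ℝ) × (ℕ → ℝ × ℝ)) => ω.1.1) ⁻¹' s) := by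
      have : Measurable fun ω : (ℝ × ℝ) × ((ℕ → ℝ × ℝ) × (ℕ → ℝ × ℝ)) => ω.1.1 := by fun_prop
      exact this hs
    have ht' : MeasurableSet ((fun (ω : (ℝ × ℝ) × ((ℕ → ℝ × ℝ) × (ℕ → ℝ × ℝ))) (t : ℤ) =>
        canonChain t ω) ⁻¹' t) := (measurable_pi_lambda _ measurable_canonChain) ht
    rw [e, Measure.map_apply (by fun_prop) (hs'.inter ht'), Measure.map_apply (by fun_prop) hs',
      Measure.map_apply (by fun_prop) ht']
    have e1 : MeasurableEquiv.prodAssoc.symm ⁻¹'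
        (((fun ω : (ℝ × ℝ) × ((ℕ → ℝ × ℝ) × (ℕ → ℝ × ℝ)) => ω.1.1) ⁻¹' s) ∩
        ((fun (ω : (ℝ × ℝ) × ((ℕ → ℝ × ℝ) × (ℕ → ℝ × ℝ))) (t : ℤ) => canonChain t ω) ⁻¹' t)) =
        s ×ˢ ((fun ω : ℝ × ((ℕ → ℝ × ℝ) × (ℕ → ℝ × ℝ)) => biChain ω.1 ω.2.1 ω.2.2) ⁻¹' t) := rfl
    have e2 : (MeasurableEquiv.prodAssoc (α := ℝ) (β := ℝ)
        (γ := (ℕ → ℝ × ℝ) × (ℕ → ℝ × ℝ))).symm ⁻¹'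
        ((fun ω : (ℝ × ℝ) × ((ℕ → ℝ × ℝ) × (ℕ → ℝ × ℝ)) => ω.1.1) ⁻¹' s) = s ×ˢ Set.univ := by
      ext; simp; rfl
    have e3 : MeasurableEquiv.prodAssoc.symm ⁻¹'
        ((fun (ω : (ℝ × ℝ) × ((ℕ → ℝ × ℝ) × (ℕ → ℝ × ℝ))) (t : ℤ) => canonChain t ω) ⁻¹' t) =
        Set.univ ×ˢ
          ((fun ω : ℝ × ((ℕ → ℝ × ℝ) × (ℕ → ℝ × ℝ)) => biChain ω.1 ω.2.1 ω.2.2) ⁻¹' t) := by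
      ext; simp; rfl
    rw [e1, e2, e3, Measure.prod_prod, Measure.prod_prod, Measure.prod_prod]
    simp
  · rw [← pareto_Ioi hα hy, ← hlaw, Measure.map_apply (by fun_prop) measurableSet_Ioi]
    rfl
  · exact map_sign_head (𝒲 := (ℕ → ℝ × ℝ) × (ℕ → ℝ × ℝ)) (A := Prod.snd) (B := Prod.fst)
      hα (by fun_prop) (by fun_prop)
      canonLaw_map_forward
  · rw [hb]; exact h
  · intro t ht B hB
    obtain ⟨n, rfl⟩ : ∃ n : ℕ, t = n + 1 := ⟨(t - 1).toNat, by omega⟩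
    refine condExp_canon (I := Set.Iio ((n : ℤ) + 1)) (M := canonChain) (s := (n : ℤ) + 1)
      (r := (n : ℤ) + 1 - 1) hα h0 h1 h.mem_left (w := fun ω => ω.1) (A := fun ω => ω.2.2)
      (B := fun ω => ω.2.1) (by fun_prop) (by fun_prop) (by fun_prop) canonLaw_map_forward n
      (ι := id) (fun j hj => Int.lt_add_one_iff.1 (Set.mem_Iio.1 hj)) (fun j ω => rfl) rfl
      (by simp) (Set.mem_Iio.2 (by omega)) hB
  · intro t ht B hB
    rw [hb]
    obtain ⟨n, rfl⟩ : ∃ n : ℕ, t = n + 1 := ⟨(t - 1).toNat, by omega⟩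
    -- Reflection of time by `ι j = -j` exchanges the two driving sequences and reduces the backward
    -- claim to the forward one.
    refine condExp_canon (I := Set.Ioi (-((n : ℤ) + 1))) (M := canonChain) (s := -((n : ℤ) + 1))
      (r := -((n : ℤ) + 1) + 1) hα h0 h1 h.mem_right (w := fun ω => ω.1) (A := fun ω => ω.2.1)
      (B := fun ω => ω.2.2) (by fun_prop) (by fun_prop) (by fun_prop) canonLaw_map_backward n
      (ι := fun j => -j) (fun j hj => by have := Set.mem_Ioi.1 hj; omega) (fun j ω => ?_) (by simp)
      (by simp) (Set.mem_Ioi.2 (by omega)) hB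
    change biChain _ _ _ j = biChain _ _ _ (-j)
    rcases Int.eq_nat_or_neg j with ⟨k, rfl | rfl⟩
    · rw [biChain_natCast, biChain_neg_natCast]
    · rw [neg_neg, biChain_natCast, biChain_neg_natCast]

end Canonical

lemma signTail_abs_gt {p α r : ℝ} (hα : 0 < α) (h0 : 0 ≤ p) (h1 : p ≤ 1) (hr : 0 < r) :
    signTail p α {y | r < |y|} = ENNReal.ofReal (r ^ (-α)) := by
  have hS' : MeasurableSet {y : ℝ | r < |y|} := measurableSet_lt measurable_const measurable_norm
  rw [← tailMeasure_Ioi hα hr, ← lintegral_indicator_one measurableSet_Ioi,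
    ← lintegral_indicator_one hS', lintegral_signTail (measurable_one.indicator hS')]
  refine lintegral_congr_ae ?_
  filter_upwards [ae_tailMeasure_pos α] with u hu
  have e (i : ℝ) (hi : |i| = 1) : {y : ℝ | r < |y|}.indicator (1 : ℝ → ENNReal) (u * i) =
      (Set.Ioi r).indicator 1 u := by
    have : r < |u * i| ↔ r < u := by rw [abs_mul, hi, mul_one, abs_of_pos hu]
    by_cases h : r < u
    · rw [Set.indicator_of_mem (by exact this.2 h), Set.indicator_of_mem (by exact h)]; rfl
    · rw [Set.indicator_of_notMem (by exact fun hh => h (this.1 hh)),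
        Set.indicator_of_notMem (by exact h)]
  rw [lintegral_signMeasure, e 1 (by simp), e (-1) (by simp), ← add_mul, signWeight_one,
    signWeight_neg_one, ← ENNReal.ofReal_add h0 (by linarith)]
  simp

/-! ### The tail process and its invariance under shifts -/

section TailProcess

variable {p α : ℝ} {κ' κ : Measure (ℝ × ℝ)} [IsProbabilityMeasure κ'] [IsProbabilityMeasure κ]

/-- A stationary step from the two-sided tail measure, in polar coordinates. -/
lemma lintegral_signTail_step {h : ℝ × ℝ → ENNReal} (hh : Measurable h) :
    ∫⁻ y, ∫⁻ x, h (y, step y x) ∂κ ∂(signTail p α) =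
      ∫⁻ u, ∫⁻ z, h (u * z.1, u * z.2) ∂(stepLaw p κ) ∂(tailMeasure α) := by
  have hm : Measurable fun y => ∫⁻ x, h (y, step y x) ∂κ :=
    Measurable.lintegral_prod_right' (f := fun q : ℝ × (ℝ × ℝ) => h (q.1, step q.1 q.2))
      (by fun_prop)
  rw [lintegral_signTail hm]
  refine lintegral_congr_ae ?_
  filter_upwards [ae_tailMeasure_pos α] with u hu
  rw [stepLaw, lintegral_map (by fun_prop) (by fun_prop), lintegral_prod _ (by fun_prop)]
  refine lintegral_congr fun i => lintegral_congr fun x => ?_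
  rw [step_mul hu]

/-- Reversal of time for one step of the tail process. -/
lemma lintegral_step_reverse (hα : 0 < α)
    (hmem : MemClass p α (stepLaw p κ))
    (hadj : stepLaw p κ' = adjointLaw p α (stepLaw p κ)) {h : ℝ × ℝ → ENNReal}
    (hh : Measurable h) (hz : ∀ q : ℝ × ℝ, q.1 = 0 ∨ q.2 = 0 → h q = 0) :
    ∫⁻ y, ∫⁻ x, h (step y x, y) ∂κ' ∂(signTail p α) =
      ∫⁻ y, ∫⁻ x, h (y, step y x) ∂κ ∂(signTail p α) := by
  have := hmem.isProb
  have e := lintegral_signTail_step (p := p) (α := α) (κ := κ') (h := fun q => h (q.2, q.1))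
    (by fun_prop)
  simp only at e
  rw [e, lintegral_signTail_step hh, hadj]
  -- The atoms of the adjoint disappear because `h` vanishes when a coordinate is zero.
  have e1 (u : ℝ) : ∫⁻ z, h (u * z.2, u * z.1) ∂(adjointLaw p α (stepLaw p κ)) =
      ∫⁻ z, ENNReal.ofReal (|z.2| ^ α) * h (u * (z.1 / |z.2|), u * Real.sign z.2)
        ∂(stepLaw p κ) := by
    rw [lintegral_adjointLaw (by fun_prop)]
    simp [hz]
  simp only [e1]
  rw [lintegral_lintegral_swap (by fun_prop)]
  symm
  rw [lintegral_lintegral_swap (by fun_prop)]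
  symm
  refine lintegral_congr fun z => ?_
  by_cases hz2 : z.2 = 0
  · simp [hz2, hz]
  have hp : 0 < |z.2| := abs_pos.2 hz2
  rw [lintegral_const_mul _ (by fun_prop)]
  -- Rescaling the radius by `|z.2|⁻¹` costs `|z.2| ^ (-α)` by homogeneity, which cancels the
  -- density of the adjoint.
  have e2 := lintegral_tailMeasure_mul (α := α) hα (inv_pos.2 hp)
    (f := fun v => h (v * z.1, v * z.2)) (by fun_prop)
  have e3 (u : ℝ) : h (u * (z.1 / |z.2|), u * Real.sign z.2) =
      h (|z.2|⁻¹ * u * z.1, |z.2|⁻¹ * u * z.2) := by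
    congr 2
    · field_simp
    · nth_rw 3 [← abs_mul_sign z.2]
      field_simp
  simp only [e3]
  rw [e2, ← mul_assoc, ← ENNReal.ofReal_mul (by positivity), ← Real.mul_rpow hp.le (by positivity),
    mul_inv_cancel₀ hp.ne', Real.one_rpow, ENNReal.ofReal_one, one_mul]

/-- The homogeneous measure on two-sided sequences underlying the tail process. -/
def tailProcess (p α : ℝ) (κ' κ : Measure (ℝ × ℝ)) : Measure (ℤ → ℝ) :=
  ((signTail p α).prod ((Measure.infinitePi fun _ : ℕ => κ').prod
    (Measure.infinitePi fun _ : ℕ => κ))).map (fun z => biChain z.1 z.2.1 z.2.2)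

lemma lintegral_tailProcess {F : (ℤ → ℝ) → ENNReal} (hF : Measurable F) :
    ∫⁻ m, F m ∂(tailProcess p α κ' κ) = ∫⁻ y, ∫⁻ b, ∫⁻ a, F (biChain y b a)
      ∂(Measure.infinitePi fun _ : ℕ => κ) ∂(Measure.infinitePi fun _ : ℕ => κ')
      ∂(signTail p α) := by
  rw [tailProcess, lintegral_map hF (by fun_prop), lintegral_prod _ (by fun_prop)]
  refine lintegral_congr fun y => ?_
  rw [lintegral_prod _ (by fun_prop)]

lemma lintegral_tailProcess_congr {F G : (ℤ → ℝ) → ENNReal} (hF : Measurable F)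
    (hG : Measurable G) (h : ∀ y b a, y ≠ 0 → F (biChain y b a) = G (biChain y b a)) :
    ∫⁻ m, F m ∂(tailProcess p α κ' κ) = ∫⁻ m, G m ∂(tailProcess p α κ' κ) := by
  rw [lintegral_tailProcess hF, lintegral_tailProcess hG]
  refine lintegral_congr_ae ?_
  filter_upwards [signTail_zero p α] with y hy
  exact lintegral_congr fun b => lintegral_congr fun a => h y b a hy

/-- Given the values at times `-1` and `0`, the remaining multipliers on both sides have the same
law before and after the shift. Integrating them out leaves a function `h` of two adjacent values,
to which one-step reversal applies. -/
lemma lintegral_tailProcess_shift (hα : 0 < α)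
    (hmem : MemClass p α (stepLaw p κ))
    (hadj : stepLaw p κ' = adjointLaw p α (stepLaw p κ)) {F : (ℤ → ℝ) → ENNReal}
    (hF : Measurable F) (hz : ∀ m, m (-1) = 0 ∨ m 0 = 0 → F m = 0) :
    ∫⁻ m, F (shift m) ∂(tailProcess p α κ' κ) = ∫⁻ m, F m ∂(tailProcess p α κ' κ) := by
  set Γ := Measure.infinitePi fun _ : ℕ => κ
  set Γ' := Measure.infinitePi fun _ : ℕ => κ'
  set h : ℝ × ℝ → ENNReal := fun q => ∫⁻ b, ∫⁻ a, F (chain q.1 q.2 b a) ∂Γ ∂Γ' with hh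
  have hm : Measurable h := by
    refine Measurable.lintegral_prod_right' (f := fun r : (ℝ × ℝ) × (ℕ → ℝ × ℝ) =>
      ∫⁻ a, F (chain r.1.1 r.1.2 r.2 a) ∂Γ) ?_
    exact Measurable.lintegral_prod_right' (f := fun r : ((ℝ × ℝ) × (ℕ → ℝ × ℝ)) × (ℕ → ℝ × ℝ) =>
      F (chain r.1.1.1 r.1.1.2 r.1.2 r.2)) (by fun_prop)
  have hhz : ∀ q : ℝ × ℝ, q.1 = 0 ∨ q.2 = 0 → h q = 0 := by
    intro q hq
    have : ∀ b a, F (chain q.1 q.2 b a) = 0 := fun b a => hz _ hq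
    simp [hh, this]
  rw [lintegral_tailProcess hF,
    lintegral_tailProcess (F := fun m => F (shift m)) (hF.comp measurable_shift)]
  have e1 (y : ℝ) : ∫⁻ b, ∫⁻ a, F (biChain y b a) ∂Γ ∂Γ' = ∫⁻ x, h (step y x, y) ∂κ' := by
    refine lintegral_infinitePi_head_tail κ'
      (f := fun x b => ∫⁻ a, F (chain (step y x) y b a) ∂Γ) ?_
    exact Measurable.lintegral_prod_right' (f := fun r : ((ℝ × ℝ) × (ℕ → ℝ × ℝ)) × (ℕ → ℝ × ℝ) =>
      F (chain (step y r.1.1) y r.1.2 r.2)) (by fun_prop)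
  have e2 (y : ℝ) : ∫⁻ b, ∫⁻ a, F (shift (biChain y b a)) ∂Γ ∂Γ' = ∫⁻ x, h (y, step y x) ∂κ := by
    simp only [shift_biChain]
    have (b : ℕ → ℝ × ℝ) : ∫⁻ a, F (chain y (step y (a 0)) b (tail a)) ∂Γ =
        ∫⁻ x, ∫⁻ a, F (chain y (step y x) b a) ∂Γ ∂κ :=
      lintegral_infinitePi_head_tail κ (f := fun x a => F (chain y (step y x) b a))
        (by unfold Function.uncurry; fun_prop)
    simp only [this]
    rw [lintegral_lintegral_swap]
    refine Measurable.aemeasurable ?_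
    exact Measurable.lintegral_prod_right' (f := fun r : ((ℕ → ℝ × ℝ) × (ℝ × ℝ)) × (ℕ → ℝ × ℝ) =>
      F (chain y (step y r.1.2) r.1.1 r.2)) (by fun_prop)
  change ∫⁻ y, (∫⁻ b, ∫⁻ a, F (shift (biChain y b a)) ∂Γ ∂Γ') ∂(signTail p α) =
    ∫⁻ y, (∫⁻ b, ∫⁻ a, F (biChain y b a) ∂Γ ∂Γ') ∂(signTail p α)
  rw [lintegral_congr e2, lintegral_congr e1]
  exact (lintegral_step_reverse hα hmem hadj hm hhz).symm

/-- Shift of a two-sided sequence by `k` steps. -/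
def shiftBy (k : ℕ) (m : ℤ → ℝ) (j : ℤ) : ℝ := m (j + k)

@[fun_prop]
lemma measurable_shiftBy (k : ℕ) : Measurable (shiftBy k) :=
  measurable_pi_lambda _ fun n => measurable_pi_apply (n + k)

/-- Zero is absorbing in both directions of time. Hence a chain that is nonzero at the two ends of a
stretch including time `0` is nonzero throughout, which lets single shifts be composed. -/
lemma biChain_succ_eq_zero {y : ℝ} {b a : ℕ → ℝ × ℝ} {k : ℕ} (h : biChain y b a k = 0) :
    biChain y b a (k + 1 : ℕ) = 0 := by
  rw [biChain_natCast] at *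
  exact path_eq_zero h

lemma biChain_neg_eq_zero {y : ℝ} {b a : ℕ → ℝ × ℝ} (h : biChain y b a (-1) = 0) (k : ℕ) :
    biChain y b a (-(k + 1 : ℕ)) = 0 := by
  have h' : biChain y b a (-(1 : ℕ)) = 0 := h
  rw [biChain_neg_natCast] at *
  rw [add_comm]
  exact path_eq_zero h'

/-- Invariance of the tail process under shifts on sequences that do not vanish at the two
relevant times. -/
lemma lintegral_tailProcess_shiftBy (hα : 0 < α)
    (hmem : MemClass p α (stepLaw p κ))
    (hadj : stepLaw p κ' = adjointLaw p α (stepLaw p κ)) (k : ℕ) {F : (ℤ → ℝ) → ENNReal}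
    (hF : Measurable F) (hz : ∀ m, m (-k) = 0 ∨ m 0 = 0 → F m = 0) :
    ∫⁻ m, F (shiftBy k m) ∂(tailProcess p α κ' κ) = ∫⁻ m, F m ∂(tailProcess p α κ' κ) := by
  induction k generalizing F with
  | zero =>
    have : ∀ m, shiftBy 0 m = m := fun m => by ext j; simp [shiftBy]
    simp only [this]
  | succ k ih =>
    have hS : MeasurableSet {m : ℤ → ℝ | m (-1) ≠ 0} :=
      (measurable_pi_apply (-1)) (measurableSet_singleton 0).compl
    -- The one-step invariance needs a function that vanishes when `m (-1) = 0`. Cutting `F` off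
    -- there changes nothing on chains, because a zero at `-1` propagates back to `-(k + 1)`.
    set F' : (ℤ → ℝ) → ENNReal := {m : ℤ → ℝ | m (-1) ≠ 0}.indicator F with hF'
    have hF'm : Measurable F' := hF.indicator hS
    have hF'0 (m : ℤ → ℝ) (hm : m (-1) = 0) : F' m = 0 :=
      Set.indicator_of_notMem (by exact fun h => h hm) _
    have hF'1 (m : ℤ → ℝ) (hm : m (-1) ≠ 0) : F' m = F m :=
      Set.indicator_of_mem (by exact hm) _
    have hF'z (m : ℤ → ℝ) (hm : F m = 0) : F' m = 0 := by
      by_cases h : m (-1) = 0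
      · exact hF'0 m h
      · rw [hF'1 m h, hm]
    have s1 : ∫⁻ m, F m ∂(tailProcess p α κ' κ) = ∫⁻ m, F' m ∂(tailProcess p α κ' κ) := by
      refine lintegral_tailProcess_congr hF hF'm fun y b a hy => ?_
      by_cases h : biChain y b a (-1) = 0
      · rw [hF'0 _ h, hz _ (Or.inl (biChain_neg_eq_zero h k))]
      · rw [hF'1 _ h]
    have s2 := lintegral_tailProcess_shift hα hmem hadj hF'm (fun m hm => by
      rcases hm with hm | hm
      · exact hF'0 m hm
      · exact hF'z m (hz m (Or.inr hm)))
    have s3 := ih (F := fun m => F' (shift m)) (hF'm.comp measurable_shift) (fun m hm => by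
      rcases hm with hm | hm
      · refine hF'z _ (hz _ (Or.inl ?_))
        rw [shift, ← hm]
        congr 1
        push_cast; ring
      · refine hF'0 _ ?_
        rw [shift, ← hm]; rfl)
    rw [s1, ← s2, ← s3]
    refine lintegral_tailProcess_congr (by fun_prop) (by fun_prop) fun y b a hy => ?_
    have e : shift (shiftBy k (biChain y b a)) = shiftBy (k + 1) (biChain y b a) := by
      ext j
      simp only [shift, shiftBy]
      congr 1
      push_cast; ring
    rw [e]
    by_cases h : shiftBy (k + 1) (biChain y b a) (-1) = 0
    · rw [hF'0 _ h]
      refine hz _ (Or.inr ?_)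
      have h' : biChain y b a k = 0 := by
        rw [← h, shiftBy]
        congr 1
        push_cast; ring
      rw [shiftBy, zero_add]
      exact biChain_succ_eq_zero h'
    · rw [hF'1 _ h]

lemma integral_tailProcess_shiftBy (hα : 0 < α)
    (hmem : MemClass p α (stepLaw p κ))
    (hadj : stepLaw p κ' = adjointLaw p α (stepLaw p κ)) (k : ℕ) {H : (ℤ → ℝ) → ℝ}
    (hH : Measurable H) (hz : ∀ m, m (-k) = 0 ∨ m 0 = 0 → H m = 0)
    (hint : Integrable H (tailProcess p α κ' κ)) :
    ∫ m, H (shiftBy k m) ∂(tailProcess p α κ' κ) = ∫ m, H m ∂(tailProcess p α κ' κ) := by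
  have key (g : ℝ → ENNReal) (hg : Measurable g) (hg0 : g 0 = 0) :=
    lintegral_tailProcess_shiftBy hα hmem hadj k (F := fun m => g (H m)) (hg.comp hH)
      (fun m hm => by rw [hz m hm, hg0])
  have hint' : Integrable (fun m => H (shiftBy k m)) (tailProcess p α κ' κ) := by
    refine ⟨(hH.comp (measurable_shiftBy k)).aestronglyMeasurable, ?_⟩
    have := hint.2
    rw [HasFiniteIntegral] at *
    rwa [key (fun x => ‖x‖ₑ) measurable_enorm (by simp)]
  rw [integral_eq_lintegral_pos_part_sub_lintegral_neg_part hint,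
    integral_eq_lintegral_pos_part_sub_lintegral_neg_part hint',
    key (fun x => ENNReal.ofReal x) (by fun_prop) (by simp),
    key (fun x => ENNReal.ofReal (-x)) (by fun_prop) (by simp)]

lemma tailProcess_abs_gt (hα : 0 < α) (h0 : 0 ≤ p) (h1 : p ≤ 1) {r : ℝ} (hr : 0 < r) :
    tailProcess p α κ' κ {m | r < |m 0|} = ENNReal.ofReal (r ^ (-α)) := by
  have hS : MeasurableSet {m : ℤ → ℝ | r < |m 0|} :=
    measurableSet_lt measurable_const (measurable_pi_apply 0).norm
  have hS' : MeasurableSet {y : ℝ | r < |y|} := measurableSet_lt measurable_const measurable_norm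
  rw [← lintegral_indicator_one hS, lintegral_tailProcess (measurable_one.indicator hS),
    ← signTail_abs_gt hα h0 h1 hr, ← lintegral_indicator_one hS']
  have e (y : ℝ) (b a : ℕ → ℝ × ℝ) : {m : ℤ → ℝ | r < |m 0|}.indicator (1 : (ℤ → ℝ) → ENNReal)
      (biChain y b a) = {y : ℝ | r < |y|}.indicator 1 y := rfl
  simp only [e, lintegral_const, measure_univ, mul_one]

/-- The scaled chain of the canonical model has the law of the tail process given that the value
at time `0` exceeds `1` in modulus. -/
lemma map_canonLaw_mul (h0 : 0 ≤ p) (h1 : p ≤ 1) :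
    (canonLaw p α κ' κ).map (fun ω t => ω.1.1 * canonChain t ω) =
      (tailProcess p α κ' κ).restrict {m | 1 < |m 0|} := by
  have := isProbabilityMeasure_signMeasure h0 h1
  have : SFinite (pareto α) := by unfold pareto; infer_instance
  have hS : MeasurableSet {m : ℤ → ℝ | 1 < |m 0|} :=
    measurableSet_lt measurable_const (measurable_pi_apply 0).norm
  have hM : Measurable fun (ω : (ℝ × ℝ) × ((ℕ → ℝ × ℝ) × (ℕ → ℝ × ℝ))) (t : ℤ) =>
      ω.1.1 * canonChain t ω :=
    measurable_pi_lambda _ fun t => (by fun_prop : Measurable fun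
      ω : (ℝ × ℝ) × ((ℕ → ℝ × ℝ) × (ℕ → ℝ × ℝ)) => ω.1.1).mul (measurable_canonChain t)
  refine Measure.ext_of_lintegral _ fun F hF => ?_
  have hFM : Measurable fun (ω : (ℝ × ℝ) × ((ℕ → ℝ × ℝ) × (ℕ → ℝ × ℝ))) =>
      F fun t => ω.1.1 * canonChain t ω := hF.comp hM
  rw [lintegral_map hF hM, ← lintegral_indicator hS, lintegral_tailProcess (hF.indicator hS),
    canonLaw, lintegral_prod _ hFM.aemeasurable,
    lintegral_prod _ hFM.lintegral_prod_right'.aemeasurable, pareto,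
    ← lintegral_indicator measurableSet_Ioi]
  have hm : Measurable fun y => ∫⁻ b, ∫⁻ a, {m : ℤ → ℝ | 1 < |m 0|}.indicator F (biChain y b a)
      ∂(Measure.infinitePi fun _ : ℕ => κ) ∂(Measure.infinitePi fun _ : ℕ => κ') := by
    have hFS := hF.indicator hS
    refine Measurable.lintegral_prod_right' (f := fun r : ℝ × (ℕ → ℝ × ℝ) =>
      ∫⁻ a, {m : ℤ → ℝ | 1 < |m 0|}.indicator F (biChain r.1 r.2 a)
      ∂(Measure.infinitePi fun _ : ℕ => κ)) ?_
    exact Measurable.lintegral_prod_right' (f := fun r : (ℝ × (ℕ → ℝ × ℝ)) × (ℕ → ℝ × ℝ) =>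
      {m : ℤ → ℝ | 1 < |m 0|}.indicator F (biChain r.1.1 r.1.2 r.2)) (by fun_prop)
  rw [lintegral_signTail hm]
  refine lintegral_congr_ae ?_
  filter_upwards [ae_tailMeasure_pos α] with u hu
  have habs : ∀ᵐ i ∂(signMeasure p), |i| = 1 := by
    rw [ae_signMeasure]
    rintro σ (rfl | rfl) _ <;> simp
  have hc (i : ℝ) (b a : ℕ → ℝ × ℝ) :
      (fun t => u * canonChain t ((u, i), b, a)) = biChain (u * i) b a := by
    ext t; rw [biChain_mul hu]; rfl
  have hi (i : ℝ) (hi : |i| = 1) (b a : ℕ → ℝ × ℝ) : 1 < |biChain (u * i) b a 0| ↔ 1 < u := by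
    change 1 < |u * i| ↔ 1 < u
    rw [abs_mul, hi, mul_one, abs_of_pos hu]
  by_cases h : 1 < u
  · rw [Set.indicator_of_mem (by exact h)]
    refine lintegral_congr_ae ?_
    filter_upwards [habs] with i hi1
    rw [lintegral_prod _ (by
      have : Measurable fun v : (ℕ → ℝ × ℝ) × (ℕ → ℝ × ℝ) => ((u, i), v) := by fun_prop
      exact (hF.comp (hM.comp this)).aemeasurable)]
    refine lintegral_congr fun b => lintegral_congr fun a => ?_
    rw [Set.indicator_of_mem (by exact (hi i hi1 b a).2 h)]
    exact congrArg F (hc i b a)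
  · rw [Set.indicator_of_notMem (by exact h)]
    refine ((lintegral_congr_ae ?_).trans lintegral_zero).symm
    filter_upwards [habs] with i hi1
    have : ∀ b a, {m : ℤ → ℝ | 1 < |m 0|}.indicator F (biChain (u * i) b a) = 0 := fun b a =>
      Set.indicator_of_notMem (by exact fun hh => h ((hi i hi1 b a).1 hh)) _
    simp [this]

end TailProcess

/-! ### Weak convergence on the line and locally uniform limits -/

/-- Convergence of the tails of laws on the line implies weak convergence. -/
lemma tendsto_probabilityMeasure_of_Ioi {ι : Type*} {l : Filter ι} [l.IsCountablyGenerated]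
    {μs : ι → ProbabilityMeasure ℝ} {μ : ProbabilityMeasure ℝ}
    (h : ∀ y, Tendsto (fun i => (μs i : Measure ℝ).real (Set.Ioi y)) l
      (𝓝 ((μ : Measure ℝ).real (Set.Ioi y)))) :
    Tendsto μs l (𝓝 μ) := by
  refine IsPiSystem.tendsto_probabilityMeasure_of_tendsto_of_mem
    (S := {S | ∃ a b : ℝ, a < b ∧ Set.Ioc a b = S}) ?_ ?_ ?_ ?_
  · exact isPiSystem_Ioc id id
  · rintro _ ⟨a, b, -, rfl⟩; exact measurableSet_Ioc
  · intro u hu x hx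
    obtain ⟨ε, hε, hball⟩ := Metric.isOpen_iff.1 hu x hx
    refine ⟨_, ⟨x - ε / 2, x + ε / 2, by linarith, rfl⟩, Ioc_mem_nhds (by linarith) (by linarith),
      fun y hy => hball ?_⟩
    rw [Metric.mem_ball, Real.dist_eq, abs_lt]
    constructor <;> linarith [hy.1, hy.2]
  · rintro _ ⟨a, b, hab, rfl⟩
    have e (ν : ProbabilityMeasure ℝ) : (ν : Measure ℝ).real (Set.Ioc a b) =
        (ν : Measure ℝ).real (Set.Ioi a) - (ν : Measure ℝ).real (Set.Ioi b) := by
      rw [← measureReal_sdiff (Set.Ioi_subset_Ioi hab.le) measurableSet_Ioi]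
      congr 1
      ext y
      simp
    have := (h a).sub (h b)
    simp only [← e] at this
    rw [← NNReal.tendsto_coe]
    exact this

/-- A limit that is locally uniform in a parameter depends continuously on the parameter. -/
lemma continuousAt_of_tendsto_prod {F : ℝ → ℝ → ℝ} {G : ℝ → ℝ} {y : ℝ}
    (h : ∀ᶠ y' in 𝓝 y, Tendsto (fun z : ℝ × ℝ => F z.2 z.1) (𝓝 y' ×ˢ atTop) (𝓝 (G y'))) :
    ContinuousAt G y := by
  rw [Metric.continuousAt_iff']
  intro ε hε
  have h1 := (Metric.tendsto_nhds.1 h.self_of_nhds (ε / 2) (by positivity)).curry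
  filter_upwards [h, h1] with y' hy' hy1
  have h2 : Tendsto (fun x => F x y') atTop (𝓝 (G y')) :=
    hy'.comp (tendsto_const_nhds.prodMk tendsto_id)
  have := le_of_tendsto (h2.dist tendsto_const_nhds) (hy1.mono fun x hx => le_of_lt hx)
  linarith

/-- Locally uniform limits are uniform on compact intervals. -/
lemma eventually_forall_Icc_dist_lt {F : ℝ → ℝ → ℝ} {G : ℝ → ℝ} {a b : ℝ}
    (h : ∀ y ∈ Set.Icc a b, Tendsto (fun z : ℝ × ℝ => F z.2 z.1) (𝓝 y ×ˢ atTop) (𝓝 (G y)))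
    (hG : ∀ y ∈ Set.Icc a b, ContinuousAt G y) {ε : ℝ} (hε : 0 < ε) :
    ∀ᶠ x in atTop, ∀ y ∈ Set.Icc a b, dist (F x y) (G y) < ε := by
  refine isCompact_Icc.induction_on (p := fun s => ∀ᶠ x in atTop, ∀ y ∈ s, dist (F x y) (G y) < ε)
    (by simp) (fun s t hst ht => ht.mono fun x hx y hy => hx y (hst hy)) ?_ ?_
  · intro s t hs ht
    filter_upwards [hs, ht] with x h1 h2 y hy
    exact hy.elim (h1 y) (h2 y)
  · intro y hy
    have h1 := Metric.tendsto_nhds.1 (h y hy) (ε / 2) (by positivity)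
    have h2 := Metric.tendsto_nhds.1 (hG y hy) (ε / 2) (by positivity)
    obtain ⟨u, hu, v, hv, huv⟩ := Filter.eventually_prod_iff.1 h1
    -- A neighbourhood on which both `F x` and `G` stay near `G y`; compactness then needs only
    -- finitely many of these.
    refine ⟨{y' | u y' ∧ dist (G y') (G y) < ε / 2}, mem_nhdsWithin_of_mem_nhds (hu.and h2), ?_⟩
    filter_upwards [hv] with x hx y' hy'
    have := huv hy'.1 hx
    simp only at this
    calc dist (F x y') (G y') ≤ dist (F x y') (G y) + dist (G y) (G y') := dist_triangle _ _ _
      _ < ε := by rw [dist_comm (G y)]; linarith [hy'.2]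

/-- The tail measure restricted to `(η, ∞)`, normalized. -/
lemma isProbabilityMeasure_smul_tailMeasure {α η : ℝ} (hα : 0 < α) (hη : 0 < η) :
    IsProbabilityMeasure (ENNReal.ofReal (η ^ α) • (tailMeasure α).restrict (Set.Ioi η)) := by
  constructor
  rw [Measure.smul_apply, Measure.restrict_apply_univ, tailMeasure_Ioi hα hη, smul_eq_mul,
    ← ENNReal.ofReal_mul (by positivity), ← Real.rpow_add hη]
  simp

/-! ### Vague convergence under regular variation -/

section OneSided

variable {Ω : Type*} [MeasurableSpace Ω] {P : Measure Ω} [IsProbabilityMeasure P]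

lemma integral_scaled_eq {X : Ω → ℝ} (hX : Measurable X) {f : ℝ → ℝ} (hf : Measurable f) {η x : ℝ}
    (hx : 0 < x) (h0 : ∀ y, y ≤ η → f y = 0) (hA : P {ω | x * η < X ω} ≠ 0) :
    ∫ ω, f (X ω / x) ∂P = P.real {ω | x * η < X ω} *
      ∫ y, f y ∂((P[|{ω | x * η < X ω}]).map (fun ω => X ω / x)) := by
  have hS : MeasurableSet {ω | x * η < X ω} := measurableSet_lt measurable_const hX
  have hAr : P.real {ω | x * η < X ω} ≠ 0 := by
    rw [Measure.real, ENNReal.toReal_ne_zero]; exact ⟨hA, measure_ne_top _ _⟩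
  rw [integral_map (by fun_prop) (by fun_prop), ProbabilityTheory.cond, integral_smul_measure,
    ENNReal.toReal_inv, smul_eq_mul, ← mul_assoc]
  change _ = P.real {ω | x * η < X ω} * (P.real {ω | x * η < X ω})⁻¹ * _
  rw [mul_inv_cancel₀ hAr, one_mul, setIntegral_eq_integral_of_forall_compl_eq_zero]
  intro ω hω
  refine h0 _ ?_
  have : X ω ≤ x * η := not_lt.1 hω
  rw [div_le_iff₀ hx]; linarith

lemma abs_integral_scaled_le {X : Ω → ℝ} (hX : Measurable X) {f : ℝ → ℝ} {η x C : ℝ}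
    (hx : 0 < x) (h0 : ∀ y, y ≤ η → f y = 0) (hC : ∀ y, |f y| ≤ C) :
    |∫ ω, f (X ω / x) ∂P| ≤ C * P.real {ω | x * η < X ω} := by
  have hS : MeasurableSet {ω | x * η < X ω} := measurableSet_lt measurable_const hX
  rw [← setIntegral_eq_integral_of_forall_compl_eq_zero (s := {ω | x * η < X ω})]
  · have hb (ω : Ω) (_ : ω ∈ {ω | x * η < X ω}) : ‖f (X ω / x)‖ ≤ C := hC _
    exact norm_setIntegral_le_of_norm_le_const (measure_lt_top _ _) hb
  intro ω hω
  refine h0 _ ?_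
  have : X ω ≤ x * η := not_lt.1 hω
  rw [div_le_iff₀ hx]; linarith

/-- Vague convergence of the law of `X / x`, for test functions that depend on `x`. -/
lemma tendsto_integral_scaled {X : Ω → ℝ} (hX : Measurable X) {D : ℝ → ℝ}
    (hD : ∀ᶠ x in atTop, 0 < D x) {α q : ℝ} (hα : 0 < α) (hq : 0 ≤ q)
    (htail : ∀ y : ℝ, 0 < y → Tendsto (fun x : ℝ => P.real {ω | x * y < X ω} / D x) atTop
      (𝓝 (q * y ^ (-α)))) {Φ : ℝ → ℝ → ℝ} {Ψ : ℝ → ℝ} {C η : ℝ} (hη : 0 < η)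
    (hΦ : ∀ x, Measurable (Φ x)) (hC : ∀ x y, |Φ x y| ≤ C) (h0 : ∀ x y, y ≤ η → Φ x y = 0)
    (hlim : 0 < q → ∀ y : ℝ, 0 < y →
      Tendsto (fun z : ℝ × ℝ => Φ z.2 z.1) (𝓝 y ×ˢ atTop) (𝓝 (Ψ y))) :
    Tendsto (fun x => (∫ ω, Φ x (X ω / x) ∂P) / D x) atTop
      (𝓝 (q * ∫ y, Ψ y ∂(tailMeasure α))) := by
  -- For `q = 0` nothing is known about the limit of `Φ`, but the rescaled mass of its support
  -- vanishes.
  rcases hq.eq_or_lt with rfl | hq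
  · rw [zero_mul]
    have h1 := (htail η hη).const_mul C
    rw [zero_mul, mul_zero] at h1
    refine squeeze_zero_norm' ?_ h1
    filter_upwards [hD, eventually_gt_atTop 0] with x hDx hx
    rw [norm_div, Real.norm_eq_abs, Real.norm_eq_abs, abs_of_pos hDx, ← mul_div_assoc]
    gcongr
    exact abs_integral_scaled_le hX hx (h0 x) (hC x)
  have hlim := hlim hq
  have hC0 : 0 ≤ C := (abs_nonneg _).trans (hC 0 0)
  -- `Ψ` is controlled only on the positive half-line. Its extension by zero is continuous because
  -- it already vanishes up to `η > 0`.
  set g : ℝ → ℝ := fun y => if 0 < y then Ψ y else 0 with hg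
  have hgpos {y : ℝ} (hy : 0 < y) : g y = Ψ y := if_pos hy
  have hlim' (y : ℝ) (hy : 0 < y) : Tendsto (fun x => Φ x y) atTop (𝓝 (Ψ y)) :=
    (hlim y hy).comp (tendsto_const_nhds.prodMk tendsto_id)
  have hg0 (y : ℝ) (hy : y ≤ η) : g y = 0 := by
    by_cases hy0 : 0 < y
    · rw [hgpos hy0]
      refine tendsto_nhds_unique (hlim' y hy0) ?_
      simp only [h0 _ y hy]
      exact tendsto_const_nhds
    · exact if_neg hy0
  have hgC (y : ℝ) : |g y| ≤ C := by
    by_cases hy0 : 0 < y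
    · rw [hgpos hy0]
      exact le_of_tendsto (hlim' y hy0).abs (.of_forall fun x => hC x y)
    · rw [show g y = 0 from if_neg hy0, abs_zero]; exact hC0
  have hgcont : Continuous g := by
    refine continuous_iff_continuousAt.2 fun y => ?_
    by_cases hy0 : 0 < y
    · refine (continuousAt_of_tendsto_prod (F := Φ) (G := Ψ) ?_).congr ?_
      · exact (eventually_gt_nhds hy0).mono fun y' hy' => hlim y' hy'
      · exact (eventually_gt_nhds hy0).mono fun y' hy' => (hgpos hy').symm
    · refine (continuousAt_const (y := (0 : ℝ))).congr ?_
      exact (eventually_lt_nhds (show y < η by linarith)).mono fun y' hy' => (hg0 y' hy'.le).symm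
  -- the normalized laws
  have hν := isProbabilityMeasure_smul_tailMeasure hα hη
  set ν : Measure ℝ := ENNReal.ofReal (η ^ α) • (tailMeasure α).restrict (Set.Ioi η) with hνdef
  have hA : ∀ᶠ x in atTop, P {ω | x * η < X ω} ≠ 0 := by
    have := (htail η hη).eventually_ne (show q * η ^ (-α) ≠ 0 by positivity)
    filter_upwards [this] with x hx h
    apply hx
    simp [Measure.real, h]
  have hprob (x : ℝ) (h : P {ω | x * η < X ω} ≠ 0) :
      IsProbabilityMeasure ((P[|{ω | x * η < X ω}]).map (fun ω => X ω / x)) := by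
    have := cond_isProbabilityMeasure h
    exact Measure.isProbabilityMeasure_map (by fun_prop)
  classical
  set ρ : ℝ → ProbabilityMeasure ℝ := fun x => if h : P {ω | x * η < X ω} ≠ 0 then
    ⟨(P[|{ω | x * η < X ω}]).map (fun ω => X ω / x), hprob x h⟩
    else ⟨Measure.dirac 0, inferInstance⟩
    with hρdef
  have hρ (x : ℝ) (h : P {ω | x * η < X ω} ≠ 0) :
      (ρ x : Measure ℝ) = (P[|{ω | x * η < X ω}]).map (fun ω => X ω / x) := by
    have e : ρ x = ⟨_, hprob x h⟩ := dif_pos h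
    rw [e]; rfl
  have htails (y : ℝ) : Tendsto (fun x => (ρ x : Measure ℝ).real (Set.Ioi y)) atTop
      (𝓝 (ν.real (Set.Ioi y))) := by
    have e1 : ν.real (Set.Ioi y) = (q * (max y η) ^ (-α)) / (q * η ^ (-α)) := by
      have hm : 0 < max y η := lt_max_of_lt_right hη
      rw [Measure.real, hνdef, Measure.smul_apply, Measure.restrict_apply measurableSet_Ioi,
        Set.Ioi_inter_Ioi, tailMeasure_Ioi hα hm, smul_eq_mul, ← ENNReal.ofReal_mul (by positivity),
        ENNReal.toReal_ofReal (by positivity), Real.rpow_neg hη.le]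
      field_simp
    rw [e1]
    have hm : 0 < max y η := lt_max_of_lt_right hη
    refine ((htail _ hm).div (htail η hη) (by positivity)).congr' ?_
    filter_upwards [hA, hD, eventually_gt_atTop 0] with x hAx hDx hx
    rw [hρ x hAx, map_measureReal_apply (by fun_prop) measurableSet_Ioi,
      measureReal_def, cond_apply (measurableSet_lt measurable_const hX), ENNReal.toReal_mul,
      ENNReal.toReal_inv]
    change _ = (P.real _)⁻¹ * P.real _
    have : {ω | x * η < X ω} ∩ (fun ω => X ω / x) ⁻¹' Set.Ioi y = {ω | x * max y η < X ω} := by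
      ext ω
      change (x * η < X ω ∧ y < X ω / x) ↔ x * max y η < X ω
      rw [lt_div_iff₀ hx, mul_max_of_nonneg _ _ hx.le, max_lt_iff, mul_comm y]
      tauto
    rw [this, Pi.div_apply, div_div_div_cancel_right₀ hDx.ne', div_eq_inv_mul]
  have hweak : Tendsto ρ atTop (𝓝 ⟨ν, hν⟩) := tendsto_probabilityMeasure_of_Ioi htails
  have hgint : Tendsto (fun x => ∫ y, g y ∂(ρ x : Measure ℝ)) atTop (𝓝 (∫ y, g y ∂ν)) := by
    have := (ProbabilityMeasure.tendsto_iff_forall_integral_tendsto.1 hweak)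
      (BoundedContinuousFunction.ofNormedAddCommGroup g hgcont C hgC)
    exact this
  have hΦint : Tendsto (fun x => ∫ y, Φ x y ∂(ρ x : Measure ℝ)) atTop (𝓝 (∫ y, g y ∂ν)) := by
    have hdiff : Tendsto (fun x => ∫ y, (Φ x y - g y) ∂(ρ x : Measure ℝ)) atTop (𝓝 0) := by
      rw [Metric.tendsto_nhds]
      intro ε hε
      -- Beyond `K` the crude bound `2 * C` suffices, since little mass lies there; on `[η, K]` the
      -- convergence is uniform.
      obtain ⟨K, hKη, hK⟩ : ∃ K, η ≤ K ∧ 2 * C * ν.real (Set.Ioi K) < ε / 2 := by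
        have h1 : Tendsto (fun K : ℝ => 2 * C * (η ^ α * K ^ (-α))) atTop (𝓝 0) := by
          have := (tendsto_rpow_neg_atTop hα).const_mul (η ^ α) |>.const_mul (2 * C)
          simpa using this
        obtain ⟨K, hK1, hK2⟩ := ((h1.eventually_lt_const (show 0 < ε / 2 by positivity)).and
          (eventually_ge_atTop η)).exists
        refine ⟨K, hK2, ?_⟩
        have hm : 0 < K := by linarith
        rwa [Measure.real, hνdef, Measure.smul_apply, Measure.restrict_apply measurableSet_Ioi,
          Set.Ioi_inter_Ioi, sup_eq_left.2 hK2, tailMeasure_Ioi hα hm, smul_eq_mul,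
          ← ENNReal.ofReal_mul (by positivity), ENNReal.toReal_ofReal (by positivity)]
      have hunif := eventually_forall_Icc_dist_lt (F := Φ) (G := g) (a := η) (b := K)
        (fun y hy => by rw [hgpos (hη.trans_le hy.1)]; exact hlim y (hη.trans_le hy.1))
        (fun y _ => hgcont.continuousAt) (half_pos hε)
      have hKlim := ((htails K).const_mul (2 * C)).eventually_lt_const hK
      filter_upwards [hunif, hKlim] with x hx hxK
      rw [dist_zero_right]
      have hint : Integrable (fun y => ε / 2 + (Set.Ioi K).indicator (fun _ => 2 * C) y)
          (ρ x : Measure ℝ) :=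
        (integrable_const _).add ((integrable_const _).indicator measurableSet_Ioi)
      refine (norm_integral_le_of_norm_le hint (.of_forall fun y => ?_)).trans_lt ?_
      · by_cases hyK : K < y
        · rw [Set.indicator_of_mem (by exact hyK)]
          calc ‖Φ x y - g y‖ ≤ ‖Φ x y‖ + ‖g y‖ := norm_sub_le _ _
            _ ≤ C + C := add_le_add (hC x y) (hgC y)
            _ ≤ _ := by linarith
        · rw [Set.indicator_of_notMem (by exact hyK), add_zero]
          by_cases hyη : y ≤ η
          · rw [h0 x y hyη, hg0 y hyη, sub_zero, norm_zero]; positivity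
          · exact (hx y ⟨(not_le.1 hyη).le, not_lt.1 hyK⟩).le
      · rw [integral_add (integrable_const _)
          ((integrable_const _).indicator measurableSet_Ioi), integral_indicator measurableSet_Ioi]
        simp only [integral_const, smul_eq_mul, probReal_univ, one_mul,
          measureReal_restrict_apply_univ]
        linarith
    have := hdiff.add hgint
    rw [zero_add] at this
    refine this.congr fun x => ?_
    rw [← integral_add]
    · simp
    · exact Integrable.of_bound (C := C + C) ((hΦ x).sub hgcont.measurable).aestronglyMeasurable
        (.of_forall fun y => (norm_sub_le _ _).trans (add_le_add (hC x y) (hgC y)))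
    · exact Integrable.of_bound (C := C) hgcont.aestronglyMeasurable (.of_forall hgC)
  have hfin := (htail η hη).mul hΦint
  have e2 : q * η ^ (-α) * ∫ y, g y ∂ν = q * ∫ y, Ψ y ∂(tailMeasure α) := by
    rw [hνdef, integral_smul_measure, ENNReal.toReal_ofReal (by positivity),
      setIntegral_eq_integral_of_forall_compl_eq_zero (s := Set.Ioi η)
        (fun y hy => hg0 y (not_lt.1 (by exact hy))),
      smul_eq_mul, Real.rpow_neg hη.le]
    have : ∫ y, g y ∂(tailMeasure α) = ∫ y, Ψ y ∂(tailMeasure α) :=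
      integral_congr_ae ((ae_tailMeasure_pos α).mono fun y hy => hgpos hy)
    rw [this]
    field_simp
  rw [← e2]
  refine hfin.congr' ?_
  filter_upwards [hA, hD, eventually_gt_atTop 0] with x hAx hDx hx
  rw [integral_scaled_eq hX (hΦ x) hx (h0 x) hAx, hρ x hAx]
  ring

end OneSided

section RegVar

variable {Ω : Type*} [MeasurableSpace Ω] {P : Measure Ω} [IsProbabilityMeasure P] {Z : Ω → ℝ}
  {α p : ℝ}

/-- Division by zero yields `0`, so the ratio at `y = 1`, which tends to `1`, forces positive tails
at arbitrarily high levels, and tails decrease in the level. -/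
lemma RegVarTails.tail_pos (h : RegVarTails P Z α p) (x : ℝ) : 0 < P.real {ω | x < |Z ω|} := by
  have h1 := h.tendsto_ratio 1 one_pos
  rw [Real.one_rpow] at h1
  obtain ⟨y, hy, hxy⟩ := ((h1.eventually_ne one_ne_zero).and (eventually_ge_atTop x)).exists
  have h2 : P.real {ω | y < |Z ω|} ≠ 0 := fun h0 => hy (by simp [h0])
  refine lt_of_lt_of_le (lt_of_le_of_ne measureReal_nonneg h2.symm) ?_
  exact measureReal_mono fun ω (hω : y < |Z ω|) => lt_of_le_of_lt hxy hω

lemma RegVarTails.tendsto_signed (h : RegVarTails P Z α p) (hZ : Measurable Z) {σ : ℝ}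
    (hσ : σ ∈ ({-1, 1} : Set ℝ)) {y : ℝ} (hy : 0 < y) :
    Tendsto (fun x : ℝ => P.real {ω | x * y < σ * Z ω} / P.real {ω | x < |Z ω|}) atTop
      (𝓝 (signWeight p σ * y ^ (-α))) := by
  have h1 : Tendsto (fun x : ℝ => P.real {ω | x * y < Z ω} / P.real {ω | x < |Z ω|}) atTop
      (𝓝 (p * y ^ (-α))) := by
    -- The balance condition at level `x * y` is multiplied by the ratio of the tails of `|Z|` at `x
    -- * y` and `x`.
    have := (h.tendsto_balance.comp (tendsto_id.atTop_mul_const hy)).mul (h.tendsto_ratio y hy)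
    refine this.congr fun x => ?_
    exact div_mul_div_cancel₀ (h.tail_pos _).ne'
  rcases hσ with rfl | rfl
  · rw [signWeight_neg_one]
    have h2 := (h.tendsto_ratio y hy).sub h1
    rw [show (1 - p) * y ^ (-α) = y ^ (-α) - p * y ^ (-α) by ring]
    refine h2.congr' ?_
    filter_upwards [eventually_gt_atTop 0] with x hx
    have hxy : 0 < x * y := by positivity
    have hsub : {ω | x * y < Z ω} ⊆ {ω | x * y < |Z ω|} :=
      fun ω (hω : x * y < Z ω) => lt_of_lt_of_le hω (le_abs_self _)
    rw [← sub_div, ← measureReal_sdiff hsub (measurableSet_lt measurable_const hZ)]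
    congr 2
    ext ω
    change (x * y < |Z ω| ∧ ¬ x * y < Z ω) ↔ x * y < -1 * Z ω
    rw [lt_abs]
    constructor
    · rintro ⟨h | h, h'⟩
      · exact absurd h h'
      · linarith
    · intro h
      exact ⟨Or.inr (by linarith), by linarith⟩
  · rw [signWeight_one]
    simpa only [one_mul] using h1

end RegVar

lemma signTail_eq (p α : ℝ) : signTail p α = ENNReal.ofReal (signWeight p 1) • tailMeasure α +
    ENNReal.ofReal (signWeight p (-1)) • (tailMeasure α).map (fun u => -u) := by
  refine Measure.ext_of_lintegral _ fun f hf => ?_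
  rw [lintegral_signTail hf, lintegral_add_measure, lintegral_smul_measure, lintegral_smul_measure,
    lintegral_map hf measurable_neg, smul_eq_mul, smul_eq_mul, ← lintegral_const_mul _ hf,
    ← lintegral_const_mul _ (by fun_prop), ← lintegral_add_left (by fun_prop)]
  refine lintegral_congr fun u => ?_
  rw [lintegral_signMeasure, mul_one, mul_neg_one]

lemma integrable_tailMeasure {α η C : ℝ} (hα : 0 < α) (hη : 0 < η) {f : ℝ → ℝ}
    (hf : Measurable f) (hC : ∀ y, |f y| ≤ C) (h0 : ∀ y, 0 < y → y ≤ η → f y = 0) :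
    Integrable f (tailMeasure α) := by
  have h1 : IntegrableOn f (Set.Ioi η) (tailMeasure α) := by
    refine IntegrableOn.of_bound (C := C) ?_ hf.aestronglyMeasurable (.of_forall hC)
    rw [tailMeasure_Ioi hα hη]
    exact ENNReal.ofReal_lt_top
  refine (integrable_indicator_iff measurableSet_Ioi).2 h1 |>.congr ?_
  filter_upwards [ae_tailMeasure_pos α] with y hy
  by_cases h : η < y
  · exact Set.indicator_of_mem (by exact h) _
  · rw [Set.indicator_of_notMem (by exact h), h0 y hy (not_lt.1 h)]

lemma integral_signTail {p α η C : ℝ} (hα : 0 < α) (h0 : 0 ≤ p) (h1 : p ≤ 1) (hη : 0 < η)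
    {f : ℝ → ℝ} (hf : Measurable f) (hC : ∀ y, |f y| ≤ C) (hf0 : ∀ y, |y| ≤ η → f y = 0) :
    ∫ y, f y ∂(signTail p α) = signWeight p 1 * ∫ u, f u ∂(tailMeasure α) +
      signWeight p (-1) * ∫ u, f (-u) ∂(tailMeasure α) := by
  have i1 : Integrable f (tailMeasure α) := integrable_tailMeasure hα hη hf hC
    fun y hy hyη => hf0 y (by rwa [abs_of_pos hy])
  have i2 : Integrable (fun u => f (-u)) (tailMeasure α) :=
    integrable_tailMeasure hα hη (by fun_prop) (fun y => hC _)
    fun y hy hyη => hf0 _ (by rwa [abs_neg, abs_of_pos hy])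
  have i3 : Integrable f ((tailMeasure α).map (fun u => -u)) :=
    (integrable_map_measure hf.aestronglyMeasurable measurable_neg.aemeasurable).2 i2
  rw [signTail_eq, integral_add_measure (i1.smul_measure ENNReal.ofReal_ne_top)
    (i3.smul_measure ENNReal.ofReal_ne_top), integral_smul_measure, integral_smul_measure,
    integral_map measurable_neg.aemeasurable hf.aestronglyMeasurable,
    ENNReal.toReal_ofReal (signWeight_nonneg h0 h1 _),
    ENNReal.toReal_ofReal (signWeight_nonneg h0 h1 _)]
  rfl

lemma integrable_signTail_prod {p α η C : ℝ} (hα : 0 < α) (h0 : 0 ≤ p) (h1 : p ≤ 1) (hη : 0 < η)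
    {E : Type*} [MeasurableSpace E] {Q : Measure E} [IsProbabilityMeasure Q]
    {f : ℝ × E → ℝ} (hf : Measurable f) (hC : ∀ z, |f z| ≤ C) (hf0 : ∀ z, |z.1| ≤ η → f z = 0) :
    Integrable f ((signTail p α).prod Q) := by
  have hS : MeasurableSet {y : ℝ | η < |y|} := measurableSet_lt measurable_const measurable_norm
  have i : IntegrableOn f ({y : ℝ | η < |y|} ×ˢ Set.univ) ((signTail p α).prod Q) := by
    refine IntegrableOn.of_bound (C := C) ?_ hf.aestronglyMeasurable (.of_forall hC)
    rw [Measure.prod_prod, signTail_abs_gt hα h0 h1 hη, measure_univ, mul_one]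
    exact ENNReal.ofReal_lt_top
  refine (integrableOn_iff_integrable_of_support_subset fun z hz => ?_).1 i
  refine ⟨?_, trivial⟩
  by_contra h
  exact hz (hf0 z (not_lt.1 h))

section Noise

variable {Ω : Type*} [MeasurableSpace Ω] {P : Measure Ω} [IsProbabilityMeasure P] {Z : Ω → ℝ}
  {α p : ℝ}

/-- Vague convergence of the law of a regularly varying variable divided by `x`. -/
lemma RegVarTails.tendsto_integral (h : RegVarTails P Z α p) (hZ : Measurable Z)
    {Φ : ℝ → ℝ → ℝ} {G : ℝ → ℝ} {C η : ℝ} (hη : 0 < η)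
    (hΦ : ∀ x, Measurable (Φ x)) (hC : ∀ x y, |Φ x y| ≤ C) (h0 : ∀ x y, |y| ≤ η → Φ x y = 0)
    (hG : Measurable G) (hGC : ∀ y, |G y| ≤ C) (hG0 : ∀ y, |y| ≤ η → G y = 0)
    (hlim : ∀ y ≠ 0, 0 < signWeight p (Real.sign y) →
      Tendsto (fun z : ℝ × ℝ => Φ z.2 z.1) (𝓝 y ×ˢ atTop) (𝓝 (G y))) :
    Tendsto (fun x => (∫ ω, Φ x (Z ω / x) ∂P) / P.real {ω | x < |Z ω|}) atTop
      (𝓝 (∫ y, G y ∂(signTail p α))) := by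
  have hC0 : 0 ≤ C := (abs_nonneg _).trans (hC 0 0)
  have side (σ : ℝ) (hσ : σ ∈ ({-1, 1} : Set ℝ)) :
      Tendsto (fun x => (∫ ω, (if 0 < (σ * Z ω) / x then Φ x (σ * ((σ * Z ω) / x)) else 0) ∂P) /
        P.real {ω | x < |Z ω|}) atTop (𝓝 (signWeight p σ * ∫ u, G (σ * u) ∂(tailMeasure α))) := by
    have hσ1 : |σ| = 1 := by rcases hσ with rfl | rfl <;> simp
    have hs {y : ℝ} (hy : 0 < y) : Real.sign (σ * y) = σ := by
      rcases hσ with rfl | rfl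
      · exact Real.sign_of_neg (by linarith)
      · exact Real.sign_of_pos (by linarith)
    refine tendsto_integral_scaled (X := fun ω => σ * Z ω)
      (Φ := fun x y => if 0 < y then Φ x (σ * y) else 0) (by fun_prop)
      (.of_forall fun x => h.tail_pos x) h.index_pos (signWeight_nonneg h.nonneg h.le_one _)
      (fun y hy => h.tendsto_signed hZ hσ hy) hη (C := C) ?_ ?_ ?_ ?_
    · exact fun x => Measurable.ite measurableSet_Ioi
        ((hΦ x).comp (measurable_const_mul σ)) measurable_const
    · intro x y
      split_ifs
      · exact hC _ _
      · simpa using hC0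
    · intro x y hy
      split_ifs with hy0
      · exact h0 _ _ (by rwa [abs_mul, hσ1, one_mul, abs_of_pos hy0])
      · rfl
    · intro hw y hy
      have hσy : σ * y ≠ 0 := by
        rcases hσ with rfl | rfl
        · linarith
        · linarith
      have h1 := hlim (σ * y) hσy (by rwa [hs hy])
      have h2 : Tendsto (fun z : ℝ × ℝ => (σ * z.1, z.2)) (𝓝 y ×ˢ atTop) (𝓝 (σ * y) ×ˢ atTop) :=
        ((continuous_const_mul σ).continuousAt.tendsto.comp tendsto_fst).prodMk tendsto_snd
      refine (h1.comp h2).congr' ?_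
      have : ∀ᶠ z : ℝ × ℝ in 𝓝 y ×ˢ atTop, 0 < z.1 := tendsto_fst.eventually (eventually_gt_nhds hy)
      filter_upwards [this] with z hz
      rw [if_pos hz]
      rfl
  have hsum := (side 1 (by simp)).add (side (-1) (by simp))
  simp only [one_mul, neg_one_mul] at hsum
  rw [integral_signTail h.index_pos h.nonneg h.le_one hη hG hGC hG0]
  refine hsum.congr' ?_
  filter_upwards with x
  have hm1 : Measurable fun ω => if 0 < Z ω / x then Φ x (Z ω / x) else 0 :=
    Measurable.ite (measurableSet_lt measurable_const (by fun_prop))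
      ((hΦ x).comp (by fun_prop)) measurable_const
  have hm2 : Measurable fun ω => if 0 < -Z ω / x then Φ x (-(-Z ω / x)) else 0 :=
    Measurable.ite (measurableSet_lt measurable_const (by fun_prop))
      ((hΦ x).comp (by fun_prop)) measurable_const
  rw [← add_div, ← integral_add]
  · congr 1
    refine integral_congr_ae (.of_forall fun ω => ?_)
    dsimp only
    rw [neg_div, neg_neg]
    rcases lt_trichotomy (Z ω / x) 0 with hz | hz | hz
    · rw [if_neg (by linarith), if_pos (by linarith), zero_add]
    · rw [hz]; simp [h0 x 0 (by simpa using hη.le)]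
    · rw [if_pos hz, if_neg (by linarith), add_zero]
  · refine Integrable.of_bound (C := C) hm1.aestronglyMeasurable (.of_forall fun ω => ?_)
    split_ifs
    · exact hC _ _
    · simpa using hC0
  · refine Integrable.of_bound (C := C) hm2.aestronglyMeasurable (.of_forall fun ω => ?_)
    split_ifs
    · exact hC _ _
    · simpa using hC0

/-- Vague convergence jointly with independent noise. -/
lemma RegVarTails.tendsto_integral_prod (h : RegVarTails P Z α p) (hZ : Measurable Z)
    {E : Type*} [MeasurableSpace E] {Q : Measure E} [IsProbabilityMeasure Q]
    {Φ : ℝ → ℝ × E → ℝ} {G : ℝ × E → ℝ} {C η : ℝ} (hη : 0 < η)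
    (hΦ : ∀ x, Measurable (Φ x)) (hC : ∀ x z, |Φ x z| ≤ C) (h0 : ∀ x z, |z.1| ≤ η → Φ x z = 0)
    (hG : Measurable G) (hGC : ∀ z, |G z| ≤ C) (hG0 : ∀ z, |z.1| ≤ η → G z = 0)
    (hlim : ∀ᵐ e ∂Q, ∀ y ≠ 0, 0 < signWeight p (Real.sign y) →
      Tendsto (fun z : ℝ × ℝ => Φ z.2 (z.1, e)) (𝓝 y ×ˢ atTop) (𝓝 (G (y, e)))) :
    Tendsto (fun x => (∫ z, Φ x (z.1 / x, z.2) ∂((P.map Z).prod Q)) / P.real {ω | x < |Z ω|}) atTop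
      (𝓝 (∫ z, G z ∂((signTail p α).prod Q))) := by
  have hPZ : IsProbabilityMeasure (P.map Z) := Measure.isProbabilityMeasure_map hZ.aemeasurable
  have hC0 : 0 ≤ C := (abs_nonneg _).trans (hGC (0, (nonempty_of_isProbabilityMeasure Q).some))
  have hΦm (x : ℝ) : Measurable fun z : ℝ × E => Φ x (z.1 / x, z.2) := (hΦ x).comp (by fun_prop)
  have hΦi (x : ℝ) : Integrable (fun z : ℝ × E => Φ x (z.1 / x, z.2)) ((P.map Z).prod Q) :=
    Integrable.of_bound (C := C) (hΦm x).aestronglyMeasurable (.of_forall fun z => hC _ _)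
  have e1 (x : ℝ) : (∫ z, Φ x (z.1 / x, z.2) ∂((P.map Z).prod Q)) / P.real {ω | x < |Z ω|} =
      ∫ e, (∫ ω, Φ x (Z ω / x, e) ∂P) / P.real {ω | x < |Z ω|} ∂Q := by
    rw [integral_prod_symm _ (hΦi x), integral_div]
    congr 1
    refine integral_congr_ae (.of_forall fun e => ?_)
    dsimp only
    rw [integral_map hZ.aemeasurable]
    exact ((hΦm x).comp measurable_prodMk_right).aestronglyMeasurable
  simp only [e1]
  rw [integral_prod_symm _ (integrable_signTail_prod h.index_pos h.nonneg h.le_one hη hG hGC hG0)]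
  -- Since `Φ` vanishes for `|z.1| ≤ η`, each inner integral is at most `C` times a tail ratio,
  -- which eventually drops below `η ^ (-α) + 1`.
  refine tendsto_integral_filter_of_dominated_convergence (fun _ => C * (η ^ (-α) + 1)) ?_ ?_
    (integrable_const _) ?_
  · refine .of_forall fun x => ?_
    have hm : StronglyMeasurable fun e => ∫ ω, Φ x (Z ω / x, e) ∂P :=
      StronglyMeasurable.integral_prod_right' (f := fun q : E × Ω => Φ x (Z q.2 / x, q.1))
        (((hΦ x).comp (by fun_prop)).stronglyMeasurable)
    exact (hm.measurable.div_const _).aestronglyMeasurable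
  · have hr := (h.tendsto_ratio η hη).eventually_lt_const (lt_add_one _)
    filter_upwards [hr, eventually_gt_atTop 0] with x hx hx0
    refine .of_forall fun e => ?_
    have hb : |∫ ω, Φ x (Z ω / x, e) ∂P| ≤ C * P.real {ω | x * η < |Z ω|} := by
      have hf (ω : Ω) : Φ x (Z ω / x, e) = 0 ∨ x * η < |Z ω| := by
        by_cases hω : x * η < |Z ω|
        · exact Or.inr hω
        · refine Or.inl (h0 _ _ ?_)
          change |Z ω / x| ≤ η
          rw [abs_div, abs_of_pos hx0, div_le_iff₀ hx0]
          linarith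
      rw [← setIntegral_eq_integral_of_forall_compl_eq_zero (s := {ω | x * η < |Z ω|})
        (fun ω hω => (hf ω).resolve_right hω)]
      have hb (ω : Ω) (_ : ω ∈ {ω | x * η < |Z ω|}) : ‖Φ x (Z ω / x, e)‖ ≤ C := hC _ _
      exact norm_setIntegral_le_of_norm_le_const (measure_lt_top _ _) hb
    rw [norm_div, Real.norm_eq_abs, Real.norm_eq_abs, abs_of_pos (h.tail_pos x)]
    calc _ ≤ C * P.real {ω | x * η < |Z ω|} / P.real {ω | x < |Z ω|} := by
          gcongr
      _ = C * (P.real {ω | x * η < |Z ω|} / P.real {ω | x < |Z ω|}) := by ring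
      _ ≤ _ := by gcongr
  · filter_upwards [hlim] with e he
    exact h.tendsto_integral hZ (Φ := fun x y => Φ x (y, e)) (G := fun y => G (y, e)) hη
      (fun x => (hΦ x).comp measurable_prodMk_right) (fun x y => hC _ _) (fun x y hy => h0 _ _ hy)
      (hG.comp measurable_prodMk_right) (fun y => hGC _) (fun y hy => hG0 _ hy) he

end Noise

/-! ### Asymptotics of the recursion for frozen noise -/

/-- The path of the recursion `x ↦ Ψ x v` started at `x`. -/
def recPath {S : Type*} (Ψ : ℝ → S → ℝ) (x : ℝ) (e : ℕ → S) : ℕ → ℝ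
  | 0 => x
  | n + 1 => Ψ (recPath Ψ x e n) (e n)

@[fun_prop]
lemma measurable_recPath {S : Type*} [MeasurableSpace S] {Ψ : ℝ → S → ℝ}
    (hΨ : Measurable (Function.uncurry Ψ)) :
    Measurable fun z : ℝ × (ℕ → S) => recPath Ψ z.1 z.2 := by
  refine measurable_pi_lambda _ fun n => ?_
  induction n with
  | zero => exact measurable_fst
  | succ n ih =>
    exact hΨ.comp (ih.prodMk ((measurable_pi_apply n).comp measurable_snd))

section Asymptotics

variable {p : ℝ} {f : ℝ → ℝ} {a : ℝ × ℝ}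

/-- Asymptotic homogeneity along the rays of positive weight. -/
def AsympStep (p : ℝ) (f : ℝ → ℝ) (a : ℝ × ℝ) : Prop :=
  ∀ σ ∈ ({-1, 1} : Set ℝ), 0 < signWeight p σ →
    Tendsto (fun x : ℝ => x⁻¹ * f (σ * x)) atTop (𝓝 (step σ a))

/-- At most linear growth. -/
def LinearGrowth (f : ℝ → ℝ) : Prop :=
  ∃ C : ℝ, ∀ᶠ x : ℝ in atTop, ∀ y : ℝ, |y| ≤ x → |f y| ≤ C * x

/-- Write `f u / x` as `(σ u / x)` times `(σ u)⁻¹ f u`. The first factor tends to `|y|`, and since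
`σ u` then tends to infinity the second tends to `step σ a`. The arbitrary filter allows the
starting point and the scale to vary together, which gives local uniformity. -/
lemma AsympStep.tendsto (hf : AsympStep p f a) {β : Type*} {l : Filter β} {u x : β → ℝ} {y : ℝ}
    (hx : Tendsto x l atTop) (hu : Tendsto (fun b => u b / x b) l (𝓝 y)) (hy : y ≠ 0)
    (hp : 0 < signWeight p (Real.sign y)) :
    Tendsto (fun b => f (u b) / x b) l (𝓝 (step y a)) := by
  set σ := Real.sign y with hσdef
  have hσ := sign_mem hy
  have hσσ : σ * σ = 1 := by rcases hσ with h | h <;> rw [hσdef, h] <;> norm_num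
  have h1 : Tendsto (fun b => σ * (u b / x b)) l (𝓝 |y|) := by
    have : |y| = σ * y := by
      nth_rw 2 [← abs_mul_sign y]
      rw [mul_left_comm, ← hσdef, hσσ, mul_one]
    rw [this]
    exact hu.const_mul σ
  have h2 : Tendsto (fun b => σ * u b) l atTop := by
    refine (h1.pos_mul_atTop (abs_pos.2 hy) hx).congr' ?_
    filter_upwards [hx.eventually_gt_atTop 0] with b hb
    field_simp
  have h3 := h1.mul ((hf σ hσ hp).comp h2)
  rw [← step_eq_abs_mul hy] at h3
  refine h3.congr' ?_
  filter_upwards [hx.eventually_gt_atTop 0, h2.eventually_gt_atTop 0] with b hb hub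
  simp only [Function.comp]
  rw [← mul_assoc σ σ, hσσ, one_mul]
  have : σ * u b ≠ 0 := hub.ne'
  rw [← mul_assoc, ← mul_div_assoc, div_mul_eq_mul_div, mul_inv_cancel₀ this]
  ring

/-- If `|u| ≤ δ x`, then `|f u| ≤ C δ x`, with `δ` as small as desired. This replaces asymptotic
homogeneity once the limiting path has reached zero. -/
lemma LinearGrowth.tendsto (hf : LinearGrowth f) {β : Type*} {l : Filter β} {u x : β → ℝ}
    (hx : Tendsto x l atTop) (hu : Tendsto (fun b => u b / x b) l (𝓝 0)) :
    Tendsto (fun b => f (u b) / x b) l (𝓝 0) := by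
  obtain ⟨C, hC⟩ := hf
  rw [Metric.tendsto_nhds]
  intro ε hε
  set δ := ε / (2 * (|C| + 1)) with hδ
  have hδ0 : 0 < δ := by positivity
  have h1 := (hx.const_mul_atTop hδ0).eventually hC
  filter_upwards [h1, Metric.tendsto_nhds.1 hu δ hδ0, hx.eventually_gt_atTop 0] with b hb hub hxb
  rw [dist_zero_right, Real.norm_eq_abs, abs_div, abs_of_pos hxb] at *
  have h2 := hb (u b) ((div_le_iff₀ hxb).1 hub.le)
  rw [div_lt_iff₀ hxb]
  calc |f (u b)| ≤ C * (δ * x b) := h2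
    _ ≤ (|C| + 1) * (δ * x b) := by gcongr; linarith [le_abs_self C]
    _ = ε / 2 * x b := by rw [hδ]; field_simp
    _ < ε * x b := by gcongr; linarith

variable {S : Type*} {Ψ : ℝ → S → ℝ} {e : ℕ → S} {a : ℕ → ℝ × ℝ}

/-- Induction on time. As long as the limiting path is nonzero, its sign has positive weight and
asymptotic homogeneity applies. A zero is either excluded by nonvanishing multipliers or handled by
linear growth; these are the two alternatives in the hypothesis. -/
lemma tendsto_recPath (hstep : ∀ n, AsympStep p (Ψ · (e n)) (a n))
    (hrel : ∀ n, ∀ σ ∈ ({-1, 1} : Set ℝ), 0 < signWeight p σ → Relevant p (step σ (a n)))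
    (hzero : (∀ n, ∀ σ ∈ ({-1, 1} : Set ℝ), 0 < signWeight p σ → step σ (a n) ≠ 0) ∨
      ∀ n, LinearGrowth (Ψ · (e n)))
    {β : Type*} {l : Filter β} {u x : β → ℝ} {y : ℝ} (hx : Tendsto x l atTop)
    (hu : Tendsto (fun b => u b / x b) l (𝓝 y)) (hy0 : y ≠ 0)
    (hy : 0 < signWeight p (Real.sign y)) (n : ℕ) :
    Tendsto (fun b => recPath Ψ (u b) e n / x b) l (𝓝 (path y a n)) := by
  have hr (n : ℕ) : Relevant p (path y a n) := relevant_path (Or.inr hy) hrel n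
  induction n with
  | zero => exact hu
  | succ n ih =>
    change Tendsto (fun b => Ψ (recPath Ψ (u b) e n) (e n) / x b) l (𝓝 (step (path y a n) (a n)))
    rcases hzero with hz | hg
    · have hne (n : ℕ) : path y a n ≠ 0 := by
        induction n with
        | zero => exact hy0
        | succ n ih =>
          change step (path y a n) (a n) ≠ 0
          rw [step_eq_abs_mul ih]
          exact mul_ne_zero (abs_ne_zero.2 ih) (hz n _ (sign_mem ih) ((hr n).resolve_left ih))
      exact (hstep n).tendsto hx ih (hne n) ((hr n).resolve_left (hne n))
    · by_cases h : path y a n = 0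
      · rw [h] at ih ⊢
        rw [step_zero]
        exact (hg n).tendsto hx ih
      · exact (hstep n).tendsto hx ih h ((hr n).resolve_left h)

end Asymptotics

/-! ### Measurable limiting multipliers -/

section Multiplier

variable {S : Type*} [MeasurableSpace S] {Ψ : ℝ → S → ℝ} {ν : Measure S} [IsProbabilityMeasure ν]
  {p : ℝ} {φ : S → ℝ → ℝ}

lemma forwardLaw_eq_stepLaw {A : S → ℝ × ℝ} (hA : Measurable A)
    (h : ∀ᵐ v ∂ν, ∀ σ ∈ ({-1, 1} : Set ℝ), 0 < signWeight p σ → σ * φ v σ = step σ (A v)) :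
    forwardLaw p ν φ = stepLaw p (ν.map A) := by
  have e1 : stepLaw p (ν.map A) =
      ((signMeasure p).prod ν).map (fun z => (z.1, step z.1 (A z.2))) := by
    have := Measure.map_prod_map (signMeasure p) ν measurable_id hA
    rw [Measure.map_id] at this
    rw [stepLaw, this, Measure.map_map (by fun_prop) (by fun_prop)]
    rfl
  rw [e1]
  change ((signMeasure p).prod ν).map _ = _
  refine Measure.map_congr ?_
  have h1 : ∀ᵐ z ∂((signMeasure p).prod ν), z.1 ∈ ({-1, 1} : Set ℝ) ∧ 0 < signWeight p z.1 :=
    Measure.quasiMeasurePreserving_fst.ae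
      (p := fun i => i ∈ ({-1, 1} : Set ℝ) ∧ 0 < signWeight p i)
      (ae_signMeasure.2 fun σ hσ hw => ⟨hσ, hw⟩)
  filter_upwards [h1, Measure.quasiMeasurePreserving_snd.ae h] with z hz hz2
  have : Real.sign z.1 = z.1 := by
    rcases hz.1 with h | h <;> rw [h]
    · exact Real.sign_of_neg (by norm_num)
    · exact Real.sign_of_pos (by norm_num)
  rw [this, hz2 z.1 hz.1 hz.2]

/-- A measurable version of the limiting multipliers. -/
lemma LinearAtInfinity.exists_multiplier (hΨ : Measurable (Function.uncurry Ψ))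
    (h : LinearAtInfinity Ψ ν p φ) :
    ∃ A : S → ℝ × ℝ, Measurable A ∧ forwardLaw p ν φ = stepLaw p (ν.map A) ∧
      (∀ᵐ v ∂ν, AsympStep p (Ψ · v) (A v)) ∧
      ((∀ᵐ v ∂ν, ∀ σ ∈ ({-1, 1} : Set ℝ), 0 < signWeight p σ → step σ (A v) ≠ 0) ∨
        ∀ᵐ v ∂ν, LinearGrowth (Ψ · v)) := by
  classical
  obtain ⟨V, hV, hV1, hlim, hW⟩ := h
  have hVae : ∀ᵐ v ∂ν, v ∈ V := (mem_ae_iff_prob_eq_one hV).2 hV1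
  -- No measurability of `φ` is assumed. Off `V`, and for signs of weight zero, its values carry no
  -- information and are replaced by zero.
  set B : ℝ → S → ℝ := fun σ v => if 0 < signWeight p σ then V.indicator (φ · σ) v else 0 with hB
  have hBm (σ : ℝ) (hσ : σ ∈ ({-1, 1} : Set ℝ)) : Measurable (B σ) := by
    by_cases hw : 0 < signWeight p σ
    · have e : B σ = V.indicator (φ · σ) := by ext v; simp [hB, hw]
      rw [e]
      -- Along the integers the limit is sequential, hence measurable.
      refine measurable_of_tendsto_metrizable
        (f := fun (n : ℕ) => V.indicator fun v => (σ * (n : ℝ))⁻¹ * Ψ (σ * (n : ℝ)) v) ?_ ?_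
      · intro n
        exact (((hΨ.comp measurable_prodMk_left)).const_mul _).indicator hV
      · rw [tendsto_pi_nhds]
        intro v
        by_cases hv : v ∈ V
        · simp only [Set.indicator_of_mem hv]
          exact (hlim σ hσ hw v hv).comp tendsto_natCast_atTop_atTop
        · simp only [Set.indicator_of_notMem hv]
          exact tendsto_const_nhds
    · have e : B σ = fun _ => 0 := by ext v; simp [hB, hw]
      rw [e]; exact measurable_const
  have hBφ (v : S) (hv : v ∈ V) (σ : ℝ) (hσ : σ ∈ ({-1, 1} : Set ℝ)) (hw : 0 < signWeight p σ) :
      σ * φ v σ = step σ (B 1 v, B (-1) v) := by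
    rcases hσ with rfl | rfl
    · rw [step_neg_one]; simp [hB, hw, hv]
    · rw [step_one]; simp [hB, hw, hv]
  refine ⟨fun v => (B 1 v, B (-1) v), (hBm 1 (by simp)).prodMk (hBm (-1) (by simp)), ?_, ?_, ?_⟩
  · exact forwardLaw_eq_stepLaw ((hBm 1 (by simp)).prodMk (hBm (-1) (by simp)))
      (hVae.mono hBφ)
  · filter_upwards [hVae] with v hv σ hσ hw
    rw [← hBφ v hv σ hσ hw]
    refine ((hlim σ hσ hw v hv).const_mul σ).congr fun x => ?_
    rcases hσ with rfl | rfl <;> simp [inv_neg]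
  · by_cases hex : ∃ σ ∈ ({-1, 1} : Set ℝ), 0 < signWeight p σ ∧ 0 < ν {v | φ v σ = 0}
    · right
      obtain ⟨W, -, hWm, hW1, hgrowth⟩ := hW hex
      have hWae : ∀ᵐ v ∂ν, v ∈ W := (mem_ae_iff_prob_eq_one hWm).2 hW1
      exact hWae.mono hgrowth
    · left
      push Not at hex
      have hne (σ : ℝ) (hσ : σ ∈ ({-1, 1} : Set ℝ)) :
          ∀ᵐ v ∂ν, 0 < signWeight p σ → step σ (B 1 v, B (-1) v) ≠ 0 := by
        by_cases hw : 0 < signWeight p σ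
        · have h0 : ∀ᵐ v ∂ν, φ v σ ≠ 0 := by
            rw [ae_iff]
            simpa using hex σ hσ hw
          filter_upwards [hVae, h0] with v hv hv0 _
          rw [← hBφ v hv σ hσ hw]
          refine mul_ne_zero ?_ hv0
          rcases hσ with rfl | rfl <;> norm_num
        · exact .of_forall fun v hw' => absurd hw' hw
      filter_upwards [hne 1 (by simp), hne (-1) (by simp)] with v h1 h2
      rintro σ (rfl | rfl)
      · exact h2
      · exact h1

end Multiplier

/-! ### One-sided limits and the moment condition -/

lemma IsRecursiveChain.map_eq {S Ω : Type*} [MeasurableSpace S] [MeasurableSpace Ω]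
    {Ψ : ℝ → S → ℝ} {P : Measure Ω} [IsProbabilityMeasure P] {Z : ℕ → Ω → ℝ} {ε : ℕ → Ω → S}
    (hZ : IsRecursiveChain Ψ P Z ε) :
    P.map (fun ω (n : ℕ) => Z n ω) =
      ((P.map (Z 0)).prod (Measure.infinitePi fun _ : ℕ => P.map (ε 0))).map
        (fun z => recPath Ψ z.1 z.2) := by
  have hε : Measurable fun ω (n : ℕ) => ε n ω := measurable_pi_lambda _ hZ.measurable_innov
  have h1 := (indepFun_iff_map_prod_eq_prod_map_map hZ.measurable_init.aemeasurable
    hε.aemeasurable).1 hZ.indep_init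
  have h2 := (iIndepFun_iff_map_fun_eq_infinitePi_map hZ.measurable_innov).1 hZ.indep_innov
  simp only [hZ.ident_innov] at h2
  rw [h2] at h1
  rw [← h1, Measure.map_map (measurable_recPath hZ.measurable_map) (hZ.measurable_init.prodMk hε)]
  congr 1
  ext ω n
  induction n with
  | zero => rfl
  | succ n ih =>
    rw [hZ.recursion, ih]
    rfl

lemma lintegral_tailMeasure_indicator {α : ℝ} (hα : 0 < α) (c : ℝ) :
    tailMeasure α {u | 1 < u * c} = ENNReal.ofReal ((max c 0) ^ α) := by
  rcases lt_or_ge 0 c with hc | hc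
  · have : {u | 1 < u * c} = Set.Ioi c⁻¹ := by
      ext u
      change 1 < u * c ↔ c⁻¹ < u
      rw [inv_lt_iff_one_lt_mul₀ hc, mul_comm]
    rw [this, tailMeasure_Ioi hα (inv_pos.2 hc), max_eq_left hc.le, Real.inv_rpow hc.le,
      Real.rpow_neg hc.le, inv_inv]
  · rw [max_eq_right hc, Real.zero_rpow hα.ne', ENNReal.ofReal_zero]
    have : ∀ᵐ u ∂(tailMeasure α), ¬ 1 < u * c := by
      filter_upwards [ae_tailMeasure_pos α] with u hu
      have := mul_nonpos_of_nonneg_of_nonpos hu.le hc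
      linarith
    rw [ae_iff] at this
    simpa using this

/-- For fixed `c`, the number `(c)₊ ^ α` is the `tailMeasure` of the radii `u` with `u c > 1`.
Integrating over the step turns the moment into the limiting mass of paths with `σ` times the value
at time `1` above `1`, which can be compared with tails of `X 1`. -/
lemma lintegral_moment_stepLaw {p α : ℝ} (hα : 0 < α) {κ : Measure (ℝ × ℝ)}
    [IsProbabilityMeasure κ] (σ : ℝ) :
    ∫⁻ z, ENNReal.ofReal ((max (σ * z.2) 0) ^ α) ∂(stepLaw p κ) =
      ((signTail p α).prod (Measure.infinitePi fun _ : ℕ => κ))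
        {z | 1 < σ * path z.1 z.2 1} := by
  have hS : SFinite (stepLaw p κ) := by unfold stepLaw; infer_instance
  have hm : Measurable fun q : ℝ × ℝ => (Set.Ioi (1 : ℝ)).indicator (1 : ℝ → ENNReal) (σ * q.2) :=
    (measurable_one.indicator measurableSet_Ioi).comp (by fun_prop)
  have hB : MeasurableSet {z : ℝ × (ℕ → ℝ × ℝ) | 1 < σ * path z.1 z.2 1} :=
    measurableSet_lt measurable_const
      ((measurable_path 1).const_mul σ)
  have h1 := lintegral_signTail_step (p := p) (α := α) (κ := κ) hm
  rw [Measure.prod_apply hB]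
  have h2 (y : ℝ) : (Measure.infinitePi fun _ : ℕ => κ)
      (Prod.mk y ⁻¹' {z : ℝ × (ℕ → ℝ × ℝ) | 1 < σ * path z.1 z.2 1}) =
      ∫⁻ x, (Set.Ioi (1 : ℝ)).indicator (1 : ℝ → ENNReal) (σ * step y x) ∂κ := by
    rw [← (measurePreserving_eval_infinitePi (fun _ : ℕ => κ) 0).lintegral_comp
      (f := fun x => (Set.Ioi (1 : ℝ)).indicator (1 : ℝ → ENNReal) (σ * step y x))
      ((measurable_one.indicator measurableSet_Ioi).comp (by fun_prop)),
      ← lintegral_indicator_one (measurable_prodMk_left hB)]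
    rfl
  simp only [h2]
  have h3 : Measurable (Function.uncurry fun (u : ℝ) (z : ℝ × ℝ) =>
      (Set.Ioi (1 : ℝ)).indicator (1 : ℝ → ENNReal) (σ * (u * z.2))) :=
    (measurable_one.indicator measurableSet_Ioi).comp (by fun_prop)
  rw [h1, lintegral_lintegral_swap h3.aemeasurable]
  refine lintegral_congr fun z => ?_
  have hI : MeasurableSet {u : ℝ | 1 < u * (σ * z.2)} :=
    measurableSet_lt measurable_const (by fun_prop)
  rw [← lintegral_tailMeasure_indicator hα, ← lintegral_indicator_one hI]
  refine lintegral_congr fun u => ?_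
  rw [mul_left_comm]
  rfl

section OneSidedLimit

variable {S : Type*} [MeasurableSpace S] {Ψ : ℝ → S → ℝ} {ν : Measure S} [IsProbabilityMeasure ν]
  {Ω : Type*} [MeasurableSpace Ω] {P : Measure Ω} [IsProbabilityMeasure P] {X : ℤ → Ω → ℝ}
  {α p : ℝ} {A : S → ℝ × ℝ}

/-- The law of the forward chain separates the initial value from the noise. Vague convergence of
the former, jointly with the independent noise, reduces the claim to a limit for almost every noise
sequence. -/
lemma tendsto_integral_path (hRV : RegVarTails P (X 0) α p)
    (hX : ∀ t, Measurable (X t)) (hΨ : Measurable (Function.uncurry Ψ)) (hA : Measurable A)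
    (hlaw : P.map (fun ω (n : ℕ) => X n ω) =
      ((P.map (X 0)).prod (Measure.infinitePi fun _ : ℕ => ν)).map (fun z => recPath Ψ z.1 z.2))
    {H : (ℕ → ℝ) → ℝ} {C η : ℝ} (hη : 0 < η) (hH : Measurable H) (hC : ∀ m, |H m| ≤ C)
    (h0 : ∀ m, |m 0| ≤ η → H m = 0)
    (hlim : ∀ᵐ e ∂(Measure.infinitePi fun _ : ℕ => ν), ∀ y ≠ 0, 0 < signWeight p (Real.sign y) →
      Tendsto (fun z : ℝ × ℝ => H fun n => recPath Ψ (z.2 * z.1) e n / z.2) (𝓝 y ×ˢ atTop)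
        (𝓝 (H (path y fun n => A (e n))))) :
    Tendsto (fun x => (∫ ω, H (fun n => X n ω / x) ∂P) / P.real {ω | x < |X 0 ω|}) atTop
      (𝓝 (∫ z, H (path z.1 z.2)
        ∂((signTail p α).prod (Measure.infinitePi fun _ : ℕ => ν.map A)))) := by
  have hκ : IsProbabilityMeasure (ν.map A) := Measure.isProbabilityMeasure_map hA.aemeasurable
  have hAm : Measurable fun (e : ℕ → S) (n : ℕ) => A (e n) :=
    measurable_pi_lambda _ fun n => hA.comp (measurable_pi_apply n)
  have hQ : (Measure.infinitePi fun _ : ℕ => ν).map (fun (e : ℕ → S) (n : ℕ) => A (e n)) =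
      Measure.infinitePi fun _ : ℕ => ν.map A :=
    Measure.infinitePi_map_pi (fun _ : ℕ => ν) (f := fun _ => A) fun _ => hA
  have hprod := Measure.map_prod_map (signTail p α) (Measure.infinitePi fun _ : ℕ => ν)
    measurable_id hAm
  rw [Measure.map_id, hQ] at hprod
  have hpm : Measurable fun z : ℝ × (ℕ → ℝ × ℝ) => path z.1 z.2 :=
    measurable_pi_lambda _ measurable_path
  have hHp : Measurable fun z : ℝ × (ℕ → ℝ × ℝ) => H (path z.1 z.2) := hH.comp hpm
  rw [hprod, integral_map (by fun_prop) hHp.aestronglyMeasurable]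
  have hr : Measurable fun z : ℝ × (ℕ → S) => recPath Ψ z.1 z.2 := measurable_recPath hΨ
  have hdiv (x : ℝ) : Measurable fun (m : ℕ → ℝ) (n : ℕ) => m n / x :=
    measurable_pi_lambda _ fun n => (measurable_pi_apply (X := fun _ : ℕ => ℝ) n).div_const x
  have key := hRV.tendsto_integral_prod (hX 0) (Q := Measure.infinitePi fun _ : ℕ => ν)
    (Φ := fun x z => H fun n => recPath Ψ (x * z.1) z.2 n / x)
    (G := fun z => H (path z.1 fun n => A (z.2 n))) hη
    (fun x => hH.comp ((hdiv x).comp (hr.comp ((measurable_fst.const_mul x).prodMk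
      measurable_snd)))) (fun x z => hC _)
    (fun x z hz => h0 _ ?_) (hH.comp (hpm.comp (measurable_fst.prodMk (hAm.comp measurable_snd))))
    (fun z => hC _) (fun z hz => h0 _ hz) hlim
  · refine key.congr' ?_
    filter_upwards [eventually_gt_atTop 0] with x hx
    congr 1
    have hHx : Measurable fun m : ℕ → ℝ => H fun n => m n / x := hH.comp (hdiv x)
    have e1 : ∫ ω, H (fun n => X n ω / x) ∂P =
        ∫ m, H (fun n => m n / x) ∂(P.map (fun ω (n : ℕ) => X n ω)) := by
      rw [integral_map (measurable_pi_lambda _ fun n => hX _).aemeasurable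
        hHx.aestronglyMeasurable]
    rw [e1, hlaw, integral_map hr.aemeasurable hHx.aestronglyMeasurable]
    refine integral_congr_ae (.of_forall fun z => ?_)
    dsimp only
    rw [mul_div_cancel₀ _ hx.ne']
  · change |x * z.1 / x| ≤ η
    by_cases hx : x = 0
    · simpa [hx] using hη.le
    · rwa [mul_div_cancel_left₀ _ hx]

/-- The moment condition on the limiting multipliers. -/
lemma memClass_stepLaw (hRV : RegVarTails P (X 0) α p) (hX : IsStationary P X)
    (hΨ : Measurable (Function.uncurry Ψ)) (hA : Measurable A)
    (hlaw : P.map (fun ω (n : ℕ) => X n ω) =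
      ((P.map (X 0)).prod (Measure.infinitePi fun _ : ℕ => ν)).map (fun z => recPath Ψ z.1 z.2))
    (hstep : ∀ᵐ v ∂ν, AsympStep p (Ψ · v) (A v)) : MemClass p α (stepLaw p (ν.map A)) := by
  have hα := hRV.index_pos
  have hκ : IsProbabilityMeasure (ν.map A) := Measure.isProbabilityMeasure_map hA.aemeasurable
  refine ⟨isProbabilityMeasure_stepLaw hRV.nonneg hRV.le_one _, ?_, ?_, fun σ hσ => ?_⟩
  · rw [stepLaw_fst_eq (by simp), signWeight_one]
  · rw [stepLaw_fst_eq (by simp), signWeight_neg_one]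
  rw [stepLaw_fst_eq hσ, lintegral_moment_stepLaw hα]
  set ρ := (signTail p α).prod (Measure.infinitePi fun _ : ℕ => ν.map A) with hρ
  have hpm : Measurable fun z : ℝ × (ℕ → ℝ × ℝ) => path z.1 z.2 :=
    measurable_pi_lambda _ measurable_path
  have bound (δ : ℝ) (hδ : 0 < δ) :
      ρ {z | 2 * δ ≤ |z.1| ∧ 1 + δ ≤ σ * path z.1 z.2 1} ≤ ENNReal.ofReal (signWeight p σ) := by
    -- A continuous function between the indicator of the set to be bounded and that of `σ * q.2 >
    -- 1`. Its first factor keeps the starting value away from zero, so linear growth is not needed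
    -- for the single step.
    set g : ℝ × ℝ → ℝ := fun q =>
      min (max ((|q.1| - δ) / δ) 0) 1 * min (max ((σ * q.2 - 1) / δ) 0) 1 with hg
    have hgc : Continuous g := by fun_prop
    have hg0 (q : ℝ × ℝ) : 0 ≤ g q := by positivity
    have hg1 (q : ℝ × ℝ) : |g q| ≤ 1 := by
      rw [abs_of_nonneg (hg0 q)]
      exact mul_le_one₀ (min_le_right _ _) (by positivity) (min_le_right _ _)
    have hgz (q : ℝ × ℝ) (hq : |q.1| ≤ δ) : g q = 0 := by
      have : (|q.1| - δ) / δ ≤ 0 := div_nonpos_of_nonpos_of_nonneg (by linarith) hδ.le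
      simp [hg, max_eq_right this]
    have hgz' (q : ℝ × ℝ) (hq : σ * q.2 ≤ 1) : g q = 0 := by
      have : (σ * q.2 - 1) / δ ≤ 0 := div_nonpos_of_nonpos_of_nonneg (by linarith) hδ.le
      simp [hg, max_eq_right this]
    have hHm : Measurable fun m : ℕ → ℝ => g (m 0, m 1) := hgc.measurable.comp (by fun_prop)
    have hlim := tendsto_integral_path hRV hX.measurable hΨ hA hlaw
      (H := fun m => g (m 0, m 1)) hδ hHm (fun m => hg1 _) (fun m hm => hgz _ hm) (by
        have he := (measurePreserving_eval_infinitePi (fun _ : ℕ => ν)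
          0).quasiMeasurePreserving.ae hstep
        filter_upwards [he] with e he y hy hw
        refine (hgc.tendsto _).comp (Tendsto.prodMk_nhds ?_ ?_)
        · refine (tendsto_fst (f := 𝓝 y) (g := (atTop : Filter ℝ))).congr' ?_
          filter_upwards [tendsto_snd.eventually (eventually_ne_atTop (0 : ℝ))] with z hz
          exact (mul_div_cancel_left₀ _ hz).symm
        · refine AsympStep.tendsto he tendsto_snd ?_ hy hw
          refine (tendsto_fst (f := 𝓝 y) (g := (atTop : Filter ℝ))).congr' ?_
          filter_upwards [tendsto_snd.eventually (eventually_ne_atTop (0 : ℝ))] with z hz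
          exact (mul_div_cancel_left₀ _ hz).symm)
    have hle : ∫ z, g (path z.1 z.2 0, path z.1 z.2 1) ∂ρ ≤ signWeight p σ := by
      have h1 := hRV.tendsto_signed (hX.measurable 0) hσ one_pos
      rw [Real.one_rpow, mul_one] at h1
      refine le_of_tendsto_of_tendsto hlim h1 ?_
      filter_upwards [eventually_gt_atTop 0] with x hx
      -- Stationarity enters here: the tail of `σ X 1` is that of `σ X 0`, whose limiting ratio is
      -- the weight of `σ`.
      have hshift : P {ω | x * 1 < σ * X 1 ω} = P {ω | x * 1 < σ * X 0 ω} := by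
        have hm0 (t : ℤ) : Measurable fun ω (s : ℤ) => X (s + t) ω :=
          measurable_pi_lambda _ fun s => hX.measurable _
        have hB : MeasurableSet {m : ℤ → ℝ | x * 1 < σ * m 0} :=
          measurableSet_lt measurable_const
            ((measurable_pi_apply (X := fun _ : ℤ => ℝ) 0).const_mul σ)
        have := congrArg (fun m => m {m : ℤ → ℝ | x * 1 < σ * m 0}) (hX.shift 1)
        rw [Measure.map_apply (hm0 1) hB,
          Measure.map_apply (measurable_pi_lambda _ hX.measurable) hB] at this
        exact this
      have hpos := hRV.tail_pos x
      refine (div_le_div_iff_of_pos_right hpos).2 ?_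
      rw [measureReal_def, ← hshift, ← measureReal_def]
      have hB : MeasurableSet {ω | x * 1 < σ * X 1 ω} :=
        measurableSet_lt measurable_const ((hX.measurable 1).const_mul σ)
      rw [← integral_indicator_one hB]
      refine integral_mono_of_nonneg (.of_forall fun ω => hg0 _)
        ((integrable_const (1 : ℝ)).indicator hB) (.of_forall fun ω => ?_)
      by_cases hω : x * 1 < σ * X 1 ω
      · rw [Set.indicator_of_mem (by exact hω)]
        exact (le_abs_self _).trans (hg1 _)
      · rw [Set.indicator_of_notMem (by exact hω)]
        refine (hgz' _ ?_).le
        change σ * (X ((1 : ℕ) : ℤ) ω / x) ≤ 1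
        rw [Nat.cast_one, ← mul_div_assoc, div_le_one hx]
        linarith
    have hgm : Measurable fun z : ℝ × (ℕ → ℝ × ℝ) => g (path z.1 z.2 0, path z.1 z.2 1) :=
      hHm.comp hpm
    have hint : Integrable (fun z : ℝ × (ℕ → ℝ × ℝ) => g (path z.1 z.2 0, path z.1 z.2 1)) ρ :=
      integrable_signTail_prod hα hRV.nonneg hRV.le_one hδ hgm (fun z => hg1 _)
        (fun z hz => hgz _ hz)
    have hBm : MeasurableSet {z : ℝ × (ℕ → ℝ × ℝ) | 2 * δ ≤ |z.1| ∧ 1 + δ ≤ σ * path z.1 z.2 1} :=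
      (measurableSet_le measurable_const measurable_fst.norm).inter
        (measurableSet_le measurable_const (((measurable_pi_apply 1).comp hpm).const_mul σ))
    refine le_trans ?_ (ENNReal.ofReal_le_ofReal hle)
    rw [ofReal_integral_eq_lintegral_ofReal hint (.of_forall fun z => hg0 _),
      ← lintegral_indicator_one hBm]
    refine lintegral_mono fun z => ?_
    by_cases hz : 2 * δ ≤ |z.1| ∧ 1 + δ ≤ σ * path z.1 z.2 1
    · rw [Set.indicator_of_mem (by exact hz)]
      have h1 : 1 ≤ (|z.1| - δ) / δ := by rw [le_div_iff₀ hδ]; linarith [hz.1]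
      have h2 : 1 ≤ (σ * path z.1 z.2 1 - 1) / δ := by rw [le_div_iff₀ hδ]; linarith [hz.2]
      have : g (path z.1 z.2 0, path z.1 z.2 1) = 1 := by
        change min (max ((|z.1| - δ) / δ) 0) 1 *
          min (max ((σ * path z.1 z.2 1 - 1) / δ) 0) 1 = 1
        rw [min_eq_right (le_max_of_le_left h1), min_eq_right (le_max_of_le_left h2), one_mul]
      rw [this]; simp
    · rw [Set.indicator_of_notMem (by exact hz)]; exact zero_le
  -- A path that starts at zero stays there, so the target set is exhausted as `δ = 1 / (k + 1)`
  -- decreases.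
  have hsub : {z : ℝ × (ℕ → ℝ × ℝ) | 1 < σ * path z.1 z.2 1} ⊆
      ⋃ k : ℕ, {z | 2 * (1 / ((k : ℝ) + 1)) ≤ |z.1| ∧
        1 + 1 / ((k : ℝ) + 1) ≤ σ * path z.1 z.2 1} := by
    intro z (hz : 1 < σ * path z.1 z.2 1)
    have hz1 : z.1 ≠ 0 := by
      intro h
      have : path z.1 z.2 1 = 0 := by
        change step z.1 (z.2 0) = 0
        rw [h, step_zero]
      rw [this] at hz; linarith
    obtain ⟨k, hk⟩ := exists_nat_one_div_lt
      (lt_min (half_pos (abs_pos.2 hz1)) (sub_pos.2 hz))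
    refine Set.mem_iUnion.2 ⟨k, ?_, ?_⟩
    · have := hk.le.trans (min_le_left _ _); linarith
    · have := hk.le.trans (min_le_right _ _); linarith
  refine (measure_mono hsub).trans ?_
  rw [Monotone.measure_iUnion]
  · exact iSup_le fun k => bound _ (by positivity)
  · intro k l hkl z hz
    have : 1 / ((l : ℝ) + 1) ≤ 1 / ((k : ℝ) + 1) := one_div_le_one_div_of_le (by positivity)
      (by simpa using hkl)
    exact ⟨by linarith [hz.1], by linarith [hz.2]⟩

end OneSidedLimit

/-! ### Two-sided limits through stationarity -/

section TwoSidedLimit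

lemma map_natCast_tailProcess {p α : ℝ} {κ' κ : Measure (ℝ × ℝ)} [IsProbabilityMeasure κ']
    [IsProbabilityMeasure κ] :
    (tailProcess p α κ' κ).map (fun m (n : ℕ) => m n) =
      ((signTail p α).prod (Measure.infinitePi fun _ : ℕ => κ)).map (fun z => path z.1 z.2) := by
  have hm : Measurable fun (m : ℤ → ℝ) (n : ℕ) => m n :=
    measurable_pi_lambda _ fun n => measurable_pi_apply _
  have hpm : Measurable fun z : ℝ × (ℕ → ℝ × ℝ) => path z.1 z.2 :=
    measurable_pi_lambda _ measurable_path
  refine Measure.ext_of_lintegral _ fun F hF => ?_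
  have hFp : Measurable fun z : ℝ × (ℕ → ℝ × ℝ) => F (path z.1 z.2) := hF.comp hpm
  have hFm : Measurable fun m : ℤ → ℝ => F fun n : ℕ => m n := hF.comp hm
  rw [lintegral_map hF hm, lintegral_map hF hpm, lintegral_tailProcess hFm,
    lintegral_prod _ hFp.aemeasurable]
  refine lintegral_congr fun y => ?_
  have e (b a : ℕ → ℝ × ℝ) : (fun n : ℕ => biChain y b a n) = path y a := rfl
  simp only [e, lintegral_const, measure_univ, mul_one]

lemma integrable_tailProcess {p α : ℝ} {κ' κ : Measure (ℝ × ℝ)} [IsProbabilityMeasure κ']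
    [IsProbabilityMeasure κ] (hα : 0 < α) (h0 : 0 ≤ p) (h1 : p ≤ 1) {H : (ℤ → ℝ) → ℝ} {C η : ℝ}
    (hη : 0 < η) (hH : Measurable H) (hC : ∀ m, |H m| ≤ C) (hH0 : ∀ m, |m 0| ≤ η → H m = 0) :
    Integrable H (tailProcess p α κ' κ) := by
  have i : IntegrableOn H {m | η < |m 0|} (tailProcess p α κ' κ) := by
    refine IntegrableOn.of_bound (C := C) ?_ hH.aestronglyMeasurable (.of_forall hC)
    rw [tailProcess_abs_gt hα h0 h1 hη]
    exact ENNReal.ofReal_lt_top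
  refine (integrableOn_iff_integrable_of_support_subset fun m hm => ?_).1 i
  by_contra h
  exact hm (hH0 m (not_lt.1 h))

lemma IsStationary.integral_shift {Ω : Type*} [MeasurableSpace Ω] {P : Measure Ω} {X : ℤ → Ω → ℝ}
    (hX : IsStationary P X) {F : (ℤ → ℝ) → ℝ} (hF : Measurable F) (h : ℤ) :
    ∫ ω, F (fun t => X (t + h) ω) ∂P = ∫ ω, F (fun t => X t ω) ∂P := by
  have h1 : Measurable fun ω (t : ℤ) => X (t + h) ω :=
    measurable_pi_lambda _ fun t => hX.measurable _
  have h2 : Measurable fun ω (t : ℤ) => X t ω := measurable_pi_lambda _ hX.measurable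
  rw [← integral_map (f := F) h1.aemeasurable hF.aestronglyMeasurable, hX.shift,
    integral_map h2.aemeasurable hF.aestronglyMeasurable]

variable {S : Type*} [MeasurableSpace S] {Ψ : ℝ → S → ℝ} {ν : Measure S} [IsProbabilityMeasure ν]
  {Ω : Type*} [MeasurableSpace Ω] {P : Measure Ω} {X : ℤ → Ω → ℝ}
  {α p : ℝ} {A : S → ℝ × ℝ} {κ' : Measure (ℝ × ℝ)} [IsProbabilityMeasure κ']

/-- The moment condition makes almost every multiplier preserve relevance, so the frozen-noise
convergence applies at all times; continuity of `H` then uses coordinatewise convergence. The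
backward law is irrelevant to forward functionals. -/
lemma tendsto_integral_tailProcess [IsProbabilityMeasure P] (hRV : RegVarTails P (X 0) α p)
    (hX : ∀ t, Measurable (X t)) (hΨ : Measurable (Function.uncurry Ψ)) (hA : Measurable A)
    (hlaw : P.map (fun ω (n : ℕ) => X n ω) =
      ((P.map (X 0)).prod (Measure.infinitePi fun _ : ℕ => ν)).map (fun z => recPath Ψ z.1 z.2))
    (hstep : ∀ᵐ v ∂ν, AsympStep p (Ψ · v) (A v))
    (hzero : (∀ᵐ v ∂ν, ∀ σ ∈ ({-1, 1} : Set ℝ), 0 < signWeight p σ → step σ (A v) ≠ 0) ∨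
        ∀ᵐ v ∂ν, LinearGrowth (Ψ · v))
    (hmem : MemClass p α (stepLaw p (ν.map A))) {H : (ℕ → ℝ) → ℝ} {C η : ℝ} (hη : 0 < η)
    (hH : Continuous H) (hC : ∀ m, |H m| ≤ C) (h0 : ∀ m, |m 0| ≤ η → H m = 0) :
    Tendsto (fun x => (∫ ω, H (fun n => X n ω / x) ∂P) / P.real {ω | x < |X 0 ω|}) atTop
      (𝓝 (∫ m, H (fun n => m n) ∂(tailProcess p α κ' (ν.map A)))) := by
  have hκ : IsProbabilityMeasure (ν.map A) := Measure.isProbabilityMeasure_map hA.aemeasurable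
  have hm : Measurable fun (m : ℤ → ℝ) (n : ℕ) => m n :=
    measurable_pi_lambda _ fun n => measurable_pi_apply _
  have hpm : Measurable fun z : ℝ × (ℕ → ℝ × ℝ) => path z.1 z.2 :=
    measurable_pi_lambda _ measurable_path
  have e : ∫ m, H (fun n => m n) ∂(tailProcess p α κ' (ν.map A)) =
      ∫ z, H (path z.1 z.2)
        ∂((signTail p α).prod (Measure.infinitePi fun _ : ℕ => ν.map A)) := by
    rw [← integral_map (f := H) hm.aemeasurable hH.measurable.aestronglyMeasurable,
      map_natCast_tailProcess, integral_map hpm.aemeasurable hH.measurable.aestronglyMeasurable]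
  rw [e]
  refine tendsto_integral_path hRV hX hΨ hA hlaw hη hH.measurable hC h0 ?_
  have hrel := ae_infinitePi_eval (ae_of_ae_map hA.aemeasurable (ae_relevant_step hmem))
  have hz : ∀ᵐ e ∂(Measure.infinitePi fun _ : ℕ => ν),
      (∀ n, ∀ σ ∈ ({-1, 1} : Set ℝ), 0 < signWeight p σ → step σ (A (e n)) ≠ 0) ∨
      ∀ n, LinearGrowth (Ψ · (e n)) := by
    rcases hzero with h | h
    · exact (ae_infinitePi_eval h).mono fun e he => Or.inl he
    · exact (ae_infinitePi_eval h).mono fun e he => Or.inr he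
  filter_upwards [ae_infinitePi_eval hstep, hrel, hz] with e h1 h2 h3 y hy hw
  refine (hH.tendsto _).comp (tendsto_pi_nhds.2 fun n => ?_)
  refine tendsto_recPath h1 h2 h3 tendsto_snd ?_ hy hw n
  refine (tendsto_fst (f := 𝓝 y) (g := (atTop : Filter ℝ))).congr' ?_
  filter_upwards [tendsto_snd.eventually (eventually_ne_atTop (0 : ℝ))] with z hz
  exact (mul_div_cancel_left₀ _ hz).symm

/-- Functionals of the two-sided sequence, seen from time `-k`. -/
lemma tendsto_integral_tailProcess_shift (hRV : RegVarTails P (X 0) α p) (hX : IsStationary P X)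
    (hadj : stepLaw p κ' = adjointLaw p α (stepLaw p (ν.map A)))
    (hA : Measurable A) (hmem : MemClass p α (stepLaw p (ν.map A)))
    (hlim : ∀ (H : (ℕ → ℝ) → ℝ) (C η : ℝ), 0 < η → Continuous H → (∀ m, |H m| ≤ C) →
      (∀ m, |m 0| ≤ η → H m = 0) →
      Tendsto (fun x => (∫ ω, H (fun n => X n ω / x) ∂P) / P.real {ω | x < |X 0 ω|}) atTop
        (𝓝 (∫ m, H (fun n => m n) ∂(tailProcess p α κ' (ν.map A)))))
    (k : ℕ) {H : (ℤ → ℝ) → ℝ} {C η : ℝ} (hη : 0 < η) (hH : Continuous H) (hC : ∀ m, |H m| ≤ C)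
    (h0 : ∀ m, |m 0| ≤ η ∨ |m (-k)| ≤ η → H m = 0)
    (hdep : ∀ m m' : ℤ → ℝ, (∀ j, -(k : ℤ) ≤ j → m j = m' j) → H m = H m') :
    Tendsto (fun x => (∫ ω, H (fun t => X t ω / x) ∂P) / P.real {ω | x < |X 0 ω|}) atTop
      (𝓝 (∫ m, H m ∂(tailProcess p α κ' (ν.map A)))) := by
  have hκ : IsProbabilityMeasure (ν.map A) := Measure.isProbabilityMeasure_map hA.aemeasurable
  have hα := hRV.index_pos
  -- A forward path is reread with its origin at time `-k`. The repeated values that `Int.toNat`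
  -- produces before `-k` do not matter by `hdep`.
  set T : (ℕ → ℝ) → ℤ → ℝ := fun m j => m (j + k).toNat with hT
  have hTc : Continuous T := continuous_pi fun j => continuous_apply _
  have hTe (m : ℤ → ℝ) : H (T fun n => m n) = H (fun j => m (j + k)) := by
    refine hdep _ _ fun j hj => ?_
    change m ((j + k).toNat : ℤ) = m (j + k)
    rw [Int.toNat_of_nonneg (by omega)]
  have h1 := hlim (fun m => H (T m)) C η hη (hH.comp hTc) (fun m => hC _) (fun m hm => h0 _ (by
    right
    change |m (-(k : ℤ) + k).toNat| ≤ η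
    simpa using hm))
  have h2 : ∫ m, H (T fun n => m n) ∂(tailProcess p α κ' (ν.map A)) =
      ∫ m, H m ∂(tailProcess p α κ' (ν.map A)) := by
    simp only [hTe]
    refine integral_tailProcess_shiftBy hα hmem hadj k hH.measurable (fun m hm => h0 m ?_)
      (integrable_tailProcess hα hRV.nonneg hRV.le_one hη hH.measurable hC
        fun m hm => h0 m (Or.inl hm))
    rcases hm with hm | hm
    · right; simpa [hm] using hη.le
    · left; simpa [hm] using hη.le
  rw [← h2]
  refine h1.congr fun x => ?_
  congr 1
  have hmx : Measurable fun m : ℤ → ℝ => H fun t => m t / x :=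
    hH.measurable.comp (measurable_pi_lambda _ fun n =>
      (measurable_pi_apply (X := fun _ : ℤ => ℝ) n).div_const x)
  rw [← hX.integral_shift hmx k]
  refine integral_congr_ae (.of_forall fun ω => ?_)
  exact hTe fun t => X t ω / x

end TwoSidedLimit

/-! ### Polar coordinates and continuous approximation -/

section Polar

variable {s t : ℕ}

/-- The modulus at time `0` and the coordinates from `-s` to `t` relative to it. -/
def polar (s t : ℕ) (m : ℤ → ℝ) : ℝ × (Fin (s + t + 1) → ℝ) :=
  (|m 0|, fun i => m ((i : ℤ) - s) / |m 0|)

lemma measurable_polar (s t : ℕ) : Measurable (polar s t) := by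
  have (j : ℤ) : Measurable fun m : ℤ → ℝ => m j := measurable_pi_apply j
  exact (this 0).norm.prodMk (measurable_pi_lambda _ fun i => (this _).div (this 0).norm)

/-- A continuous function that vanishes up to `1` and equals `1` from `1 + δ` on. -/
def cut (δ r : ℝ) : ℝ := min (max ((r - 1) / δ) 0) 1

/-- Soft thresholding at level `δ`. -/
def shrink (δ u : ℝ) : ℝ := u - max (-δ) (min u δ)

/-- The relative coordinates, continuously extended to small values at time `0`, thresholded
before time `0` and removed before time `-k`. -/
def coarse (s t : ℕ) (δ : ℝ) (k : ℕ) (m : ℤ → ℝ) (i : Fin (s + t + 1)) : ℝ :=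
  if (i : ℤ) - s < -k then 0
  else if (i : ℤ) - s < 0 then shrink δ (m ((i : ℤ) - s) / max |m 0| 1)
  else m ((i : ℤ) - s) / max |m 0| 1

/-- A continuous approximation of `f ∘ polar s t` on `{m | 1 < |m 0|}`. -/
def smooth (f : ℝ × (Fin (s + t + 1) → ℝ) → ℝ) (δ : ℝ) (k : ℕ) (m : ℤ → ℝ) : ℝ :=
  cut δ |m 0| * f (|m 0|, coarse s t δ k m)

variable {δ C : ℝ} {f : ℝ × (Fin (s + t + 1) → ℝ) → ℝ}

lemma cut_of_le (hδ : 0 < δ) {r : ℝ} (hr : r ≤ 1) : cut δ r = 0 := by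
  have : (r - 1) / δ ≤ 0 := div_nonpos_of_nonpos_of_nonneg (by linarith) hδ.le
  simp [cut, max_eq_right this]

lemma cut_of_ge (hδ : 0 < δ) {r : ℝ} (hr : 1 + δ ≤ r) : cut δ r = 1 := by
  have : 1 ≤ (r - 1) / δ := by rw [le_div_iff₀ hδ]; linarith
  exact min_eq_right (le_max_of_le_left this)

lemma cut_nonneg (δ r : ℝ) : 0 ≤ cut δ r := by unfold cut; positivity

lemma cut_le_one (δ r : ℝ) : cut δ r ≤ 1 := min_le_right _ _

lemma shrink_of_abs_le {u : ℝ} (hu : |u| ≤ δ) : shrink δ u = 0 := by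
  obtain ⟨h1, h2⟩ := abs_le.1 hu
  rw [shrink, min_eq_left h2, max_eq_right h1, sub_self]

lemma abs_shrink_sub_le (hδ : 0 < δ) (u : ℝ) : |u - shrink δ u| ≤ δ := by
  rw [shrink, sub_sub_cancel, abs_le]
  exact ⟨le_max_left _ _, max_le (by linarith) (min_le_right _ _)⟩

lemma continuous_coarse (s t : ℕ) (δ : ℝ) (k : ℕ) : Continuous (coarse s t δ k) := by
  have hq (j : ℤ) : Continuous fun m : ℤ → ℝ => m j / max |m 0| 1 :=
    (continuous_apply j).div₀ (by fun_prop) fun m => (lt_max_of_lt_right one_pos).ne'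
  have hs : Continuous (shrink δ) := by unfold shrink; fun_prop
  refine continuous_pi fun i => ?_
  unfold coarse
  split_ifs
  · exact continuous_const
  · exact hs.comp (hq _)
  · exact hq _

lemma continuous_smooth (hf : Continuous f) (k : ℕ) : Continuous (smooth f δ k) := by
  have h0 : Continuous fun m : ℤ → ℝ => |m 0| := by fun_prop
  have hc : Continuous (cut δ) := by unfold cut; fun_prop
  exact (hc.comp h0).mul (hf.comp (h0.prodMk (continuous_coarse s t δ k)))

lemma abs_smooth_le (hC : ∀ z, |f z| ≤ C) (k : ℕ) (m : ℤ → ℝ) : |smooth f δ k m| ≤ C := by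
  rw [smooth, abs_mul, abs_of_nonneg (cut_nonneg _ _)]
  calc _ ≤ 1 * C := mul_le_mul (cut_le_one _ _) (hC _) (abs_nonneg _) zero_le_one
    _ = C := one_mul C

lemma smooth_eq_zero (hδ : 0 < δ) (k : ℕ) {m : ℤ → ℝ} (hm : |m 0| ≤ 1) : smooth f δ k m = 0 := by
  rw [smooth, cut_of_le hδ hm, zero_mul]

lemma smooth_congr (k : ℕ) {m m' : ℤ → ℝ} (h : ∀ j, -(k : ℤ) ≤ j → m j = m' j) :
    smooth f δ k m = smooth f δ k m' := by
  have h0 := h 0 (by omega)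
  have : coarse s t δ k m = coarse s t δ k m' := by
    ext i
    unfold coarse
    split_ifs with h1 h2
    · rfl
    · rw [h _ (by omega), h0]
    · rw [h _ (by omega), h0]
  rw [smooth, smooth, this, h0]

/-- The divisor is at least `1`, so a value of modulus at most `δ` is thresholded to zero, which is
also what removing the coordinate gives. -/
lemma smooth_succ_eq (k : ℕ) {m : ℤ → ℝ} (hm : |m (-((k + 1 : ℕ) : ℤ))| ≤ δ) :
    smooth f δ (k + 1) m = smooth f δ k m := by
  have hM : (1 : ℝ) ≤ max |m 0| 1 := le_max_right _ _
  have : coarse s t δ (k + 1) m = coarse s t δ k m := by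
    ext i
    by_cases hi : (i : ℤ) - s = -((k + 1 : ℕ) : ℤ)
    · have h1 : ¬ (i : ℤ) - s < -((k + 1 : ℕ) : ℤ) := by omega
      have h2 : (i : ℤ) - s < 0 := by omega
      have h3 : (i : ℤ) - s < -(k : ℤ) := by omega
      rw [coarse, coarse, if_neg h1, if_pos h2, if_pos h3, hi, shrink_of_abs_le]
      rw [abs_div, abs_of_pos (zero_lt_one.trans_le hM)]
      exact (div_le_self (abs_nonneg _) hM).trans hm
    · have : (i : ℤ) - s < -((k + 1 : ℕ) : ℤ) ↔ (i : ℤ) - s < -(k : ℤ) := by omega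
      simp only [coarse, this]
  rw [smooth, smooth, this]

/-- Induction on the number of past coordinates admitted. With none, only the future matters. The
difference between stages `k + 1` and `k` vanishes when the value at `0` or at `-(k + 1)` is small,
so it is an admissible functional for the two-sided limit. -/
lemma tendsto_integral_smooth {Ω : Type*} [MeasurableSpace Ω] {P : Measure Ω}
    [IsProbabilityMeasure P] {X : ℤ → Ω → ℝ} {ρ : Measure (ℤ → ℝ)} {D : ℝ → ℝ}
    (hX : ∀ t, Measurable (X t))
    (hint : ∀ (H : (ℤ → ℝ) → ℝ) (C : ℝ), Measurable H → (∀ m, |H m| ≤ C) →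
      (∀ m, |m 0| ≤ 1 → H m = 0) → Integrable H ρ)
    (hlim : ∀ (k : ℕ) (H : (ℤ → ℝ) → ℝ) (C η : ℝ), 0 < η → Continuous H → (∀ m, |H m| ≤ C) →
      (∀ m, |m 0| ≤ η ∨ |m (-k)| ≤ η → H m = 0) →
      (∀ m m' : ℤ → ℝ, (∀ j, -(k : ℤ) ≤ j → m j = m' j) → H m = H m') →
      Tendsto (fun x => (∫ ω, H (fun t => X t ω / x) ∂P) / D x) atTop (𝓝 (∫ m, H m ∂ρ)))
    (hδ : 0 < δ) (hf : Continuous f) (hC : ∀ z, |f z| ≤ C) (k : ℕ) :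
    Tendsto (fun x => (∫ ω, smooth f δ k (fun t => X t ω / x) ∂P) / D x) atTop
      (𝓝 (∫ m, smooth f δ k m ∂ρ)) := by
  induction k with
  | zero =>
    refine hlim 0 _ C 1 one_pos (continuous_smooth hf 0) (abs_smooth_le hC 0) (fun m hm => ?_)
      fun m m' h => smooth_congr 0 h
    refine smooth_eq_zero hδ 0 ?_
    simpa using hm
  | succ k ih =>
    have hcont := continuous_smooth (δ := δ) hf
    have hi (k : ℕ) : Integrable (smooth f δ k) ρ :=
      hint _ C (hcont k).measurable (abs_smooth_le hC k) fun m hm => smooth_eq_zero hδ k hm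
    have hiP (k : ℕ) (x : ℝ) : Integrable (fun ω => smooth f δ k (fun t => X t ω / x)) P := by
      refine Integrable.of_bound (C := C) ?_ (.of_forall fun ω => abs_smooth_le hC k _)
      exact ((hcont k).measurable.comp
        (measurable_pi_lambda _ fun t => (hX t).div_const x)).aestronglyMeasurable
    have hdiff := hlim (k + 1) (fun m => smooth f δ (k + 1) m - smooth f δ k m) (C + C) (min 1 δ)
      (by positivity) ((hcont (k + 1)).sub (hcont k))
      (fun m => (abs_sub _ _).trans (add_le_add (abs_smooth_le hC _ _) (abs_smooth_le hC _ _)))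
      (fun m hm => by
        rcases hm with hm | hm
        · have := hm.trans (min_le_left _ _)
          rw [smooth_eq_zero hδ _ this, smooth_eq_zero hδ _ this, sub_zero]
        · rw [smooth_succ_eq k (hm.trans (min_le_right _ _)), sub_self])
      (fun m m' h => by
        rw [smooth_congr (k + 1) h, smooth_congr k fun j hj => h j (by push_cast; omega)])
    have hsum := hdiff.add ih
    rw [integral_sub (hi _) (hi _), sub_add_cancel] at hsum
    refine hsum.congr fun x => ?_
    rw [integral_sub (hiP _ _) (hiP _ _), ← add_div, sub_add_cancel]

/-- At stage `s` no coordinate is removed, and thresholding moves each by at most `δ`, at a cost of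
`L * δ`. The cut-off differs from `1` only where `|m 0| ≤ 1 + δ`, at a cost of `C` times the
probability of that event. -/
lemma abs_integral_polar_sub_smooth_le {ν : Measure (ℤ → ℝ)} [IsProbabilityMeasure ν]
    (hν : ∀ᵐ m ∂ν, 1 < |m 0|) {L : NNReal} (hf : LipschitzWith L f) (hC : ∀ z, |f z| ≤ C)
    (hδ : 0 < δ) :
    |∫ m, f (polar s t m) ∂ν - ∫ m, smooth f δ s m ∂ν| ≤
      L * δ + C * (1 - ν.real {m | 1 + δ < |m 0|}) := by
  have hC0 : 0 ≤ C := (abs_nonneg _).trans (hC 0)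
  have hS : MeasurableSet {m : ℤ → ℝ | 1 + δ < |m 0|} :=
    measurableSet_lt measurable_const (measurable_pi_apply (X := fun _ : ℤ => ℝ) 0).norm
  have h1 : Integrable (fun m => f (polar s t m)) ν :=
    Integrable.of_bound (C := C)
      (hf.continuous.measurable.comp (measurable_polar s t)).aestronglyMeasurable
      (.of_forall fun m => hC _)
  have h2 : Integrable (fun m => smooth f δ s m) ν :=
    Integrable.of_bound (C := C) (continuous_smooth hf.continuous s).aestronglyMeasurable
      (.of_forall fun m => abs_smooth_le hC s m)
  have hSc : ν.real {m | 1 + δ < |m 0|}ᶜ = 1 - ν.real {m | 1 + δ < |m 0|} := by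
    rw [measureReal_compl hS, probReal_univ]
  rw [← integral_sub h1 h2, ← hSc]
  have hi : Integrable (({m : ℤ → ℝ | 1 + δ < |m 0|}ᶜ).indicator fun _ => C) ν :=
    (integrable_const _).indicator hS.compl
  have e : ∫ m, (L * δ + ({m : ℤ → ℝ | 1 + δ < |m 0|}ᶜ).indicator (fun _ => C) m) ∂ν =
      L * δ + C * ν.real {m | 1 + δ < |m 0|}ᶜ := by
    rw [integral_add (integrable_const _) hi, integral_indicator hS.compl]
    simp only [integral_const, smul_eq_mul, probReal_univ, one_mul,
      measureReal_restrict_apply_univ]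
    ring
  rw [← e, ← Real.norm_eq_abs]
  refine norm_integral_le_of_norm_le ((integrable_const _).add hi) ?_
  filter_upwards [hν] with m hm
  have hclose : |f (polar s t m) - f (|m 0|, coarse s t δ s m)| ≤ L * δ := by
    have h3 := hf.dist_le_mul (polar s t m) (|m 0|, coarse s t δ s m)
    rw [Real.dist_eq] at h3
    refine h3.trans (mul_le_mul_of_nonneg_left ?_ L.2)
    rw [Prod.dist_eq]
    refine max_le (by simp [polar, hδ.le]) ((dist_pi_le_iff hδ.le).2 fun i => ?_)
    change |m ((i : ℤ) - s) / |m 0| - coarse s t δ s m i| ≤ δ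
    have hi1 : ¬ (i : ℤ) - s < -(s : ℤ) := by omega
    rw [coarse, if_neg hi1, max_eq_left hm.le]
    split_ifs
    · exact abs_shrink_sub_le hδ _
    · simpa using hδ.le
  rw [Real.norm_eq_abs]
  by_cases hmS : 1 + δ < |m 0|
  · rw [Set.indicator_of_notMem (by exact fun h => h hmS), add_zero, smooth,
      cut_of_ge hδ hmS.le, one_mul]
    exact hclose
  · rw [Set.indicator_of_mem (by exact hmS), smooth]
    set c := cut δ |m 0|
    have hc0 : 0 ≤ c := cut_nonneg _ _
    have hc1 : c ≤ 1 := cut_le_one _ _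
    set u := f (polar s t m)
    set v := f (|m 0|, coarse s t δ s m)
    have hLδ : 0 ≤ L * δ := mul_nonneg L.2 hδ.le
    calc |u - c * v| = |c * (u - v) + (1 - c) * u| := by ring_nf
      _ ≤ |c * (u - v)| + |(1 - c) * u| := abs_add_le _ _
      _ = c * |u - v| + (1 - c) * |u| := by
        rw [abs_mul, abs_mul, abs_of_nonneg hc0, abs_of_nonneg (sub_nonneg.2 hc1)]
      _ ≤ 1 * (L * δ) + 1 * C := by
        gcongr
        · linarith
        · exact hC _
      _ = L * δ + C := by ring

end Polar

/-! ### Identification of the limiting joint law -/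

section TailLimit

variable {p α : ℝ}

/-- The joint law of the limit in terms of the laws of the windows of the chain. -/
lemma IsTailLimit.map_eq_prod {Ω : Type*} [MeasurableSpace Ω] {P : Measure Ω}
    [IsProbabilityMeasure P] (hα : 0 < α) {μ : Measure (ℝ × ℝ)} {Y : Ω → ℝ} {M : ℤ → Ω → ℝ}
    (h : IsTailLimit p α μ P Y M) (s t : ℕ) :
    P.map (fun ω => (Y ω, fun i : Fin (s + t + 1) => M ((i : ℤ) - s) ω)) =
      (TailChain.pareto α).prod
        ((P.map fun ω => window (Finset.Icc (-s : ℤ) t) fun i => M i ω).map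
          fun w (i : Fin (s + t + 1)) => w ((i : ℤ) - s)) := by
  have hr : Measurable fun (w : ℤ → ℝ) (i : Fin (s + t + 1)) => w ((i : ℤ) - s) :=
    measurable_pi_lambda _ fun i => measurable_pi_apply _
  have hM : Measurable fun ω (t : ℤ) => M t ω := measurable_pi_lambda _ h.bftc.measurable
  have hW : Measurable fun ω => window (Finset.Icc (-s : ℤ) t) fun i => M i ω :=
    (measurable_window _).comp hM
  have hMr : Measurable fun ω (i : Fin (s + t + 1)) => M ((i : ℤ) - s) ω :=
    measurable_pi_lambda _ fun i => h.bftc.measurable _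
  have hind : IndepFun Y (fun ω (i : Fin (s + t + 1)) => M ((i : ℤ) - s) ω) P :=
    h.indep.comp measurable_id hr
  have hY : P.map Y = TailChain.pareto α := by
    have := Measure.isProbabilityMeasure_map (μ := P) h.measurable.aemeasurable
    refine eq_pareto hα fun y hy => ?_
    rw [Measure.map_apply h.measurable measurableSet_Ioi]
    exact h.pareto y hy
  rw [(indepFun_iff_map_prod_eq_prod_map_map h.measurable.aemeasurable hMr.aemeasurable).1 hind,
    hY, Measure.map_map hr hW]
  congr 2
  ext ω i
  change M ((i : ℤ) - s) ω = window (Finset.Icc (-s : ℤ) t) (fun t => M t ω) ((i : ℤ) - s)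
  rw [window, if_pos]
  rw [Finset.mem_Icc]
  omega

/-- The joint law of the limit is determined by the parameters. -/
lemma IsTailLimit.map_eq {Ω Ω' : Type*} [MeasurableSpace Ω] [MeasurableSpace Ω'] {P : Measure Ω}
    {P' : Measure Ω'} [IsProbabilityMeasure P] [IsProbabilityMeasure P'] (hα : 0 < α) (h0 : 0 ≤ p)
    (h1 : p ≤ 1) {μ : Measure (ℝ × ℝ)} {Y : Ω → ℝ} {Y' : Ω' → ℝ} {M : ℤ → Ω → ℝ} {M' : ℤ → Ω' → ℝ}
    (h : IsTailLimit p α μ P Y M) (h' : IsTailLimit p α μ P' Y' M') (s t : ℕ) :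
    P.map (fun ω => (Y ω, fun i : Fin (s + t + 1) => M ((i : ℤ) - s) ω)) =
      P'.map (fun ω => (Y' ω, fun i : Fin (s + t + 1) => M' ((i : ℤ) - s) ω)) := by
  rw [h.map_eq_prod hα, h'.map_eq_prod hα, h.bftc.map_window_eq hα h0 h1 h'.bftc]

variable {κ' κ : Measure (ℝ × ℝ)} [IsProbabilityMeasure κ'] [IsProbabilityMeasure κ]

/-- The radius is positive and the chain has modulus one at time `0`, so `polar` recovers both
factors of the scaled chain. -/
lemma map_canonLaw_eq_polar (hα : 0 < α) (h0 : 0 ≤ p) (h1 : p ≤ 1) (s t : ℕ) :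
    (canonLaw p α κ' κ).map
        (fun ω => (ω.1.1, fun i : Fin (s + t + 1) => canonChain ((i : ℤ) - s) ω)) =
      ((tailProcess p α κ' κ).restrict {m | 1 < |m 0|}).map (polar s t) := by
  have := isProbabilityMeasure_signMeasure h0 h1
  have := isProbabilityMeasure_pareto hα
  have hM : Measurable fun (ω : (ℝ × ℝ) × ((ℕ → ℝ × ℝ) × (ℕ → ℝ × ℝ))) (t : ℤ) =>
      ω.1.1 * canonChain t ω :=
    measurable_pi_lambda _ fun t => (by fun_prop : Measurable fun
      ω : (ℝ × ℝ) × ((ℕ → ℝ × ℝ) × (ℕ → ℝ × ℝ)) => ω.1.1).mul (measurable_canonChain t)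
  rw [← map_canonLaw_mul h0 h1, Measure.map_map (measurable_polar s t) hM]
  refine Measure.map_congr ?_
  have hpos : ∀ᵐ y ∂(pareto α), 0 < y :=
    (ae_restrict_mem measurableSet_Ioi).mono fun y hy => zero_lt_one.trans hy
  have habs : ∀ᵐ i ∂(signMeasure p), |i| = 1 := by
    rw [ae_signMeasure]
    rintro σ (rfl | rfl) _ <;> simp
  have h2 : ∀ᵐ ω ∂(canonLaw p α κ' κ), 0 < ω.1.1 ∧ |ω.1.2| = 1 :=
    Measure.quasiMeasurePreserving_fst.ae (p := fun q : ℝ × ℝ => 0 < q.1 ∧ |q.2| = 1)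
      ((Measure.quasiMeasurePreserving_fst.ae hpos).and
        (Measure.quasiMeasurePreserving_snd.ae habs))
  filter_upwards [h2] with ω hω
  have h3 : |ω.1.1 * canonChain 0 ω| = ω.1.1 := by
    change |ω.1.1 * ω.1.2| = ω.1.1
    rw [abs_mul, hω.2, mul_one, abs_of_pos hω.1]
  refine Prod.ext h3.symm (funext fun i => ?_)
  change _ = ω.1.1 * canonChain _ ω / |ω.1.1 * canonChain 0 ω|
  rw [h3, mul_div_cancel_left₀ _ hω.1.ne']

end TailLimit

/-! ### From approximations to conditional laws -/

section WeakLimit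

variable {s t : ℕ} {f : ℝ × (Fin (s + t + 1) → ℝ) → ℝ} {C α : ℝ}

lemma tendsto_integral_polar {ν : ℝ → Measure (ℤ → ℝ)} {ρ : Measure (ℤ → ℝ)}
    [∀ x, IsProbabilityMeasure (ν x)] [IsProbabilityMeasure ρ]
    (hν : ∀ᶠ x in atTop, ∀ᵐ m ∂(ν x), 1 < |m 0|) (hρ : ∀ᵐ m ∂ρ, 1 < |m 0|)
    {L : NNReal} (hf : LipschitzWith L f) (hC : ∀ z, |f z| ≤ C)
    (hsmooth : ∀ δ > 0, Tendsto (fun x => ∫ m, smooth f δ s m ∂(ν x)) atTop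
      (𝓝 (∫ m, smooth f δ s m ∂ρ)))
    (htail : ∀ δ : ℝ, 0 < δ → Tendsto (fun x => (ν x).real {m | 1 + δ < |m 0|}) atTop
      (𝓝 ((1 + δ) ^ (-α))))
    (hρtail : ∀ δ : ℝ, 0 < δ → ρ.real {m | 1 + δ < |m 0|} = (1 + δ) ^ (-α)) :
    Tendsto (fun x => ∫ m, f (polar s t m) ∂(ν x)) atTop (𝓝 (∫ m, f (polar s t m) ∂ρ)) := by
  rw [Metric.tendsto_nhds]
  intro ε hε
  -- One `δ` serves for the limit and for all large `x`, because the probabilities in the error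
  -- bounds converge to `(1 + δ) ^ (-α)`, which tends to `1` as `δ` decreases to `0`.
  obtain ⟨δ, hδε, hδ⟩ : ∃ δ : ℝ, L * δ + C * (1 - (1 + δ) ^ (-α)) < ε / 3 ∧ 0 < δ := by
    have hc : ContinuousAt (fun δ : ℝ => L * δ + C * (1 - (1 + δ) ^ (-α))) 0 := by
      refine ContinuousAt.add (by fun_prop) (continuousAt_const.mul (continuousAt_const.sub ?_))
      exact (by fun_prop : ContinuousAt (fun δ : ℝ => 1 + δ) 0).rpow_const (Or.inl (by simp))
    have h0 : L * (0 : ℝ) + C * (1 - (1 + 0) ^ (-α)) < ε / 3 := by simp; positivity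
    exact ((hc.eventually_lt_const h0).filter_mono nhdsWithin_le_nhds
      |>.and self_mem_nhdsWithin : ∀ᶠ δ in 𝓝[>] (0 : ℝ), _).exists
  have h1 : Tendsto (fun x => L * δ + C * (1 - (ν x).real {m | 1 + δ < |m 0|})) atTop
      (𝓝 (L * δ + C * (1 - (1 + δ) ^ (-α)))) :=
    (((htail δ hδ).const_sub 1).const_mul C).const_add _
  have h2 := abs_integral_polar_sub_smooth_le hρ hf hC hδ
  rw [hρtail δ hδ] at h2
  filter_upwards [hν, h1.eventually_lt_const hδε,
    Metric.tendsto_nhds.1 (hsmooth δ hδ) (ε / 3) (by positivity)] with x hx hx1 hx2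
  have h3 := abs_integral_polar_sub_smooth_le hx hf hC hδ
  rw [Real.dist_eq] at hx2 ⊢
  rw [abs_le] at h2 h3
  rw [abs_lt] at hx2 ⊢
  constructor <;> linarith [h2.1, h2.2, h3.1, h3.2, hx2.1, hx2.2]

variable {Ω : Type*} [MeasurableSpace Ω] {P : Measure Ω} {X : ℤ → Ω → ℝ}

/-- The conditional law of the scaled process. -/
def scaledLaw (P : Measure Ω) (X : ℤ → Ω → ℝ) (x : ℝ) : Measure (ℤ → ℝ) :=
  (P[|{ω | x < |X 0 ω|}]).map (fun ω t => X t ω / x)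

/-- For test functions vanishing when `|m 0| ≤ 1`, conditioning on `|X 0| > x` is just division by
its probability. Vague limits thus become limits of conditional means. -/
lemma integral_scaledLaw (hX : ∀ t, Measurable (X t)) {x : ℝ} (hx : 0 < x) {H : (ℤ → ℝ) → ℝ}
    (hH : Measurable H) (h0 : ∀ m, |m 0| ≤ 1 → H m = 0) :
    ∫ m, H m ∂(scaledLaw P X x) =
      (∫ ω, H (fun t => X t ω / x) ∂P) / P.real {ω | x < |X 0 ω|} := by
  have hm : Measurable fun ω (t : ℤ) => X t ω / x :=
    measurable_pi_lambda _ fun t => (hX t).div_const x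
  rw [scaledLaw, integral_map hm.aemeasurable hH.aestronglyMeasurable, ProbabilityTheory.cond,
    integral_smul_measure, setIntegral_eq_integral_of_forall_compl_eq_zero, ENNReal.toReal_inv,
    smul_eq_mul, ← measureReal_def, inv_mul_eq_div]
  intro ω hω
  refine h0 _ ?_
  have : |X 0 ω| ≤ x := not_lt.1 hω
  rwa [abs_div, abs_of_pos hx, div_le_one hx]

lemma map_polar_scaledLaw (hX : ∀ t, Measurable (X t)) {x : ℝ} (hx : 0 < x) (s t : ℕ) :
    (conditionalLaw P X s t x : Measure (ℝ × (Fin (s + t + 1) → ℝ))) =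
      (scaledLaw P X x).map (polar s t) := by
  have hm : Measurable fun ω (t : ℤ) => X t ω / x :=
    measurable_pi_lambda _ fun t => (hX t).div_const x
  rw [scaledLaw, Measure.map_map (measurable_polar s t) hm]
  change Measure.map _ _ = _
  congr 1
  ext1 ω
  have : |X 0 ω / x| = |X 0 ω| / x := by rw [abs_div, abs_of_pos hx]
  refine Prod.ext this.symm (funext fun i => ?_)
  change _ = X _ ω / x / |X 0 ω / x|
  rw [this, div_div_div_cancel_right₀ hx.ne']

lemma scaledLaw_real_abs_gt (hX : ∀ t, Measurable (X t)) {x : ℝ} (hx : 0 < x) {r : ℝ}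
    (hr : 1 ≤ r) : (scaledLaw P X x).real {m | r < |m 0|} =
      P.real {ω | x * r < |X 0 ω|} / P.real {ω | x < |X 0 ω|} := by
  have hm : Measurable fun ω (t : ℤ) => X t ω / x :=
    measurable_pi_lambda _ fun t => (hX t).div_const x
  have hS : MeasurableSet {m : ℤ → ℝ | r < |m 0|} :=
    measurableSet_lt measurable_const (measurable_pi_apply (X := fun _ : ℤ => ℝ) 0).norm
  have hS' : MeasurableSet {ω | x < |X 0 ω|} := measurableSet_lt measurable_const (hX 0).norm
  have e : {ω | x < |X 0 ω|} ∩ (fun ω (t : ℤ) => X t ω / x) ⁻¹' {m : ℤ → ℝ | r < |m 0|} =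
      {ω | x * r < |X 0 ω|} := by
    ext ω
    change (x < |X 0 ω| ∧ r < |X 0 ω / x|) ↔ x * r < |X 0 ω|
    rw [abs_div, abs_of_pos hx, lt_div_iff₀ hx, mul_comm r]
    refine ⟨fun h => h.2, fun h => ⟨lt_of_le_of_lt ?_ h, h⟩⟩
    exact le_mul_of_one_le_right hx.le hr
  rw [scaledLaw, map_measureReal_apply hm hS, measureReal_def, cond_apply hS', ENNReal.toReal_mul,
    ENNReal.toReal_inv, e, inv_mul_eq_div]
  rfl

end WeakLimit

/-! ### Existence of the model and convergence -/

section Main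

variable {S : Type*} [MeasurableSpace S] {Ψ : ℝ → S → ℝ} {ν : Measure S} [IsProbabilityMeasure ν]
  {Ω : Type*} [MeasurableSpace Ω] {P : Measure Ω} [IsProbabilityMeasure P] {X : ℤ → Ω → ℝ}
  {α p : ℝ} {φ : S → ℝ → ℝ}

/-- Weak convergence of finite measures of mass one, tested with Lipschitz functions. -/
lemma tendsto_finiteMeasure_of_lipschitz {E : Type*} [PseudoEMetricSpace E] [MeasurableSpace E]
    [OpensMeasurableSpace E] {μs : ℝ → FiniteMeasure E} {μ : FiniteMeasure E}
    (hs : ∀ x, IsProbabilityMeasure (μs x : Measure E)) (hμ : IsProbabilityMeasure (μ : Measure E))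
    (h : ∀ (f : E → ℝ) (C : ℝ) (L : NNReal), (∀ z, |f z| ≤ C) → LipschitzWith L f →
      Tendsto (fun x => ∫ z, f z ∂(μs x : Measure E)) atTop (𝓝 (∫ z, f z ∂(μ : Measure E)))) :
    Tendsto μs atTop (𝓝 μ) := by
  let ρs : ℝ → ProbabilityMeasure E := fun x => ⟨μs x, hs x⟩
  let ρ : ProbabilityMeasure E := ⟨μ, hμ⟩
  have key : Tendsto ρs atTop (𝓝 ρ) := by
    rw [tendsto_iff_forall_lipschitz_integral_tendsto]
    rintro f ⟨C, hC⟩ ⟨L, hL⟩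
    obtain ⟨z₀⟩ := nonempty_of_isProbabilityMeasure (μ : Measure E)
    refine h f (C + |f z₀|) L (fun z => ?_) hL
    have := hC z z₀
    rw [Real.dist_eq] at this
    calc |f z| = |(f z - f z₀) + f z₀| := by ring_nf
      _ ≤ |f z - f z₀| + |f z₀| := abs_add_le _ _
      _ ≤ _ := by linarith
  exact (ProbabilityMeasure.tendsto_nhds_iff_toFiniteMeasure_tendsto_nhds _).1 key

/-- The canonical model of the tail process exists and governs all limits of conditional laws. -/
lemma exists_canonical_limit (hX : IsStationary P X) (hRV : RegVarTails P (X 0) α p)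
    (hΨ : Measurable (Function.uncurry Ψ))
    (hlaw : P.map (fun ω (n : ℕ) => X n ω) =
      ((P.map (X 0)).prod (Measure.infinitePi fun _ : ℕ => ν)).map (fun z => recPath Ψ z.1 z.2))
    (hφ : LinearAtInfinity Ψ ν p φ) :
    ∃ (κ' κ : Measure (ℝ × ℝ)) (_ : IsProbabilityMeasure κ') (_ : IsProbabilityMeasure κ),
      IsTailLimit p α (forwardLaw p ν φ) (canonLaw p α κ' κ) (fun ω => ω.1.1) canonChain ∧
      ∀ (s t : ℕ) (f : ℝ × (Fin (s + t + 1) → ℝ) → ℝ) (C : ℝ) (L : NNReal), (∀ z, |f z| ≤ C) →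
        LipschitzWith L f → Tendsto (fun x => ∫ z, f z ∂(conditionalLaw P X s t x : Measure _))
          atTop (𝓝 (∫ m, f (polar s t m) ∂((tailProcess p α κ' κ).restrict {m | 1 < |m 0|}))) := by
  have hα := hRV.index_pos
  have h0 := hRV.nonneg
  have h1 := hRV.le_one
  obtain ⟨A, hA, hforward, hstep, hzero⟩ := hφ.exists_multiplier hΨ
  have hκ : IsProbabilityMeasure (ν.map A) := Measure.isProbabilityMeasure_map hA.aemeasurable
  have hmem := memClass_stepLaw hRV hX hΨ hA hlaw hstep
  have hadj := isAdjoint_adjointLaw hα h0 h1 hmem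
  have hκ' := hadj.mem_right.isProbabilityMeasure_multiplierPair
  have hκ'eq := hadj.mem_right.stepLaw_multiplierPair h0 h1
  -- The backward multipliers are chosen so that one backward step has the adjoint law.
  set κ' := multiplierPair p (adjointLaw p α (stepLaw p (ν.map A)))
  refine ⟨κ', ν.map A, hκ', hκ, ?_, fun s t f C L hC hL => ?_⟩
  · rw [hforward]
    exact isTailLimit_canon hα h0 h1 (by rw [hκ'eq]; exact hadj)
  set ρ := (tailProcess p α κ' (ν.map A)).restrict {m | 1 < |m 0|} with hρ
  have hS (r : ℝ) : MeasurableSet {m : ℤ → ℝ | r < |m 0|} :=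
    measurableSet_lt measurable_const (measurable_pi_apply (X := fun _ : ℤ => ℝ) 0).norm
  have hρtail (r : ℝ) (hr : 1 ≤ r) : ρ {m | r < |m 0|} = ENNReal.ofReal (r ^ (-α)) := by
    rw [hρ, Measure.restrict_apply (hS r), Set.inter_eq_left.2, tailProcess_abs_gt hα h0 h1
      (by linarith)]
    exact fun m (hm : r < |m 0|) => lt_of_le_of_lt hr hm
  have hρprob : IsProbabilityMeasure ρ :=
    ⟨by rw [hρ, Measure.restrict_apply_univ, tailProcess_abs_gt hα h0 h1 one_pos]; simp⟩
  have hvague := tendsto_integral_tailProcess_shift (κ' := κ') hRV hX hκ'eq hA hmem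
    fun H C η hη hH hC h0 =>
      tendsto_integral_tailProcess hRV hX.measurable hΨ hA hlaw hstep hzero hmem hη hH hC h0
  have hpos (x : ℝ) : P {ω | x < |X 0 ω|} ≠ 0 := fun h => by
    have := hRV.tail_pos x
    rw [measureReal_def, h] at this
    simp at this
  have hprob (x : ℝ) : IsProbabilityMeasure (scaledLaw P X x) := by
    have := cond_isProbabilityMeasure (hpos x)
    exact Measure.isProbabilityMeasure_map
      (measurable_pi_lambda _ fun t => (hX.measurable t).div_const x).aemeasurable
  have hlim := tendsto_integral_polar (ν := scaledLaw P X) (ρ := ρ) (α := α) ?_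
    (ae_restrict_mem (hS 1)) hL hC ?_ ?_ ?_
  · refine hlim.congr' ?_
    filter_upwards [eventually_gt_atTop 0] with x hx
    rw [map_polar_scaledLaw hX.measurable hx, integral_map (measurable_polar s t).aemeasurable
      hL.continuous.aestronglyMeasurable]
  · filter_upwards [eventually_gt_atTop 0] with x hx
    have h2 := scaledLaw_real_abs_gt (P := P) hX.measurable hx le_rfl
    rw [mul_one, div_self (hRV.tail_pos x).ne'] at h2
    refine (mem_ae_iff_prob_eq_one (hS 1)).2 ?_
    rwa [measureReal_def, ENNReal.toReal_eq_one_iff] at h2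
  · intro δ hδ
    have hcont : Continuous (smooth f δ s) := continuous_smooth hL.continuous s
    have h2 := tendsto_integral_smooth (P := P) (ρ := tailProcess p α κ' (ν.map A))
      (D := fun x => P.real {ω | x < |X 0 ω|}) hX.measurable
      (fun H C hH hC hH0 => integrable_tailProcess hα h0 h1 one_pos hH hC hH0)
      (fun k H C η hη hH hC hH0 hdep => hvague k hη hH hC hH0 hdep) hδ hL.continuous hC s
    -- The restriction to `|m 0| > 1` is invisible to `smooth`, which vanishes on the complement.
    have h3 : ∫ m, smooth f δ s m ∂ρ = ∫ m, smooth f δ s m ∂(tailProcess p α κ' (ν.map A)) :=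
      setIntegral_eq_integral_of_forall_compl_eq_zero fun m hm =>
        smooth_eq_zero hδ s (not_lt.1 hm)
    rw [h3]
    refine h2.congr' ?_
    filter_upwards [eventually_gt_atTop 0] with x hx
    exact (integral_scaledLaw hX.measurable hx hcont.measurable
      fun m hm => smooth_eq_zero hδ s hm).symm
  · intro δ hδ
    refine (hRV.tendsto_ratio (1 + δ) (by linarith)).congr' ?_
    filter_upwards [eventually_gt_atTop 0] with x hx
    rw [scaledLaw_real_abs_gt hX.measurable hx (by linarith)]
  · intro δ hδ
    rw [measureReal_def, hρtail _ (by linarith), ENNReal.toReal_ofReal (by positivity)]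

end Main

end TailChain

end

theorem theoremT {S : Type*} [MeasurableSpace S] (Ψ : ℝ → S → ℝ)
    -- the one-sided recursive chain
    {Ω₀ : Type*} [MeasurableSpace Ω₀] (P₀ : Measure Ω₀) [IsProbabilityMeasure P₀]
    (Z : ℕ → Ω₀ → ℝ) (ε : ℕ → Ω₀ → S) (hZ : TailChain.IsRecursiveChain Ψ P₀ Z ε)
    -- the two-sided stationary chain whose law is determined by the recursion
    {Ω : Type*} [MeasurableSpace Ω] (P : Measure Ω) [IsProbabilityMeasure P]
    (X : ℤ → Ω → ℝ) (hX : TailChain.IsStationary P X)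
    (hXZ : P.map (fun ω (n : ℕ) => X n ω) = P₀.map (fun ω (n : ℕ) => Z n ω))
    -- the tail conditions
    (α p : ℝ) (hRV : TailChain.RegVarTails P (X 0) α p)
    (φ : S → ℝ → ℝ) (hφ : TailChain.LinearAtInfinity Ψ (P₀.map (ε 0)) p φ) :
    -- a limit process exists
    (∃ (Ω' : Type) (_ : MeasurableSpace Ω') (P' : Measure Ω') (_ : IsProbabilityMeasure P')
      (Y : Ω' → ℝ) (M : ℤ → Ω' → ℝ),
      TailChain.IsTailLimit p α (TailChain.forwardLaw p (P₀.map (ε 0)) φ) P' Y M) ∧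
    -- and every such process is the weak limit
    (∀ {Ω' : Type*} [MeasurableSpace Ω'] (P' : Measure Ω') [IsProbabilityMeasure P']
      (Y : Ω' → ℝ) (M : ℤ → Ω' → ℝ),
      TailChain.IsTailLimit p α (TailChain.forwardLaw p (P₀.map (ε 0)) φ) P' Y M →
      ∀ s t : ℕ, Tendsto (TailChain.conditionalLaw P X s t) atTop
        (𝓝 (TailChain.jointLaw P' Y M s t))) := by
  have hν : IsProbabilityMeasure (P₀.map (ε 0)) :=
    Measure.isProbabilityMeasure_map (hZ.measurable_innov 0).aemeasurable
  have hZm (n : ℕ) : Measurable (Z n) := by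
    induction n with
    | zero => exact hZ.measurable_init
    | succ n ih =>
      rw [funext (hZ.recursion n)]
      exact hZ.measurable_map.comp (ih.prodMk (hZ.measurable_innov n))
  have hinit : P₀.map (Z 0) = P.map (X 0) := by
    have := congrArg (Measure.map fun m : ℕ → ℝ => m 0) hXZ
    rw [Measure.map_map (measurable_pi_apply 0) (measurable_pi_lambda _ fun n => hX.measurable _),
      Measure.map_map (measurable_pi_apply 0) (measurable_pi_lambda _ hZm)] at this
    exact this.symm
  have hlaw := hXZ.trans hZ.map_eq
  rw [hinit] at hlaw
  have hα := hRV.index_pos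
  have h0 := hRV.nonneg
  have h1 := hRV.le_one
  obtain ⟨κ', κ, hκ', hκ, hcanon, hlim⟩ :=
    TailChain.exists_canonical_limit hX hRV hZ.measurable_map hlaw hφ
  have hprob := TailChain.isProbabilityMeasure_canonLaw (κ' := κ') (κ := κ) hα h0 h1
  refine ⟨⟨_, _, _, hprob, _, _, hcanon⟩, fun P' _ Y M h s t => ?_⟩
  -- An arbitrary admissible pair has the joint law of the canonical one, by uniqueness, so a single
  -- limit computation covers all of them.
  have hjoint : (TailChain.jointLaw P' Y M s t : Measure (ℝ × (Fin (s + t + 1) → ℝ))) =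
      ((TailChain.tailProcess p α κ' κ).restrict {m | 1 < |m 0|}).map (TailChain.polar s t) :=
    (h.map_eq hα h0 h1 hcanon s t).trans (TailChain.map_canonLaw_eq_polar hα h0 h1 s t)
  refine TailChain.tendsto_finiteMeasure_of_lipschitz (fun x => ?_) ?_ fun f C L hC hL => ?_
  · have : P {ω | x < |X 0 ω|} ≠ 0 := fun h => by
      have := hRV.tail_pos x
      rw [measureReal_def, h] at this
      simp at this
    have := cond_isProbabilityMeasure this
    exact Measure.isProbabilityMeasure_map ((hX.measurable 0).norm.div_const x |>.prodMk
      (measurable_pi_lambda _ fun i => (hX.measurable _).div (hX.measurable 0).norm)).aemeasurable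
  · exact Measure.isProbabilityMeasure_map (h.measurable.prodMk
      (measurable_pi_lambda _ fun i => h.bftc.measurable _)).aemeasurable
  · rw [hjoint, integral_map (TailChain.measurable_polar s t).aemeasurable
      hL.continuous.aestronglyMeasurable]
    exact hlim s t f C L hC hL
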